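/- **Graded manifolds.** All algebras are $\mathbb Z_2$-graded; $\tilde f$ denotes parity. A weighted coordinate system consists of even coordinates $x^1,\dots,x^n$ of weight $0$ ranging over an open set $V\subset\mathbb R^n$, finitely many further even coordinates $y^e$ and finitely many odd coordinates $\xi^o$, where the $y^e$ and $\xi^o$ carry integer weights independent of their parities; its algebra of functions is $C^\infty(V)\otimes\mathbb R[y]\otimes\Lambda[\xi]$ (smooth in the $x$'s, polynomial in the $y$'s). A graded manifold is given by an atlas of such coordinate systems whose changes of coordinates are isomorphisms of the algebras of functions over overlaps, compatible with restriction and on triple overlaps, and preserving parity and weight. It is called strict if every $y^e$ has nonzero weight (so that functions are exactly the smooth functions polynomial in the coordinates of nonzero weight). A vector field is a derivation of the algebras of functions; it has weight $q$ if it raises weights by $q$. It is homological if it is odd and has square zero. A bracket has weight $p$ if $w(\{f,g\})=w(f)+w(g)+p$ for homogeneous $f,g$. A graded Q-manifold is a graded manifold with a homological vector field homogeneous of some weight. A graded QP-manifold is a graded manifold with a homological vector field $\hat Q$ of weight $q$ and an even Poisson bracket $\{\ ,\ \}_P$ of weight $p$ such that $\hat Q$ is a derivation of the bracket. **The anticotangent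 bundle.** Write now $x^a$ for all coordinates of a chart of $M$ (of parity $\tilde a$). On $\Pi T^*M$ there are the coordinates $x^a,x^*_a$, where $x^*_a$ has parity $\tilde a+1$, functions are polynomial in the fibre coordinates $x^*_a$, and $x^*_{a}=\frac{\partial x^{a'}}{\partial x^{a}}x^*_{a'}$ under a change of coordinates. The induced weight $w$ is given by $w(x^*_a)=-w(x^a)$ with the $x^a$ keeping their weights, and the fibrewise degree by $d(x^a)=0$, $d(x^*_a)=1$. The canonical Schouten bracket is $$\{f,g\}=\sum_a(-1)^{(\tilde a+1)(\tilde f+1)}\frac{\partial f}{\partial x^*_a}\frac{\partial g}{\partial x^a}-(-1)^{\tilde a(\tilde f+1)}\frac{\partial f}{\partial x^a}\frac{\partial g}{\partial x^*_a}.$$ **Theorem 5.2.** Let $M$ be a graded QP-manifold with homological field $\hat Q=Q^a\frac{\partial}{\partial x^a}$ of weight $q$ and Poisson bracket $\{\ ,\ \}_P$ of weight $p$, and let $\lambda\in\mathbb R$. Put $Q'=-Q^ax^*_a$ and $P=\tfrac12P^{ab}x^*_bx^*_a$, where $\{x^a,x^b\}_P=(-1)^{\tilde a}P^{ab}$, and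 let $X_{Q'}=\{Q',\ \}$, $X_P=\{P,\ \}$. Then $\Pi T^*M$ with the total weight $w+(q-p)d$ is a graded manifold, $\hat Q_D=X_{Q'}+\lambda X_P$ is a (globally defined) homological vector field on it, and $\hat Q_D$ has weight $q$. Thus $\Pi T^*M$ with $\hat Q_D$ is a graded Q-manifold. Moreover, if $M$ is strict and no odd coordinate of $M$ has weight $q-p$, then the graded manifold $\Pi T^*M$ is strict. -/

import Mathlib

open TopologicalSpace
open scoped ContDiff TensorProduct

noncomputable section

namespace GradedMfd

/-! ## Smooth functions on an open subset of `ℝⁿ` -/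

/-- Extension by zero of a function on an open set; only its values on that set are ever used. -/
def extendZero {n : ℕ} {V : Opens (Fin n → ℝ)} (f : V → ℝ) : (Fin n → ℝ) → ℝ :=
  Function.extend Subtype.val f 0

theorem extendZero_apply {n : ℕ} {V : Opens (Fin n → ℝ)} (f : V → ℝ) (x : V) :
    extendZero f x = f x :=
  Subtype.val_injective.extend_apply f 0 x

/-- A function on `V` is smooth if it agrees on `V` with a map that is smooth on `V`. -/
theorem contDiffOn_extendZero {n : ℕ} {V : Opens (Fin n → ℝ)} {f : V → ℝ} {F : (Fin n → ℝ) → ℝ}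
    (hF : ContDiffOn ℝ ∞ F V) (h : ∀ x : V, f x = F x) : ContDiffOn ℝ ∞ (extendZero f) V :=
  hF.congr fun x hx => by rw [← h ⟨x, hx⟩]; exact extendZero_apply f ⟨x, hx⟩

/-- The algebra `C^∞(V)` of smooth real functions on an open set `V ⊆ ℝⁿ`. -/
def Smooth {n : ℕ} (V : Opens (Fin n → ℝ)) : Subalgebra ℝ (V → ℝ) where
  carrier := {f | ContDiffOn ℝ ∞ (extendZero f) V}
  mul_mem' {f g} hf hg := contDiffOn_extendZero (hf.mul hg) fun x => by
    simp [extendZero_apply]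
  add_mem' {f g} hf hg := contDiffOn_extendZero (hf.add hg) fun x => by
    simp [extendZero_apply]
  algebraMap_mem' r := contDiffOn_extendZero (contDiffOn_const (c := r)) fun x => rfl

/-- The coordinate function `x^a` in `C^∞(V)`. -/
def Smooth.coord {n : ℕ} (V : Opens (Fin n → ℝ)) (a : Fin n) : Smooth V :=
  ⟨fun x => (x : Fin n → ℝ) a,
    contDiffOn_extendZero (contDiff_apply ℝ ℝ a).contDiffOn fun _ => rfl⟩

/-- Restriction `C^∞(V) → C^∞(V')` for `V' ⊆ V`. -/
def Smooth.res {n : ℕ} {V V' : Opens (Fin n → ℝ)} (h : V' ≤ V) : Smooth V →ₐ[ℝ] Smooth V' where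
  toFun f := ⟨fun x => f.1 ⟨x, h x.2⟩,
    contDiffOn_extendZero (ContDiffOn.mono f.2 h) fun x => (extendZero_apply f.1 ⟨x, h x.2⟩).symm⟩
  map_one' := rfl
  map_mul' _ _ := rfl
  map_zero' := rfl
  map_add' _ _ := rfl
  commutes' _ := rfl

theorem differentiableAt_extendZero {n : ℕ} {V : Opens (Fin n → ℝ)} (f : Smooth V) (x : V) :
    DifferentiableAt ℝ (extendZero f.1) x :=
  (ContDiffOn.contDiffAt f.2 (V.isOpen.mem_nhds x.2)).differentiableAt (by simp)

/-- The partial derivative `∂/∂x^a` on `C^∞(V)`. -/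
def Smooth.pd {n : ℕ} {V : Opens (Fin n → ℝ)} (a : Fin n) : Smooth V →ₗ[ℝ] Smooth V where
  toFun f := ⟨fun x => fderiv ℝ (extendZero f.1) x (Pi.single a 1),
    contDiffOn_extendZero
      ((ContDiffOn.fderiv_of_isOpen (m := ∞) f.2 V.isOpen (by simp)).clm_apply
        contDiffOn_const) fun _ => rfl⟩
  map_add' f g := by
    ext x
    have h : extendZero (f + g).1 =ᶠ[nhds (x : Fin n → ℝ)] extendZero f.1 + extendZero g.1 := by
      filter_upwards [V.isOpen.mem_nhds x.2] with y hy
      have := extendZero_apply (f + g).1 ⟨y, hy⟩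
      have h1 := extendZero_apply f.1 ⟨y, hy⟩
      have h2 := extendZero_apply g.1 ⟨y, hy⟩
      simp only at this h1 h2
      rw [this, Pi.add_apply, h1, h2]
      rfl
    change fderiv ℝ (extendZero (f + g).1) x _ = fderiv ℝ (extendZero f.1) x _ +
      fderiv ℝ (extendZero g.1) x _
    rw [h.fderiv_eq, fderiv_add (differentiableAt_extendZero f x) (differentiableAt_extendZero g x)]
    rfl
  map_smul' r f := by
    ext x
    have h : extendZero (r • f).1 =ᶠ[nhds (x : Fin n → ℝ)] r • extendZero f.1 := by
      filter_upwards [V.isOpen.mem_nhds x.2] with y hy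
      have := extendZero_apply (r • f).1 ⟨y, hy⟩
      have h1 := extendZero_apply f.1 ⟨y, hy⟩
      simp only at this h1
      rw [this, Pi.smul_apply, h1]
      rfl
    change fderiv ℝ (extendZero (r • f).1) x _ = r • fderiv ℝ (extendZero f.1) x _
    rw [h.fderiv_eq, fderiv_const_smul (differentiableAt_extendZero f x)]
    rfl

/-! ## Coordinate systems and their algebras of functions -/

/-- The type of a weighted coordinate system: `n` even coordinates of weight zero on which functions
depend smoothly, further even coordinates `Ev` on which functions depend polynomially, and odd
coordinates `Od`. The coordinates in `Ev` and `Od` carry arbitrary integer weights, independent of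
their parities. -/
structure CoordType where
  n : ℕ
  Ev : Type
  Od : Type
  [fintypeEv : Fintype Ev]
  [fintypeOd : Fintype Od]
  [decEqEv : DecidableEq Ev]
  [decEqOd : DecidableEq Od]
  wEv : Ev → ℤ
  wOd : Od → ℤ

attribute [instance] CoordType.fintypeEv CoordType.fintypeOd CoordType.decEqEv CoordType.decEqOd

/-- No polynomial even coordinate has weight zero: the functions are exactly the smooth functions
that are polynomial in the coordinates of nonzero weight. -/
def CoordType.Strict (c : CoordType) : Prop := ∀ e, c.wEv e ≠ 0

/-- All coordinates: smooth even ones, polynomial even ones, odd ones. -/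
abbrev CoordType.Coord (c : CoordType) : Type := Fin c.n ⊕ (c.Ev ⊕ c.Od)

/-- Parity of a coordinate. -/
def CoordType.par (c : CoordType) : c.Coord → ℕ :=
  Sum.elim (fun _ => 0) (Sum.elim (fun _ => 0) (fun _ => 1))

/-- Weight of a coordinate. -/
def CoordType.wt (c : CoordType) : c.Coord → ℤ :=
  Sum.elim (fun _ => 0) (Sum.elim c.wEv c.wOd)

/-- The algebra `C^∞(V) ⊗ ℝ[y] ⊗ Λ[ξ]` of functions on the coordinate domain `V × ℝ^Ev`, with odd
coordinates `ξ` indexed by `Od`. -/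
def Model (c : CoordType) (V : Opens (Fin c.n → ℝ)) : Type :=
  Smooth V ⊗[ℝ] (MvPolynomial c.Ev ℝ ⊗[ℝ] ExteriorAlgebra ℝ (c.Od → ℝ))

instance (c : CoordType) (V : Opens (Fin c.n → ℝ)) : Ring (Model c V) :=
  inferInstanceAs (Ring (Smooth V ⊗[ℝ] (MvPolynomial c.Ev ℝ ⊗[ℝ] ExteriorAlgebra ℝ (c.Od → ℝ))))

instance (c : CoordType) (V : Opens (Fin c.n → ℝ)) : Algebra ℝ (Model c V) :=
  inferInstanceAs
    (Algebra ℝ (Smooth V ⊗[ℝ] (MvPolynomial c.Ev ℝ ⊗[ℝ] ExteriorAlgebra ℝ (c.Od → ℝ))))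

namespace Model

variable {c : CoordType} {V : Opens (Fin c.n → ℝ)}

/-- The element `s ⊗ p ⊗ u` of the algebra of functions. -/
def mk (s : Smooth V) (p : MvPolynomial c.Ev ℝ) (u : ExteriorAlgebra ℝ (c.Od → ℝ)) : Model c V :=
  s ⊗ₜ[ℝ] (p ⊗ₜ[ℝ] u)

/-- Smooth functions of the smooth coordinates, as functions of all coordinates. -/
def ofSmooth (c : CoordType) {V : Opens (Fin c.n → ℝ)} : Smooth V →ₐ[ℝ] Model c V :=
  (Algebra.TensorProduct.includeLeft :
    Smooth V →ₐ[ℝ] Smooth V ⊗[ℝ] (MvPolynomial c.Ev ℝ ⊗[ℝ] ExteriorAlgebra ℝ (c.Od → ℝ)))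

/-- The coordinates as elements of the algebra of functions. -/
def x : c.Coord → Model c V
  | .inl a => mk (Smooth.coord V a) 1 1
  | .inr (.inl e) => mk 1 (MvPolynomial.X e) 1
  | .inr (.inr o) => mk 1 1 (ExteriorAlgebra.ι ℝ (Pi.single o 1))

/-- A triple of linear maps acting on the three tensor factors. -/
def map₃ (α : Smooth V →ₗ[ℝ] Smooth V) (β : MvPolynomial c.Ev ℝ →ₗ[ℝ] MvPolynomial c.Ev ℝ)
    (γ : ExteriorAlgebra ℝ (c.Od → ℝ) →ₗ[ℝ] ExteriorAlgebra ℝ (c.Od → ℝ)) :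
    Model c V →ₗ[ℝ] Model c V :=
  (TensorProduct.map α (TensorProduct.map β γ) :
    Smooth V ⊗[ℝ] (MvPolynomial c.Ev ℝ ⊗[ℝ] ExteriorAlgebra ℝ (c.Od → ℝ)) →ₗ[ℝ]
      Smooth V ⊗[ℝ] (MvPolynomial c.Ev ℝ ⊗[ℝ] ExteriorAlgebra ℝ (c.Od → ℝ)))

/-- The left partial derivatives. In the odd directions this is the antiderivation `d⌋` determined
by `d⌋(ξ * f) = d ξ • f - ξ * d⌋f`. -/
def pd : c.Coord → (Model c V →ₗ[ℝ] Model c V)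
  | .inl a => map₃ (Smooth.pd a) LinearMap.id LinearMap.id
  | .inr (.inl e) => map₃ LinearMap.id (MvPolynomial.pderiv e).toLinearMap LinearMap.id
  | .inr (.inr o) => map₃ LinearMap.id LinearMap.id
      (CliffordAlgebra.contractLeft (Q := (0 : QuadraticForm ℝ (c.Od → ℝ))) (LinearMap.proj o))

/-- The parity involution `f ↦ (-1)^{f̃} f`. -/
def sigma : Model c V →ₐ[ℝ] Model c V :=
  (Algebra.TensorProduct.map (AlgHom.id ℝ _)
    (Algebra.TensorProduct.map (AlgHom.id ℝ _) CliffordAlgebra.involute) :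
    Smooth V ⊗[ℝ] (MvPolynomial c.Ev ℝ ⊗[ℝ] ExteriorAlgebra ℝ (c.Od → ℝ)) →ₐ[ℝ]
      Smooth V ⊗[ℝ] (MvPolynomial c.Ev ℝ ⊗[ℝ] ExteriorAlgebra ℝ (c.Od → ℝ)))

/-- `f` is homogeneous of parity `s` (only `s` modulo 2 matters). -/
def HasParity (s : ℕ) (f : Model c V) : Prop := sigma f = (-1 : ℝ) ^ s • f

/-- The Euler operator `∑ w_a x^a ∂/∂x^a`, which multiplies each monomial by its weight. -/
def euler : Model c V →ₗ[ℝ] Model c V :=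
  ∑ a : c.Coord, (c.wt a : ℝ) • (LinearMap.mulLeft ℝ (x a : Model c V) ∘ₗ pd a)

/-- `f` is homogeneous of weight `k`, i.e. a combination of monomials of weight `k`. -/
def HasWeight (k : ℤ) (f : Model c V) : Prop := euler f = (k : ℝ) • f

/-- Restriction of functions to a smaller domain. -/
def res {V' : Opens (Fin c.n → ℝ)} (h : V' ≤ V) : Model c V →ₐ[ℝ] Model c V' :=
  (Algebra.TensorProduct.map (Smooth.res h) (AlgHom.id ℝ _) :
    Smooth V ⊗[ℝ] (MvPolynomial c.Ev ℝ ⊗[ℝ] ExteriorAlgebra ℝ (c.Od → ℝ)) →ₐ[ℝ]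
      Smooth V' ⊗[ℝ] (MvPolynomial c.Ev ℝ ⊗[ℝ] ExteriorAlgebra ℝ (c.Od → ℝ)))

/-! ### Super-commutativity and algebra homomorphisms out of the model -/

theorem induction {P : Model c V → Prop} (zero : P 0) (add : ∀ f g, P f → P g → P (f + g))
    (tmul : ∀ s p u, P (mk s p u)) (f : Model c V) : P f := by
  refine TensorProduct.induction_on
    (motive := fun f : Smooth V ⊗[ℝ] (MvPolynomial c.Ev ℝ ⊗[ℝ] ExteriorAlgebra ℝ (c.Od → ℝ)) =>
      P (show Model c V from f)) f zero (fun s u => ?_) add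
  induction u using TensorProduct.induction_on with
  | zero => rw [TensorProduct.tmul_zero]; exact zero
  | add a b ha hb => rw [TensorProduct.tmul_add]; exact add _ _ ha hb
  | tmul p u => exact tmul s p u

theorem sigma_mk (s : Smooth V) (p : MvPolynomial c.Ev ℝ)
    (u : ExteriorAlgebra ℝ (c.Od → ℝ)) :
    sigma (mk s p u) = mk s p (CliffordAlgebra.involute u) := rfl

theorem mk_mul_mk (s s' : Smooth V) (p p' : MvPolynomial c.Ev ℝ)
    (u u' : ExteriorAlgebra ℝ (c.Od → ℝ)) :
    mk s p u * mk s' p' u' = mk (s * s') (p * p') (u * u') :=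
  (Algebra.TensorProduct.tmul_mul_tmul s s' (p ⊗ₜ[ℝ] u) (p' ⊗ₜ[ℝ] u')).trans
    (congrArg (TensorProduct.tmul ℝ (s * s')) (Algebra.TensorProduct.tmul_mul_tmul p p' u u'))

theorem mk_add (s : Smooth V) (p : MvPolynomial c.Ev ℝ) (u v : ExteriorAlgebra ℝ (c.Od → ℝ)) :
    mk s p (u + v) = mk s p u + mk s p v :=
  (congrArg (TensorProduct.tmul ℝ s) (TensorProduct.tmul_add p u v)).trans
    (TensorProduct.tmul_add s _ _)

theorem mk_smul (r : ℝ) (s : Smooth V) (p : MvPolynomial c.Ev ℝ)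
    (u : ExteriorAlgebra ℝ (c.Od → ℝ)) : mk s p (r • u) = r • mk s p u :=
  (congrArg (TensorProduct.tmul ℝ s) (TensorProduct.tmul_smul r p u)).trans
    (TensorProduct.tmul_smul r s _)

theorem mk_neg (s : Smooth V) (p : MvPolynomial c.Ev ℝ)
    (u : ExteriorAlgebra ℝ (c.Od → ℝ)) : mk s p (-u) = -mk s p u := by
  rw [← neg_one_smul ℝ u, mk_smul]
  exact neg_one_smul ℝ (mk s p u)

theorem mk_sub (s : Smooth V) (p : MvPolynomial c.Ev ℝ) (u v : ExteriorAlgebra ℝ (c.Od → ℝ)) :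
    mk s p (u - v) = mk s p u - mk s p v := by
  rw [sub_eq_add_neg, sub_eq_add_neg, mk_add, mk_neg]

theorem ext_commute {M : Type} [AddCommGroup M] [Module ℝ M] (u f : ExteriorAlgebra ℝ M) :
    (2 : ℝ) • (u * f) = f * (u + CliffordAlgebra.involute u) +
      CliffordAlgebra.involute f * (u - CliffordAlgebra.involute u) := by
  have key : ∀ (v : M) (f : ExteriorAlgebra ℝ M), ExteriorAlgebra.ι ℝ v * f =
      CliffordAlgebra.involute f * ExteriorAlgebra.ι ℝ v := by
    intro v f
    induction f using ExteriorAlgebra.induction with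
    | algebraMap r => simp [Algebra.commutes]
    | ι w =>
      have h := CliffordAlgebra.involute_ι (Q := (0 : QuadraticForm ℝ M)) w
      change ExteriorAlgebra.ι ℝ v * ExteriorAlgebra.ι ℝ w = CliffordAlgebra.involute
        (CliffordAlgebra.ι (0 : QuadraticForm ℝ M) w) * ExteriorAlgebra.ι ℝ v
      rw [h]
      have := ExteriorAlgebra.ι_add_mul_swap (R := ℝ) v w
      rw [neg_mul]
      exact eq_neg_of_add_eq_zero_left this
    | mul a b ha hb => rw [← mul_assoc, ha, mul_assoc, hb, map_mul, mul_assoc]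
    | add a b ha hb => rw [mul_add, ha, hb, map_add, add_mul]
  induction u using CliffordAlgebra.left_induction generalizing f with
  | algebraMap r =>
    rw [AlgHom.commutes, sub_self, mul_zero, add_zero, ← two_smul ℝ, mul_smul_comm]
    exact congrArg _ (Algebra.commutes r f)
  | add a b ha hb =>
    rw [add_mul, smul_add, ha, hb, map_add]
    simp only [mul_add, mul_sub]
    abel
  | ι_mul a v ha =>
    have k := key v f
    have k' := key v (CliffordAlgebra.involute f)
    rw [CliffordAlgebra.involute_involute] at k'
    rw [mul_assoc, ← mul_smul_comm, ha f, map_mul, CliffordAlgebra.involute_ι]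
    change ExteriorAlgebra.ι ℝ v * _ = f * (ExteriorAlgebra.ι ℝ v * a + -ExteriorAlgebra.ι ℝ v * _) +
      _ * (ExteriorAlgebra.ι ℝ v * a - -ExteriorAlgebra.ι ℝ v * _)
    rw [mul_add, ← mul_assoc, ← mul_assoc, k, k']
    simp only [mul_add, mul_sub, neg_mul, mul_neg, mul_assoc, sub_neg_eq_add]
    abel

theorem super_commute (u f : Model c V) :
    (2 : ℝ) • (u * f) = f * (u + sigma u) + sigma f * (u - sigma u) := by
  induction u using Model.induction with
  | zero => simp
  | add a b ha hb =>
    rw [add_mul, smul_add, ha, hb, map_add]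
    simp only [mul_add, mul_sub]
    abel
  | tmul s p u =>
  induction f using Model.induction with
  | zero => simp
  | add a b ha hb =>
    rw [mul_add, smul_add, ha, hb, map_add]
    simp only [add_mul]
    abel
  | tmul s' p' f =>
    simp only [sigma_mk, ← mk_add, ← mk_sub, mk_mul_mk, ← mk_smul, ext_commute u f]
    rw [mul_comm s, mul_comm p]

theorem HasParity.even_commute {u : Model c V} (h : HasParity 0 u) (f : Model c V) :
    u * f = f * u := by
  have := super_commute u f
  rw [HasParity, pow_zero, one_smul] at h
  rw [h, sub_self, mul_zero, add_zero, ← two_smul ℝ u, mul_smul_comm] at this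
  exact smul_right_injective _ (two_ne_zero' ℝ) this

theorem HasParity.odd_sq {u : Model c V} (h : HasParity 1 u) : u * u = 0 := by
  have := super_commute u u
  rw [HasParity, pow_one, neg_smul, one_smul] at h
  rw [h, add_neg_cancel, mul_zero, zero_add, sub_neg_eq_add, ← two_smul ℝ u, mul_smul_comm,
    neg_mul, smul_neg] at this
  have h2 : (4 : ℝ) • (u * u) = 0 := by
    have h3 := add_eq_zero_iff_eq_neg.mpr this
    rw [← add_smul] at h3
    norm_num at h3 ⊢
    exact h3
  exact (smul_eq_zero.mp h2).resolve_left (by norm_num)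

theorem HasParity.add {s : ℕ} {f g : Model c V} (hf : HasParity s f) (hg : HasParity s g) :
    HasParity s (f + g) := by
  rw [HasParity] at *
  rw [map_add, hf, hg, smul_add]

theorem HasParity.smul {s : ℕ} {f : Model c V} (r : ℝ) (hf : HasParity s f) :
    HasParity s (r • f) := by
  rw [HasParity] at *
  rw [map_smul, hf, smul_comm]

theorem HasParity.sum {ι : Type} [Fintype ι] {s : ℕ} {f : ι → Model c V}
    (hf : ∀ i, HasParity s (f i)) : HasParity s (∑ i, f i) := by
  rw [HasParity, map_sum, Finset.smul_sum]
  exact Finset.sum_congr rfl fun i _ => hf i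

theorem HasParity.mul {s t : ℕ} {f g : Model c V} (hf : HasParity s f) (hg : HasParity t g) :
    HasParity (s + t) (f * g) := by
  rw [HasParity] at *
  rw [map_mul, hf, hg, smul_mul_smul_comm, pow_add]

theorem HasParity.congr {s t : ℕ} {f : Model c V} (hf : HasParity s f) (h : s % 2 = t % 2) :
    HasParity t f := by
  rw [HasParity] at *
  rw [hf, neg_one_pow_eq_pow_mod_two, h, ← neg_one_pow_eq_pow_mod_two]

theorem hasParity_ofSmooth (s : Smooth V) : HasParity 0 (ofSmooth c s) := by
  rw [HasParity, pow_zero, one_smul]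
  change sigma (mk s 1 1) = mk s 1 1
  rw [sigma_mk, map_one]

theorem hasParity_x (a : c.Coord) : HasParity (c.par a) (x (V := V) a) := by
  rw [HasParity]
  rcases a with a | e | o
  · change sigma (mk _ 1 1) = (-1 : ℝ) ^ 0 • mk _ 1 1
    rw [sigma_mk, map_one, pow_zero, one_smul]
  · change sigma (mk 1 _ 1) = (-1 : ℝ) ^ 0 • mk 1 _ 1
    rw [sigma_mk, map_one, pow_zero, one_smul]
  · change sigma (mk 1 1 (CliffordAlgebra.ι _ _)) = (-1 : ℝ) ^ 1 • mk 1 1 (CliffordAlgebra.ι _ _)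
    rw [sigma_mk, CliffordAlgebra.involute_ι, pow_one, neg_smul, one_smul, mk_neg]

theorem involute_contractLeft {M : Type} [AddCommGroup M] [Module ℝ M]
    (d : Module.Dual ℝ M) (u : CliffordAlgebra (0 : QuadraticForm ℝ M)) :
    CliffordAlgebra.involute (CliffordAlgebra.contractLeft d u) =
      -CliffordAlgebra.contractLeft d (CliffordAlgebra.involute u) := by
  induction u using CliffordAlgebra.left_induction with
  | algebraMap r => simp
  | add a b ha hb => simp only [map_add, ha, hb, neg_add]
  | ι_mul a v ha =>
    simp only [CliffordAlgebra.contractLeft_ι_mul, map_sub, map_smul, map_mul,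
      CliffordAlgebra.involute_ι, ha, neg_mul, map_neg]
    simp

theorem sigma_pd (a : c.Coord) (f : Model c V) :
    sigma (pd a f) = (-1 : ℝ) ^ c.par a • pd a (sigma f) := by
  induction f using Model.induction with
  | zero => simp
  | add f g hf hg => simp only [map_add, hf, hg, smul_add]
  | tmul s p u =>
  rcases a with a | e | o
  · change mk _ _ _ = (-1 : ℝ) ^ 0 • mk _ _ _
    rw [pow_zero, one_smul]
    rfl
  · change mk _ _ _ = (-1 : ℝ) ^ 0 • mk _ _ _
    rw [pow_zero, one_smul]
    rfl
  · change mk s p (CliffordAlgebra.involute (CliffordAlgebra.contractLeft _ u)) =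
      (-1 : ℝ) ^ 1 • mk s p (CliffordAlgebra.contractLeft _ (CliffordAlgebra.involute u))
    rw [involute_contractLeft, pow_one, neg_smul, one_smul, mk_neg]

theorem HasParity.pd {s : ℕ} {f : Model c V} (hf : HasParity s f) (a : c.Coord) :
    HasParity (c.par a + s) (pd a f) := by
  rw [HasParity] at *
  rw [sigma_pd, hf, map_smul, smul_smul, pow_add]

/-- The algebra homomorphism out of `C^∞(V) ⊗ ℝ[y] ⊗ Λ[ξ]` with prescribed values on `C^∞(V)`, on
the polynomial even coordinates (even values) and on the odd coordinates (odd values). -/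
def lift {c' : CoordType} {V' : Opens (Fin c'.n → ℝ)} (gS : Smooth V →ₐ[ℝ] Model c' V')
    (gE : c.Ev → Model c' V') (gO : c.Od → Model c' V') (hS : ∀ s, HasParity 0 (gS s))
    (hE : ∀ e, HasParity 0 (gE e)) (hO : ∀ o, HasParity 1 (gO o)) :
    Model c V →ₐ[ℝ] Model c' V' :=
  (Algebra.TensorProduct.lift gS
    (Algebra.TensorProduct.lift
      ((Subalgebra.center ℝ (Model c' V')).val.comp
        (MvPolynomial.aeval fun e => (⟨gE e, Subalgebra.mem_center_iff.mpr fun f =>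
          ((hE e).even_commute f).symm⟩ : Subalgebra.center ℝ (Model c' V'))))
      (ExteriorAlgebra.lift ℝ
        ⟨∑ o, (LinearMap.proj (R := ℝ) (φ := fun _ : c.Od => ℝ) o).smulRight (gO o), fun v => by
          refine HasParity.odd_sq ?_
          rw [LinearMap.sum_apply]
          exact HasParity.sum fun o => (hO o).smul (v o)⟩)
      fun p _ => Subalgebra.mem_center_iff.mp (Subtype.property _) _ |>.symm)
    (fun s _ => (hS s).even_commute _) :
    Smooth V ⊗[ℝ] (MvPolynomial c.Ev ℝ ⊗[ℝ] ExteriorAlgebra ℝ (c.Od → ℝ)) →ₐ[ℝ] Model c' V')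

theorem hom_ext {A : Type} [Ring A] [Algebra ℝ A] {g h : Model c V →ₐ[ℝ] A}
    (hS : ∀ s, g (ofSmooth c s) = h (ofSmooth c s))
    (hx : ∀ a : c.Ev ⊕ c.Od, g (x (Sum.inr a)) = h (x (Sum.inr a))) : g = h := by
  refine Algebra.TensorProduct.ext (R := ℝ) (S := ℝ) (A := Smooth V)
    (B := MvPolynomial c.Ev ℝ ⊗[ℝ] ExteriorAlgebra ℝ (c.Od → ℝ)) (C := A)
    (f := g) (g := h) (AlgHom.ext hS) ?_
  refine Algebra.TensorProduct.ext (MvPolynomial.algHom_ext fun e => hx (Sum.inl e))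
    (ExteriorAlgebra.hom_ext (LinearMap.pi_ext' fun o => LinearMap.ext_ring (hx (Sum.inr o))))

theorem lift_ofSmooth {c' : CoordType} {V' : Opens (Fin c'.n → ℝ)} (gS : Smooth V →ₐ[ℝ] Model c' V')
    (gE : c.Ev → Model c' V') (gO : c.Od → Model c' V') (hS : ∀ s, HasParity 0 (gS s))
    (hE : ∀ e, HasParity 0 (gE e)) (hO : ∀ o, HasParity 1 (gO o)) (s : Smooth V) :
    lift gS gE gO hS hE hO (ofSmooth c s) = gS s := by
  refine (Algebra.TensorProduct.lift_tmul _ _ _ s 1).trans ?_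
  rw [map_one, mul_one]

theorem lift_x_ev {c' : CoordType} {V' : Opens (Fin c'.n → ℝ)} (gS : Smooth V →ₐ[ℝ] Model c' V')
    (gE : c.Ev → Model c' V') (gO : c.Od → Model c' V') (hS : ∀ s, HasParity 0 (gS s))
    (hE : ∀ e, HasParity 0 (gE e)) (hO : ∀ o, HasParity 1 (gO o)) (e : c.Ev) :
    lift gS gE gO hS hE hO (x (Sum.inr (Sum.inl e))) = gE e := by
  refine (Algebra.TensorProduct.lift_tmul _ _ _ 1 _).trans ?_
  rw [map_one, one_mul]
  refine (Algebra.TensorProduct.lift_tmul _ _ _ _ 1).trans ?_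
  rw [map_one, mul_one]
  simp

theorem lift_x_od {c' : CoordType} {V' : Opens (Fin c'.n → ℝ)} (gS : Smooth V →ₐ[ℝ] Model c' V')
    (gE : c.Ev → Model c' V') (gO : c.Od → Model c' V') (hS : ∀ s, HasParity 0 (gS s))
    (hE : ∀ e, HasParity 0 (gE e)) (hO : ∀ o, HasParity 1 (gO o)) (o : c.Od) :
    lift gS gE gO hS hE hO (x (Sum.inr (Sum.inr o))) = gO o := by
  refine (Algebra.TensorProduct.lift_tmul _ _ _ 1 _).trans ?_
  rw [map_one, one_mul]
  refine (Algebra.TensorProduct.lift_tmul _ _ _ 1 _).trans ?_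
  rw [map_one, one_mul, ExteriorAlgebra.lift_ι_apply]
  simp [Pi.single_apply]

end Model

/-! ## Graded manifolds -/

/-- The data of an atlas of weighted charts. The space `X` underlies the smooth coordinates (weight
zero, even); the domain of chart `i` is the cylinder over `(chart i).source` in the direction of the
polynomial even coordinates. The homomorphism `trans i j W` is the change of coordinates over
`W`: it rewrites functions of the `j`-th coordinates as functions of the `i`-th coordinates. -/
structure GradedAtlas (X : Type*) [TopologicalSpace X] where
  ι : Type*
  coord : ι → CoordType
  chart : ∀ i, OpenPartialHomeomorph X (Fin (coord i).n → ℝ)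
  trans : ∀ (i j : ι) (W : Opens X), (W : Set X) ⊆ (chart i).source ∩ (chart j).source →
    (Model (coord j) ⟨chart j '' ((chart j).source ∩ W),
        (chart j).isOpen_image_source_inter W.isOpen⟩ →ₐ[ℝ]
      Model (coord i) ⟨chart i '' ((chart i).source ∩ W),
        (chart i).isOpen_image_source_inter W.isOpen⟩)

namespace GradedAtlas

variable {X : Type*} [TopologicalSpace X] (M : GradedAtlas X)

/-- The image in chart `i` of (the part in the chart domain of) an open set `W`. -/
def img (i : M.ι) (W : Opens X) : Opens (Fin (M.coord i).n → ℝ) :=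
  ⟨M.chart i '' ((M.chart i).source ∩ W), (M.chart i).isOpen_image_source_inter W.isOpen⟩

theorem img_mono (i : M.ι) {W' W : Opens X} (h : W' ≤ W) : M.img i W' ≤ M.img i W :=
  Set.image_mono (Set.inter_subset_inter_right _ h)

/-- Functions over `W` (intersected with the domain of chart `i`), written in chart `i`. -/
abbrev Fn (i : M.ι) (W : Opens X) : Type := Model (M.coord i) (M.img i W)

/-- Restriction of functions. -/
def res (i : M.ι) {W' W : Opens X} (h : W' ≤ W) : M.Fn i W →ₐ[ℝ] M.Fn i W' :=
  Model.res (M.img_mono i h)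

/-- `W` is contained in the domains of the charts `i` and `j`. -/
def Small (i j : M.ι) (W : Opens X) : Prop :=
  (W : Set X) ⊆ (M.chart i).source ∩ (M.chart j).source

/-- The change of coordinates over `W`, as a homomorphism of algebras of functions. -/
def tr (i j : M.ι) (W : Opens X) (h : M.Small i j W) : M.Fn j W →ₐ[ℝ] M.Fn i W :=
  M.trans i j W h

theorem Small.symm {M : GradedAtlas X} {i j : M.ι} {W : Opens X} (h : M.Small i j W) :
    M.Small j i W := fun _ hx => ⟨(h hx).2, (h hx).1⟩

/-- The atlas defines a graded manifold: the charts cover, and the changes of coordinates preserve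
parity and weight, are compatible with restrictions, and satisfy the cocycle conditions (in
particular they are invertible). -/
structure IsGradedManifold : Prop where
  cover : ∀ x : X, ∃ i, x ∈ (M.chart i).source
  tr_parity : ∀ i j W h (s : ℕ) (f : M.Fn j W), f.HasParity s → (M.tr i j W h f).HasParity s
  tr_weight : ∀ i j W h (k : ℤ) (f : M.Fn j W), f.HasWeight k → (M.tr i j W h f).HasWeight k
  tr_res : ∀ i j W h W' h' (hW : W' ≤ W) (f : M.Fn j W),
    M.res i hW (M.tr i j W h f) = M.tr i j W' h' (M.res j hW f)
  tr_self : ∀ i W h (f : M.Fn i W), M.tr i i W h f = f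
  tr_tr : ∀ i j k W hij hjk hik (f : M.Fn k W),
    M.tr i j W hij (M.tr j k W hjk f) = M.tr i k W hik f

/-! ## Vector fields and Poisson brackets -/

/-- A family of linear operators on functions, one for each chart and each open set. -/
abbrev Operator : Type _ := ∀ (i : M.ι) (W : Opens X), M.Fn i W →ₗ[ℝ] M.Fn i W

/-- A family of bilinear operations on functions, one for each chart and each open set. -/
abbrev BiOperator : Type _ := ∀ (i : M.ι) (W : Opens X), M.Fn i W →ₗ[ℝ] M.Fn i W →ₗ[ℝ] M.Fn i W

/-- A vector field of parity `r`: a derivation of parity `r` of the algebras of functions,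
compatible with restrictions and changes of coordinates. -/
structure IsVectorField (r : ℕ) (Y : M.Operator) : Prop where
  parity : ∀ i W (s : ℕ) (f : M.Fn i W), f.HasParity s → (Y i W f).HasParity (r + s)
  leibniz : ∀ i W (s : ℕ) (f g : M.Fn i W), f.HasParity s →
    Y i W (f * g) = Y i W f * g + (-1 : ℝ) ^ (r * s) • (f * Y i W g)
  map_res : ∀ i W' W (hW : W' ≤ W) (f : M.Fn i W), M.res i hW (Y i W f) = Y i W' (M.res i hW f)
  map_tr : ∀ i j W h (f : M.Fn j W), M.tr i j W h (Y j W f) = Y i W (M.tr i j W h f)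

/-- A homological vector field: odd and of square zero. -/
structure IsHomological (Y : M.Operator) : Prop extends M.IsVectorField 1 Y where
  sq_zero : ∀ i W (f : M.Fn i W), Y i W (Y i W f) = 0

/-- The operator has weight `q`. -/
def OperatorHasWeight (q : ℤ) (Y : M.Operator) : Prop :=
  ∀ i W (k : ℤ) (f : M.Fn i W), f.HasWeight k → (Y i W f).HasWeight (q + k)

/-- An (even) Poisson bracket on functions. -/
structure IsPoissonBracket (B : M.BiOperator) : Prop where
  parity : ∀ i W (s t : ℕ) (f g : M.Fn i W), f.HasParity s → g.HasParity t →
    (B i W f g).HasParity (s + t)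
  antisymm : ∀ i W (s t : ℕ) (f g : M.Fn i W), f.HasParity s → g.HasParity t →
    B i W f g = -((-1 : ℝ) ^ (s * t) • B i W g f)
  jacobi : ∀ i W (s t : ℕ) (f g h : M.Fn i W), f.HasParity s → g.HasParity t →
    B i W f (B i W g h) = B i W (B i W f g) h + (-1 : ℝ) ^ (s * t) • B i W g (B i W f h)
  leibniz : ∀ i W (s t : ℕ) (f g h : M.Fn i W), f.HasParity s → g.HasParity t →
    B i W f (g * h) = B i W f g * h + (-1 : ℝ) ^ (s * t) • (g * B i W f h)
  map_res : ∀ i W' W (hW : W' ≤ W) (f g : M.Fn i W),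
    M.res i hW (B i W f g) = B i W' (M.res i hW f) (M.res i hW g)
  map_tr : ∀ i j W h (f g : M.Fn j W),
    M.tr i j W h (B j W f g) = B i W (M.tr i j W h f) (M.tr i j W h g)

/-- The bracket has weight `p`. -/
def BracketHasWeight (p : ℤ) (B : M.BiOperator) : Prop :=
  ∀ i W (k l : ℤ) (f g : M.Fn i W), f.HasWeight k → g.HasWeight l →
    (B i W f g).HasWeight (p + k + l)

/-- A graded Q-manifold with homological field `Y` of weight `q`. -/
structure IsGradedQManifold (Y : M.Operator) (q : ℤ) : Prop where
  isGradedManifold : M.IsGradedManifold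
  isHomological : M.IsHomological Y
  hasWeight : M.OperatorHasWeight q Y

/-- A graded QP-manifold: a graded manifold with a homological field `Y` of weight `q` and a Poisson
bracket `B` of weight `p` such that `Y` is a derivation of the bracket. -/
structure IsGradedQPManifold (Y : M.Operator) (B : M.BiOperator) (q p : ℤ) : Prop
    extends M.IsGradedQManifold Y q where
  isPoissonBracket : M.IsPoissonBracket B
  bracketHasWeight : M.BracketHasWeight p B
  derivation : ∀ i W (s : ℕ) (f g : M.Fn i W), f.HasParity s →
    Y i W (B i W f g) = B i W (Y i W f) g + (-1 : ℝ) ^ s • B i W f (Y i W g)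

end GradedAtlas

/-! ## The anticotangent bundle -/

/-- Coordinates `x^a, x^*_a` on the anticotangent bundle. The fibre coordinate `x^*_a` has parity
opposite to that of `x^a`; functions are polynomial in the fibre coordinates. The weight is
`w + κ d` with `w` the induced weight (`w(x^*_a) = -w(x^a)`) and `d` the fibrewise degree
(`d(x^a) = 0`, `d(x^*_a) = 1`). -/
abbrev CoordType.anti (c : CoordType) (κ : ℤ) : CoordType where
  n := c.n
  Ev := c.Ev ⊕ c.Od
  Od := c.Od ⊕ (Fin c.n ⊕ c.Ev)
  wEv := fun e =>
    Sum.elim c.wEv (fun o => -c.wOd o) e + κ * Sum.elim (fun _ => 0) (fun _ => 1) e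
  wOd := fun o =>
    Sum.elim c.wOd (Sum.elim (fun _ => 0) (fun e => -c.wEv e)) o +
      κ * Sum.elim (fun _ => 0) (fun _ => 1) o

namespace Anti

variable {c : CoordType} {κ : ℤ}

/-- The index of the coordinate `x^a` on the anticotangent bundle. -/
def base (κ : ℤ) : c.Coord → (c.anti κ).Coord :=
  Sum.elim (fun a => Sum.inl a)
    (Sum.elim (fun e => Sum.inr (Sum.inl (Sum.inl e))) (fun o => Sum.inr (Sum.inr (Sum.inl o))))

/-- The index of the fibre coordinate `x^*_a`. -/
def fibre (κ : ℤ) : c.Coord → (c.anti κ).Coord :=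
  Sum.elim (fun a => Sum.inr (Sum.inr (Sum.inr (Sum.inl a))))
    (Sum.elim (fun e => Sum.inr (Sum.inr (Sum.inr (Sum.inr e))))
      (fun o => Sum.inr (Sum.inl (Sum.inr o))))

theorem par_base (a : c.Coord) : (c.anti κ).par (base κ a) = c.par a := by
  rcases a with a | e | o <;> rfl

theorem par_fibre (a : c.Coord) : (c.anti κ).par (fibre κ a) % 2 = (c.par a + 1) % 2 := by
  rcases a with a | e | o <;> simp [fibre, CoordType.par]

variable {V : Opens (Fin c.n → ℝ)}

/-- Pull-back of functions along the bundle projection. -/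
def pull (κ : ℤ) : Model c V →ₐ[ℝ] Model (c.anti κ) V :=
  Model.lift (Model.ofSmooth (c.anti κ)) (fun e => Model.x (base κ (Sum.inr (Sum.inl e))))
    (fun o => Model.x (base κ (Sum.inr (Sum.inr o)))) (fun s => Model.hasParity_ofSmooth (c := c.anti κ) s)
    (fun _ => Model.hasParity_x _) (fun _ => Model.hasParity_x _)

theorem pull_ofSmooth (s : Smooth V) :
    pull κ (Model.ofSmooth c s) = Model.ofSmooth (c.anti κ) s :=
  Model.lift_ofSmooth (c := c) (c' := c.anti κ) _ _ _ _ _ _ s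

theorem pull_x (a : c.Coord) : pull κ (Model.x (V := V) a) = Model.x (base κ a) := by
  rcases a with a | e | o
  · exact pull_ofSmooth (Smooth.coord V a)
  · exact Model.lift_x_ev (c := c) (c' := c.anti κ) _ _ _ _ _ _ e
  · exact Model.lift_x_od (c := c) (c' := c.anti κ) _ _ _ _ _ _ o

theorem sigma_pull (f : Model c V) : Model.sigma (pull κ f) = pull κ (Model.sigma f) := by
  have : (Model.sigma (c := c.anti κ) (V := V)).comp (pull κ) = (pull κ).comp Model.sigma := by
    refine Model.hom_ext (fun s => ?_) (fun a => ?_)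
    · have h1 := Model.hasParity_ofSmooth (c := c) s
      have h2 := Model.hasParity_ofSmooth (c := c.anti κ) s
      rw [Model.HasParity, pow_zero, one_smul] at h1 h2
      rw [AlgHom.comp_apply, AlgHom.comp_apply, h1, pull_ofSmooth]
      exact h2
    · have h1 := Model.hasParity_x (V := V) (Sum.inr a : c.Coord)
      have h2 := Model.hasParity_x (c := c.anti κ) (V := V) (base κ (Sum.inr a))
      rw [Model.HasParity] at h1 h2
      rw [par_base] at h2
      rw [AlgHom.comp_apply, AlgHom.comp_apply, h1, map_smul, pull_x, h2]
  exact DFunLike.congr_fun this f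

theorem pull_parity {s : ℕ} {f : Model c V} (hf : f.HasParity s) : (pull κ f).HasParity s := by
  rw [Model.HasParity] at *
  rw [sigma_pull, hf, map_smul]

/-- The operation `f ↦ (-1)^{k (f̃ + 1)} f`. -/
def twist (k : ℕ) (f : Model (c.anti κ) V) : Model (c.anti κ) V :=
  (-1 : ℝ) ^ k • (Model.sigma^[k] f)

/-- The canonical Schouten bracket `g ↦ {f, g}` in coordinates `x^a, x^*_a`:
`{f,g} = ∑ (-1)^{(ã+1)(f̃+1)} ∂f/∂x^*_a ∂g/∂x^a - (-1)^{ã(f̃+1)} ∂f/∂x^a ∂g/∂x^*_a`. -/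
def schouten (f : Model (c.anti κ) V) : Model (c.anti κ) V →ₗ[ℝ] Model (c.anti κ) V :=
  ∑ a : c.Coord,
    (LinearMap.mulLeft ℝ (Model.pd (fibre κ a) (twist (c.par a + 1) f)) ∘ₗ Model.pd (base κ a) -
      LinearMap.mulLeft ℝ (Model.pd (base κ a) (twist (c.par a) f)) ∘ₗ Model.pd (fibre κ a))

/-- The function `-∑ Y^a x^*_a` attached to an odd vector field `Y = ∑ Y^a ∂/∂x^a`, given by its
components `Y^a = Y x^a`. -/
def theta (κ : ℤ) (Y : Model c V →ₗ[ℝ] Model c V) : Model (c.anti κ) V :=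
  -∑ a : c.Coord, pull κ (Y (Model.x a)) * Model.x (fibre κ a)

/-- The bivector `½ ∑ P^{ab} x^*_b x^*_a` of an even bracket, `{x^a, x^b} = (-1)^ã P^{ab}`. -/
def bivector (κ : ℤ) (B : Model c V →ₗ[ℝ] Model c V →ₗ[ℝ] Model c V) : Model (c.anti κ) V :=
  (1 / 2 : ℝ) • ∑ a : c.Coord, ∑ b : c.Coord,
    pull κ ((-1 : ℝ) ^ c.par a • B (Model.x a) (Model.x b)) *
      (Model.x (fibre κ b) * Model.x (fibre κ a))

end Anti

namespace GradedAtlas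

variable {X : Type*} [TopologicalSpace X] (M : GradedAtlas X)

/-- The fibre coordinate `x^*_b` of chart `j` in terms of the coordinates of chart `i`:
`x^*_b = ∑ (∂x^a/∂x^b) x^*_a`, with `a` running over the coordinates of chart `i`. -/
def fibreChange (κ : ℤ) (i j : M.ι) (W : Opens X) (h : M.Small i j W) (b : (M.coord j).Coord) :
    Model ((M.coord i).anti κ) (M.img i W) :=
  ∑ a : (M.coord i).Coord,
    Anti.pull κ (M.tr i j W h (Model.pd b (M.tr j i W h.symm (Model.x a)))) *
      Model.x (Anti.fibre κ a)

variable {M}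

theorem fibreChange_parity (hM : M.IsGradedManifold) (κ : ℤ) (i j : M.ι) (W : Opens X)
    (h : M.Small i j W) (b : (M.coord j).Coord) :
    (M.fibreChange κ i j W h b).HasParity ((M.coord j).par b + 1) := by
  refine Model.HasParity.sum fun a => ?_
  refine ((Anti.pull_parity (hM.tr_parity i j W h _ _
    ((hM.tr_parity j i W h.symm _ _ (Model.hasParity_x a)).pd b))).mul
      (Model.hasParity_x _)).congr ?_
  have := Anti.par_fibre (κ := κ) a
  omega

/-- The anticotangent bundle `ΠT^*M` with the total weight `w + κ d`. -/
def anticotangent (hM : M.IsGradedManifold) (κ : ℤ) : GradedAtlas X where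
  ι := M.ι
  coord i := (M.coord i).anti κ
  chart i := M.chart i
  trans i j W h :=
    Model.lift (c := (M.coord j).anti κ) (c' := (M.coord i).anti κ)
      (V := M.img j W) (V' := M.img i W)
      ((Anti.pull κ).comp ((M.tr i j W h).comp (Model.ofSmooth (M.coord j))))
      (Sum.elim (fun e => Anti.pull κ (M.tr i j W h (Model.x (Sum.inr (Sum.inl e)))))
        (fun o => M.fibreChange κ i j W h (Sum.inr (Sum.inr o))))
      (Sum.elim (fun o => Anti.pull κ (M.tr i j W h (Model.x (Sum.inr (Sum.inr o)))))
        (Sum.elim (fun a => M.fibreChange κ i j W h (Sum.inl a))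
          (fun e => M.fibreChange κ i j W h (Sum.inr (Sum.inl e)))))
      (fun s => Anti.pull_parity (hM.tr_parity i j W h _ _ (Model.hasParity_ofSmooth (c := M.coord j) s)))
      (by
        rintro (e | o)
        · exact Anti.pull_parity (hM.tr_parity i j W h _ _
            (Model.hasParity_x (Sum.inr (Sum.inl e))))
        · exact (fibreChange_parity hM κ i j W h (Sum.inr (Sum.inr o))).congr
            (by simp [CoordType.par]))
      (by
        rintro (o | a | e)
        · exact Anti.pull_parity (hM.tr_parity i j W h _ _
            (Model.hasParity_x (Sum.inr (Sum.inr o))))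
        · exact fibreChange_parity hM κ i j W h (Sum.inl a)
        · exact fibreChange_parity hM κ i j W h (Sum.inr (Sum.inl e)))

/-- The vector field `X_{Q'} + lam X_P` on the anticotangent bundle, where `Q' = -∑ Q^a x^*_a`,
`P` is the bivector of the bracket and `X_f = {f, -}` for the canonical Schouten bracket. -/
def oddDouble (hM : M.IsGradedManifold) (κ : ℤ) (Q : M.Operator) (B : M.BiOperator) (lam : ℝ) :
    (anticotangent hM κ).Operator := fun i W =>
  (Anti.schouten (Anti.theta κ (Q i W)) + lam • Anti.schouten (Anti.bivector κ (B i W)) :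
    Model ((M.coord i).anti κ) (M.img i W) →ₗ[ℝ] Model ((M.coord i).anti κ) (M.img i W))

end GradedAtlas

end GradedMfd

end

/-!
Why the odd double is a graded Q-manifold.

The analytic input is that a super-derivation `D` along a homomorphism between algebras of functions
is determined by its values on the coordinates (`IsSuperDer.eq_zero`). If `D` kills the coordinates
and `p` is the point below a given point of the target, Hadamard's lemma `f = f p + ∑ (x^a - p^a) g_a`
(`Smooth.hadamard`) gives `D f = ∑ φ (x^a - p^a) D g_a`, so by induction all odd derivatives
of `D f` vanish at that point (`OddFlat`). As the point is arbitrary and functions are polynomial in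
the odd coordinates, `D f = 0` (`eq_zero_of_oddFlat`). The point `p` exists since every character of
`C^∞(V)` sends the coordinates to those of a point of `V` (`exists_point`). Consequences are the chain rule, the commutation of partial derivatives and of
Euler operators with them, and the Jacobi identity of the Schouten bracket (`schouten_jacobi`), which
only has to be checked on coordinates.

The functions `Q'` (`theta`) and `P` (`bivector`) are handled through their brackets with functions
on the base: `{Q', f} = -Q f` and `{P, f} = -(-1)^f θ_{{f, -}}`, where `θ_Y` is the function attached
to the vector field `Y`. A function of positive fibrewise degree is zero once its brackets with all
functions on the base vanish (`HasDeg.eq_zero`). With the Jacobi identity this turns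
`{Q', Q'} = {Q', P} = {P, P} = 0` into `Q² = 0`, the derivation property of `Q` and the Jacobi
identity of the Poisson bracket, so that the Hamiltonian field of `Q' + lam P` has square zero.

Independence of the chart is obtained in the same way. The lifted coordinate changes intertwine the
operators `{f, -}` for `f` on the base by the chain rule (`intertwines_pull`); by induction on the
fibrewise degree they intertwine `{Q', -}` and `{P, -}` (`intertwines_of_schouten_pull`), and they
carry `Q'` and `P` of one chart to those of the other. The weight of the field follows from the
bracket having weight `-κ` for the total weight `w + κ d`, while `Q'` and `P` have weights `q + κ` and
`p + 2κ`, which agree for `κ = q - p`.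
-/

open TopologicalSpace
open scoped ContDiff TensorProduct

noncomputable section

namespace GradedMfd

/-! ### Hadamard's lemma -/

/-- Differentiation under the integral sign, for a compact interval of integration and a smooth
integrand. -/
theorem contDiff_intervalIntegral_nat {E : Type} [NormedAddCommGroup E] [NormedSpace ℝ E]
    [FiniteDimensional ℝ E] (m : ℕ) {G : Type} [NormedAddCommGroup G] [NormedSpace ℝ G]
    [CompleteSpace G] {F : E × ℝ → G} (hF : ContDiff ℝ ∞ F) :
    ContDiff ℝ m fun x => ∫ t in (0 : ℝ)..1, F (x, t) := by
  have : ProperSpace E := FiniteDimensional.proper_real E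
  induction m generalizing G with
  | zero =>
    rw [Nat.cast_zero, contDiff_zero]
    exact intervalIntegral.continuous_parametric_intervalIntegral_of_continuous'
      (f := fun x t => F (x, t)) hF.continuous 0 1
  | succ m ih =>
    let F' : E × ℝ → (E →L[ℝ] G) := fun z => (fderiv ℝ F z).comp (ContinuousLinearMap.inl ℝ E ℝ)
    have hF' : ContDiff ℝ ∞ F' :=
      (hF.fderiv_right (m := ∞) (by simp)).clm_comp contDiff_const
    have hd : ∀ x t, HasFDerivAt (fun x => F (x, t)) (F' (x, t)) x := fun x t =>
      (hF.differentiable (by simp) (x, t)).hasFDerivAt.comp x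
        (hasFDerivAt_prodMk_left x t)
    have key : ∀ x, HasFDerivAt (fun x => ∫ t in (0 : ℝ)..1, F (x, t))
        (∫ t in (0 : ℝ)..1, F' (x, t)) x := by
      intro x
      obtain ⟨C, hC⟩ := ((isCompact_closedBall x 1).prod
        (isCompact_Icc (a := (0 : ℝ)) (b := 1))).exists_bound_of_continuousOn
        hF'.continuous.continuousOn
      refine intervalIntegral.hasFDerivAt_integral_of_dominated_of_fderiv_le
        (F := fun x t => F (x, t)) (F' := fun x t => F' (x, t)) (bound := fun _ => C)
        (Metric.closedBall_mem_nhds x one_pos) ?_ ?_ ?_ ?_ ?_ ?_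
      · exact Filter.Eventually.of_forall fun y =>
          (hF.continuous.comp (by fun_prop)).aestronglyMeasurable
      · exact (hF.continuous.comp (by fun_prop)).intervalIntegrable _ _
      · exact (hF'.continuous.comp (by fun_prop)).aestronglyMeasurable
      · refine Filter.Eventually.of_forall fun t ht y hy => hC (y, t) ⟨hy, ?_⟩
        rw [Set.uIoc_of_le zero_le_one] at ht
        exact ⟨ht.1.le, ht.2⟩
      · exact intervalIntegrable_const
      · exact Filter.Eventually.of_forall fun t _ y _ => hd y t
    rw [Nat.cast_succ]
    refine contDiff_succ_iff_hasFDerivAt.mpr ⟨_, ih hF', key⟩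

theorem contDiff_intervalIntegral {E G : Type} [NormedAddCommGroup E] [NormedSpace ℝ E]
    [FiniteDimensional ℝ E] [NormedAddCommGroup G] [NormedSpace ℝ G]
    [CompleteSpace G] {F : E × ℝ → G} (hF : ContDiff ℝ ∞ F) :
    ContDiff ℝ ∞ fun x => ∫ t in (0 : ℝ)..1, F (x, t) :=
  contDiff_infty.mpr fun m => contDiff_intervalIntegral_nat m hF

/-- Hadamard's lemma on `ℝⁿ`. -/
theorem hadamard_global {n : ℕ} {f : (Fin n → ℝ) → ℝ} (hf : ContDiff ℝ ∞ f) (p : Fin n → ℝ) :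
    ∃ g : Fin n → (Fin n → ℝ) → ℝ, (∀ a, ContDiff ℝ ∞ (g a)) ∧
      ∀ x, f x = f p + ∑ a, (x a - p a) * g a x := by
  refine ⟨fun a x => ∫ t in (0 : ℝ)..1, fderiv ℝ f (p + t • (x - p)) (Pi.single a 1),
    fun a => ?_, fun x => ?_⟩
  · refine contDiff_intervalIntegral
      (F := fun z : (Fin n → ℝ) × ℝ => fderiv ℝ f (p + z.2 • (z.1 - p)) (Pi.single a 1)) ?_
    exact ((hf.fderiv_right (m := ∞) (by simp)).comp
      (contDiff_const.add (contDiff_snd.smul (contDiff_fst.sub contDiff_const)))).clm_apply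
      contDiff_const
  · have hc : Continuous fun t : ℝ => fderiv ℝ f (p + t • (x - p)) :=
      (hf.continuous_fderiv (by simp)).comp (by fun_prop)
    have hd : ∀ t : ℝ, HasDerivAt (fun t : ℝ => f (p + t • (x - p)))
        (fderiv ℝ f (p + t • (x - p)) (x - p)) t := fun t => by
      have h1 : HasDerivAt (fun t : ℝ => p + t • (x - p)) (x - p) t := by
        simpa using ((hasDerivAt_id t).smul_const (x - p)).const_add p
      exact (hf.differentiable (by simp) _).hasFDerivAt.comp_hasDerivAt t h1
    have h := intervalIntegral.integral_eq_sub_of_hasDerivAt (a := 0) (b := 1)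
      (fun t _ => hd t) ((hc.clm_apply continuous_const).intervalIntegrable _ _)
    have e : ∀ t : ℝ, fderiv ℝ f (p + t • (x - p)) (x - p) =
        ∑ a, (x a - p a) * fderiv ℝ f (p + t • (x - p)) (Pi.single a 1) := fun t => by
      generalize fderiv ℝ f (p + t • (x - p)) = L
      conv_lhs => rw [pi_eq_sum_univ' (x - p)]
      simp only [map_sum, map_smul, Pi.sub_apply, smul_eq_mul]
    simp only [e] at h
    rw [intervalIntegral.integral_finsetSum fun a _ =>
      ((hc.clm_apply continuous_const).const_mul _).intervalIntegrable _ _] at h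
    simp only [intervalIntegral.integral_const_mul] at h
    rw [h]
    simp

/-- **Hadamard's lemma** on an arbitrary open set. -/
theorem Smooth.hadamard {n : ℕ} {V : Opens (Fin n → ℝ)} (f : Smooth V) (p : V) :
    ∃ g : Fin n → Smooth V, f = algebraMap ℝ _ (f.1 p) +
      ∑ a, (Smooth.coord V a - algebraMap ℝ _ (p.1 a)) * g a := by
  obtain ⟨ε, hε, hball⟩ := Metric.nhds_basis_closedBall.mem_iff.mp (V.isOpen.mem_nhds p.2)
  let χ : ContDiffBump p.1 := ⟨ε / 2, ε, by positivity, by linarith⟩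
  let h : (Fin n → ℝ) → ℝ := fun x => extendZero f.1 x - f.1 p
  have hh : ∀ x ∈ V, ContDiffAt ℝ ∞ h x := fun x hx =>
    (ContDiffOn.contDiffAt f.2 (V.isOpen.mem_nhds hx)).sub contDiffAt_const
  have hF : ContDiff ℝ ∞ fun x => χ x * h x := by
    rw [contDiff_iff_contDiffAt]
    intro x
    by_cases hx : x ∈ V
    · exact χ.contDiffAt.mul (hh x hx)
    · have : x ∉ tsupport χ := fun h => hx (hball (χ.tsupport_eq ▸ h))
      refine (contDiffAt_const (c := (0 : ℝ))).congr_of_eventuallyEq ?_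
      filter_upwards [notMem_tsupport_iff_eventuallyEq.mp this] with y hy
      simp [hy]
  obtain ⟨g, hg, hgF⟩ := hadamard_global hF p.1
  let r : (Fin n → ℝ) → ℝ := fun x => ∑ b, (x b - p.1 b) ^ 2
  have hr : ContDiff ℝ ∞ r := ContDiff.sum fun b _ =>
    ((contDiff_apply ℝ ℝ b).sub contDiff_const).pow 2
  have hr0 : ∀ x, x ≠ p.1 → r x ≠ 0 := fun x hx h0 => hx <| funext fun b => by
    have := (Finset.sum_eq_zero_iff_of_nonneg fun b _ => sq_nonneg (x b - p.1 b)).mp h0 b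
      (Finset.mem_univ b)
    exact sub_eq_zero.mp (pow_eq_zero_iff two_ne_zero |>.mp this)
  -- away from `p` the remainder `(1 - χ) h` is divided by the squared distance to `p`
  let k : Fin n → (Fin n → ℝ) → ℝ := fun a x => (1 - χ x) * h x * (x a - p.1 a) / r x
  have hk : ∀ a, ContDiffOn ℝ ∞ (k a) V := fun a x hx => by
    by_cases hxp : x = p.1
    · refine ((contDiffAt_const (c := (0 : ℝ))).congr_of_eventuallyEq ?_).contDiffWithinAt
      rw [hxp]
      filter_upwards [χ.eventuallyEq_one] with y hy
      simp [k, hy]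
    · exact ((((contDiffAt_const.sub χ.contDiffAt).mul (hh x hx)).mul
        ((contDiff_apply ℝ ℝ a).contDiffAt.sub contDiffAt_const)).div hr.contDiffAt
        (hr0 x hxp)).contDiffWithinAt
  refine ⟨fun a => ⟨fun x => g a x + k a x, contDiffOn_extendZero
    ((hg a).contDiffOn.add (hk a)) fun _ => rfl⟩, ?_⟩
  ext x
  have e1 := hgF x.1
  have hp : h p.1 = 0 := sub_eq_zero.mpr (extendZero_apply f.1 p)
  have hx : h x.1 = f.1 x - f.1 p := congrArg (· - f.1 p) (extendZero_apply f.1 x)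
  have e2 : ∑ a, (x.1 a - p.1 a) * k a x = (1 - χ x.1) * h x := by
    by_cases hxp : x.1 = p.1
    · simp [hxp, hp]
    · have : ∀ a, (x.1 a - p.1 a) * k a x = (1 - χ x.1) * h x / r x * (x.1 a - p.1 a) ^ 2 :=
        fun a => by simp only [k]; ring
      rw [Finset.sum_congr rfl fun a _ => this a, ← Finset.mul_sum,
        div_mul_cancel₀ _ (hr0 _ hxp)]
  have e3 : (algebraMap ℝ (Smooth V) (f.1 p) +
      ∑ a, (Smooth.coord V a - algebraMap ℝ _ (p.1 a)) *
        (⟨fun x => g a x + k a x, contDiffOn_extendZero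
          ((hg a).contDiffOn.add (hk a)) fun _ => rfl⟩ : Smooth V)).1 x =
      f.1 p + ∑ a, (x.1 a - p.1 a) * (g a x + k a x) := by
    simp only [AddMemClass.coe_add, AddSubmonoidClass.coe_finsetSum, Pi.add_apply,
      Finset.sum_apply]
    rfl
  refine Eq.trans ?_ e3.symm
  simp only [mul_add, Finset.sum_add_distrib, e2]
  rw [hp, mul_zero, zero_add] at e1
  rw [← e1, hx]
  ring

/-- The inverse of a smooth function without zeros is smooth. -/
theorem Smooth.exists_mul_eq_one {n : ℕ} {V : Opens (Fin n → ℝ)} (f : Smooth V)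
    (hf : ∀ x, f.1 x ≠ 0) : ∃ g : Smooth V, f * g = 1 := by
  refine ⟨⟨fun x => (f.1 x)⁻¹, contDiffOn_extendZero (F := fun x => (extendZero f.1 x)⁻¹)
    (ContDiffOn.inv f.2 fun x hx => ?_) fun x => ?_⟩, ?_⟩
  · have := extendZero_apply f.1 ⟨x, hx⟩
    simp only at this
    rw [this]
    exact hf _
  · rw [extendZero_apply]
  · ext x
    exact mul_inv_cancel₀ (hf x)

/-! ### Super-derivations of algebras of functions -/

theorem Smooth.pd_mul {n : ℕ} {V : Opens (Fin n → ℝ)} (a : Fin n) (f g : Smooth V) :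
    Smooth.pd a (f * g) = Smooth.pd a f * g + f * Smooth.pd a g := by
  ext x
  have h : extendZero (f * g).1 =ᶠ[nhds (x : Fin n → ℝ)] extendZero f.1 * extendZero g.1 := by
    filter_upwards [V.isOpen.mem_nhds x.2] with y hy
    have := extendZero_apply (f * g).1 ⟨y, hy⟩
    have h1 := extendZero_apply f.1 ⟨y, hy⟩
    have h2 := extendZero_apply g.1 ⟨y, hy⟩
    simp only at this h1 h2
    rw [this, Pi.mul_apply, h1, h2]
    rfl
  change fderiv ℝ (extendZero (f * g).1) x _ = fderiv ℝ (extendZero f.1) x _ * g.1 x +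
    f.1 x * fderiv ℝ (extendZero g.1) x _
  rw [h.fderiv_eq, fderiv_mul (differentiableAt_extendZero f x) (differentiableAt_extendZero g x),
    extendZero_apply, extendZero_apply]
  simp only [add_apply, smul_apply, smul_eq_mul]
  ring

theorem Smooth.pd_one {n : ℕ} {V : Opens (Fin n → ℝ)} (a : Fin n) :
    Smooth.pd a (1 : Smooth V) = 0 := by
  have := Smooth.pd_mul a (1 : Smooth V) 1
  rw [mul_one, one_mul, mul_one] at this
  exact left_eq_add.mp this

theorem Smooth.pd_coord {n : ℕ} {V : Opens (Fin n → ℝ)} (a b : Fin n) :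
    Smooth.pd a (Smooth.coord V b) = if a = b then 1 else 0 := by
  ext x
  have h : extendZero (Smooth.coord V b).1 =ᶠ[nhds (x : Fin n → ℝ)] fun y => y b := by
    filter_upwards [V.isOpen.mem_nhds x.2] with y hy
    exact extendZero_apply (Smooth.coord V b).1 ⟨y, hy⟩
  change fderiv ℝ (extendZero (Smooth.coord V b).1) x _ = _
  rw [h.fderiv_eq, fderiv_apply differentiableAt_id, fderiv_fun_id]
  by_cases hab : a = b
  · subst hab
    simp
  · simp [hab, Ne.symm hab]

theorem contractLeft_mul {M : Type} [AddCommGroup M] [Module ℝ M]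
    (d : Module.Dual ℝ M) (u v : CliffordAlgebra (0 : QuadraticForm ℝ M)) :
    CliffordAlgebra.contractLeft d (u * v) = CliffordAlgebra.contractLeft d u * v +
      CliffordAlgebra.involute u * CliffordAlgebra.contractLeft d v := by
  induction u using CliffordAlgebra.left_induction with
  | algebraMap r => simp [Algebra.algebraMap_eq_smul_one]
  | add a b ha hb => simp only [add_mul, map_add, ha, hb]; abel
  | ι_mul a w ha =>
    simp only [mul_assoc, CliffordAlgebra.contractLeft_ι_mul, ha, map_mul,
      CliffordAlgebra.involute_ι, sub_mul, mul_add, smul_mul_assoc, neg_mul]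
    abel

namespace Model

variable {c : CoordType} {V : Opens (Fin c.n → ℝ)}

theorem mk_add_left (s t : Smooth V) (p : MvPolynomial c.Ev ℝ)
    (u : ExteriorAlgebra ℝ (c.Od → ℝ)) : mk (s + t) p u = mk s p u + mk t p u :=
  TensorProduct.add_tmul s t _

theorem mk_add_mid (s : Smooth V) (p q : MvPolynomial c.Ev ℝ)
    (u : ExteriorAlgebra ℝ (c.Od → ℝ)) : mk s (p + q) u = mk s p u + mk s q u :=
  (congrArg (TensorProduct.tmul ℝ s) (TensorProduct.add_tmul p q u)).trans
    (TensorProduct.tmul_add s _ _)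

theorem mk_smul_left (r : ℝ) (s : Smooth V) (p : MvPolynomial c.Ev ℝ)
    (u : ExteriorAlgebra ℝ (c.Od → ℝ)) : mk (r • s) p u = r • mk s p u :=
  TensorProduct.smul_tmul' r s _

theorem mk_smul_mid (r : ℝ) (s : Smooth V) (p : MvPolynomial c.Ev ℝ)
    (u : ExteriorAlgebra ℝ (c.Od → ℝ)) : mk s (r • p) u = r • mk s p u :=
  (congrArg (TensorProduct.tmul ℝ s) (TensorProduct.smul_tmul' r p u).symm).trans
    (TensorProduct.tmul_smul r s _)

theorem mk_sum {ι : Type} (t : Finset ι) (s : Smooth V) (p : MvPolynomial c.Ev ℝ)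
    (u : ι → ExteriorAlgebra ℝ (c.Od → ℝ)) : mk s p (∑ i ∈ t, u i) = ∑ i ∈ t, mk s p (u i) := by
  classical
  induction t using Finset.induction_on with
  | empty =>
    rw [Finset.sum_empty, Finset.sum_empty, ← zero_smul ℝ (0 : ExteriorAlgebra ℝ (c.Od → ℝ)),
      mk_smul, zero_smul]
  | insert i t hi ih => rw [Finset.sum_insert hi, Finset.sum_insert hi, mk_add, ih]

theorem ofSmooth_eq (s : Smooth V) : ofSmooth c s = mk s 1 1 := rfl

theorem one_eq : (1 : Model c V) = mk 1 1 1 := rfl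

/-- A property of functions holds if it is additive, holds for the functions of the smooth
coordinates, and is preserved by multiplication with the other coordinates. -/
theorem induction_coord {P : Model c V → Prop} (smooth : ∀ s, P (ofSmooth c s))
    (add : ∀ f g, P f → P g → P (f + g)) (mul : ∀ a f, P f → P (x (Sum.inr a) * f))
    (f : Model c V) : P f := by
  have zero : P 0 := by simpa using smooth 0
  have sum : ∀ (t : Finset c.Od) (g : c.Od → Model c V), (∀ o, P (g o)) → P (∑ o ∈ t, g o) := by
    intro t g hg
    classical
    induction t using Finset.induction_on with
    | empty => simpa using zero
    | insert i t hi ih => rw [Finset.sum_insert hi]; exact add _ _ (hg i) ih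
  have odd : ∀ (u : ExteriorAlgebra ℝ (c.Od → ℝ)) (s : Smooth V), P (mk s 1 u) := by
    intro u
    induction u using CliffordAlgebra.left_induction with
    | algebraMap r =>
      intro s
      have := smooth (r • s)
      rwa [ofSmooth_eq, mk_smul_left, ← mk_smul, ← Algebra.algebraMap_eq_smul_one] at this
    | add a b ha hb => intro s; rw [mk_add]; exact add _ _ (ha s) (hb s)
    | ι_mul a v ha =>
      intro s
      have hv : mk s 1 (CliffordAlgebra.ι (0 : QuadraticForm ℝ (c.Od → ℝ)) v * a) =
          ∑ o, x (Sum.inr (Sum.inr o)) * mk (v o • s) (1 : MvPolynomial c.Ev ℝ) a := by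
        conv_lhs => rw [pi_eq_sum_univ' v]
        rw [map_sum, Finset.sum_mul, mk_sum]
        refine Finset.sum_congr rfl fun o _ => ?_
        rw [map_smul, smul_mul_assoc, mk_smul, mk_smul_left, mul_smul_comm]
        refine congrArg (v o • ·) (Eq.trans ?_ (mk_mul_mk _ _ _ _ _ _).symm)
        rw [one_mul, one_mul]
      rw [hv]
      exact sum _ _ fun o => mul _ _ (ha _)
  induction f using Model.induction with
  | zero => exact zero
  | add f g hf hg => exact add f g hf hg
  | tmul s p u =>
    induction p using MvPolynomial.induction_on with
    | C r =>
      rw [MvPolynomial.C_eq_smul_one, mk_smul_mid, ← mk_smul_left]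
      exact odd u _
    | add p q hp hq => rw [mk_add_mid]; exact add _ _ hp hq
    | mul_X p e hp =>
      have : mk s (p * MvPolynomial.X e) u = x (Sum.inr (Sum.inl e)) * mk s p u := by
        refine Eq.trans ?_ (mk_mul_mk _ _ _ _ _ _).symm
        rw [one_mul, one_mul, mul_comm p]
      rw [this]
      exact mul _ _ hp

theorem pd_mul (a : c.Coord) (f g : Model c V) :
    pd a (f * g) = pd a f * g + sigma^[c.par a] f * pd a g := by
  induction f using Model.induction with
  | zero =>
    have : sigma^[c.par a] (0 : Model c V) = 0 := by
      induction c.par a with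
      | zero => rfl
      | succ n ih => rw [Function.iterate_succ_apply', ih, map_zero]
    simp [this]
  | add f f' hf hf' =>
    have : sigma^[c.par a] (f + f') = sigma^[c.par a] f + sigma^[c.par a] f' := by
      induction c.par a with
      | zero => rfl
      | succ n ih => simp only [Function.iterate_succ_apply', ih, map_add]
    simp only [add_mul, map_add, hf, hf', this]
    abel
  | tmul s p u =>
  induction g using Model.induction with
  | zero => simp
  | add g g' hg hg' => simp only [mul_add, map_add, hg, hg']; abel
  | tmul s' p' u' =>
  rcases a with a | e | o
  · rw [mk_mul_mk]
    change mk (Smooth.pd a (s * s')) _ _ = mk (Smooth.pd a s) p u * mk s' p' u' +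
      mk s p u * mk (Smooth.pd a s') p' u'
    rw [Smooth.pd_mul, mk_mul_mk, mk_mul_mk, mk_add_left]
    rfl
  · rw [mk_mul_mk]
    change mk _ (MvPolynomial.pderiv e (p * p')) _ = mk s (MvPolynomial.pderiv e p) u * mk s' p' u' +
      mk s p u * mk s' (MvPolynomial.pderiv e p') u'
    rw [MvPolynomial.pderiv_mul, mk_mul_mk, mk_mul_mk, mk_add_mid]
    rfl
  · rw [mk_mul_mk]
    change mk _ _ (CliffordAlgebra.contractLeft _ (u * u')) =
      mk s p (CliffordAlgebra.contractLeft _ u) * mk s' p' u' +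
      mk s p (CliffordAlgebra.involute u) * mk s' p' (CliffordAlgebra.contractLeft _ u')
    rw [contractLeft_mul, mk_mul_mk, mk_mul_mk, mk_add]
    rfl

theorem pd_one (a : c.Coord) : pd a (1 : Model c V) = 0 := by
  have h := pd_mul a (1 : Model c V) 1
  have : sigma^[c.par a] (1 : Model c V) = 1 := by
    induction c.par a with
    | zero => rfl
    | succ n ih => rw [Function.iterate_succ_apply', ih, map_one]
  rw [this, one_mul, mul_one] at h
  simpa using h

theorem pd_inr_ofSmooth (a : c.Ev ⊕ c.Od) (s : Smooth V) :
    pd (Sum.inr a) (ofSmooth c s) = 0 := by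
  rcases a with e | o
  · change mk s (MvPolynomial.pderiv e 1) 1 = 0
    rw [MvPolynomial.pderiv_one, ← zero_smul ℝ (0 : MvPolynomial c.Ev ℝ), mk_smul_mid, zero_smul]
  · change mk s 1 (CliffordAlgebra.contractLeft _ 1) = 0
    rw [CliffordAlgebra.contractLeft_one, ← zero_smul ℝ (0 : ExteriorAlgebra ℝ (c.Od → ℝ)),
      mk_smul, zero_smul]

theorem mk_zero_left (p : MvPolynomial c.Ev ℝ) (u : ExteriorAlgebra ℝ (c.Od → ℝ)) :
    mk (0 : Smooth V) p u = 0 := by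
  rw [← zero_smul ℝ (0 : Smooth V), mk_smul_left, zero_smul]

theorem mk_zero_mid (s : Smooth V) (u : ExteriorAlgebra ℝ (c.Od → ℝ)) :
    mk s (0 : MvPolynomial c.Ev ℝ) u = 0 := by
  rw [← zero_smul ℝ (0 : MvPolynomial c.Ev ℝ), mk_smul_mid, zero_smul]

theorem mk_zero (s : Smooth V) (p : MvPolynomial c.Ev ℝ) :
    mk s p (0 : ExteriorAlgebra ℝ (c.Od → ℝ)) = 0 := by
  rw [← zero_smul ℝ (0 : ExteriorAlgebra ℝ (c.Od → ℝ)), mk_smul, zero_smul]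

theorem pd_x (a b : c.Coord) : pd a (x b : Model c V) = if a = b then 1 else 0 := by
  rcases a with a | e | o <;> rcases b with b | e' | o'
  · change mk (Smooth.pd a (Smooth.coord V b)) 1 1 = _
    rw [Smooth.pd_coord]
    by_cases h : a = b
    · simp only [h, if_true]; rfl
    · simp only [h, if_false, Sum.inl.injEq]; exact mk_zero_left _ _
  · change mk (Smooth.pd a 1) _ _ = _
    rw [Smooth.pd_one, mk_zero_left, if_neg (by simp)]
  · change mk (Smooth.pd a 1) _ _ = _
    rw [Smooth.pd_one, mk_zero_left, if_neg (by simp)]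
  · change mk _ (MvPolynomial.pderiv e 1) _ = _
    rw [MvPolynomial.pderiv_one, mk_zero_mid, if_neg (by simp)]
  · change mk 1 (MvPolynomial.pderiv e (MvPolynomial.X e')) 1 = _
    by_cases h : e = e'
    · subst h
      rw [MvPolynomial.pderiv_X_self, if_pos rfl, one_eq]
    · rw [MvPolynomial.pderiv_X_of_ne (Ne.symm h), mk_zero_mid, if_neg (by simpa using h)]
  · change mk _ (MvPolynomial.pderiv e 1) _ = _
    rw [MvPolynomial.pderiv_one, mk_zero_mid, if_neg (by simp)]
  · change mk _ _ (CliffordAlgebra.contractLeft _ 1) = _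
    rw [CliffordAlgebra.contractLeft_one, if_neg (by simp)]
    exact mk_zero _ _
  · change mk _ _ (CliffordAlgebra.contractLeft _ 1) = _
    rw [CliffordAlgebra.contractLeft_one, if_neg (by simp)]
    exact mk_zero _ _
  · change mk 1 1 (CliffordAlgebra.contractLeft (LinearMap.proj o)
      (CliffordAlgebra.ι (0 : QuadraticForm ℝ (c.Od → ℝ)) (Pi.single o' 1))) = _
    rw [CliffordAlgebra.contractLeft_ι, Algebra.algebraMap_eq_smul_one]
    refine (mk_smul (c := c) (V := V) _ 1 1 1).trans ?_
    rw [LinearMap.proj_apply, ← one_eq]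
    by_cases h : o = o'
    · subst h; simp
    · simp [h]

theorem sgn_smul_congr {m n : ℕ} (h : Even m ↔ Even n) (f : Model c V) :
    (-1 : ℝ) ^ m • f = (-1 : ℝ) ^ n • f := by
  by_cases hm : Even m
  · rw [hm.neg_one_pow, (h.mp hm).neg_one_pow]
  · rw [(Nat.not_even_iff_odd.mp hm).neg_one_pow,
      (Nat.not_even_iff_odd.mp fun hn => hm (h.mpr hn)).neg_one_pow]

theorem HasParity.congr' {s t : ℕ} {f : Model c V} (hf : HasParity s f) (h : Even s ↔ Even t) :
    HasParity t f := by
  rw [HasParity] at *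
  rw [hf, sgn_smul_congr h]

theorem HasParity.iterate_sigma {s : ℕ} {f : Model c V} (hf : HasParity s f) (k : ℕ) :
    sigma^[k] f = (-1 : ℝ) ^ (k * s) • f := by
  induction k with
  | zero => simp
  | succ k ih =>
    rw [Function.iterate_succ_apply', ih, map_smul, hf, smul_smul, ← pow_add, Nat.succ_mul]

/-- Functions homogeneous with respect to the parity supercommute. -/
theorem HasParity.mul_comm {s t : ℕ} {f g : Model c V} (hf : HasParity s f) (hg : HasParity t g) :
    f * g = (-1 : ℝ) ^ (s * t) • (g * f) := by
  have h := super_commute f g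
  have h2 : (2 : ℝ) ≠ 0 := two_ne_zero
  refine smul_right_injective _ h2 ?_
  simp only
  rw [h, hf, hg]
  rcases Nat.even_or_odd s with hs | hs
  · simp only [hs.neg_one_pow, (hs.mul_right t).neg_one_pow, one_smul, sub_self, mul_zero,
      add_zero, mul_add, two_smul]
  · rcases Nat.even_or_odd t with ht | ht
    · simp only [hs.neg_one_pow, ht.neg_one_pow, (ht.mul_left s).neg_one_pow, one_smul, mul_add,
        two_smul, neg_smul, mul_neg, sub_neg_eq_add]
      abel
    · simp only [hs.neg_one_pow, ht.neg_one_pow, (hs.mul ht).neg_one_pow, one_smul, mul_add,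
        two_smul, neg_smul, mul_neg, sub_neg_eq_add, neg_mul]
      abel

theorem HasParity.neg {s : ℕ} {f : Model c V} (hf : HasParity s f) : HasParity s (-f) := by
  rw [HasParity] at *
  rw [map_neg, hf, smul_neg]

theorem HasParity.sub {s : ℕ} {f g : Model c V} (hf : HasParity s f) (hg : HasParity s g) :
    HasParity s (f - g) := by
  rw [sub_eq_add_neg]
  exact hf.add hg.neg

/-- Every function is the sum of an even and an odd one. -/
theorem exists_even_add_odd (f : Model c V) :
    ∃ g h : Model c V, HasParity 0 g ∧ HasParity 1 h ∧ f = g + h := by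
  have hs : ∀ f : Model c V, sigma (sigma f) = f := fun f => by
    induction f using Model.induction with
    | zero => simp
    | add f g hf hg => simp only [map_add, hf, hg]
    | tmul s p u => rw [sigma_mk, sigma_mk, CliffordAlgebra.involute_involute]
  refine ⟨(1 / 2 : ℝ) • (f + sigma f), (1 / 2 : ℝ) • (f - sigma f), ?_, ?_, ?_⟩
  · rw [HasParity, map_smul, map_add, hs, add_comm, pow_zero, one_smul]
  · rw [HasParity, map_smul, map_sub, hs, pow_one, neg_smul, one_smul, ← smul_neg, neg_sub]
  · rw [← smul_add]
    module

theorem hasParity_algebraMap (r : ℝ) : HasParity 0 (algebraMap ℝ (Model c V) r) := by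
  rw [HasParity, AlgHom.commutes, pow_zero, one_smul]

end Model

namespace Model

variable {c c' c'' : CoordType} {V : Opens (Fin c.n → ℝ)} {V' : Opens (Fin c'.n → ℝ)}
  {V'' : Opens (Fin c''.n → ℝ)}

/-- A super-derivation of parity `r` along the algebra homomorphism `φ`. The Leibniz rule is imposed
for a first factor homogeneous with respect to the parity, which suffices by linearity. -/
def IsSuperDer (φ : Model c V →ₐ[ℝ] Model c' V') (r : ℕ) (D : Model c V →ₗ[ℝ] Model c' V') : Prop :=
  ∀ (s : ℕ) (f g : Model c V), HasParity s f →
    D (f * g) = D f * φ g + (-1 : ℝ) ^ (r * s) • (φ f * D g)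

/-- The homomorphism preserves parity. -/
def IsEvenHom (φ : Model c V →ₐ[ℝ] Model c' V') : Prop :=
  ∀ (s : ℕ) (f : Model c V), HasParity s f → HasParity s (φ f)

theorem isEvenHom_id : IsEvenHom (AlgHom.id ℝ (Model c V)) := fun _ _ h => h

theorem pd_isSuperDer (a : c.Coord) :
    IsSuperDer (AlgHom.id ℝ (Model c V)) (c.par a) (pd a) := fun s f g hf => by
  rw [pd_mul, hf.iterate_sigma, smul_mul_assoc]
  rfl

namespace IsSuperDer

variable {φ : Model c V →ₐ[ℝ] Model c' V'} {r t : ℕ} {D E : Model c V →ₗ[ℝ] Model c' V'}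

theorem congr (hD : IsSuperDer φ r D) (h : Even r ↔ Even t) : IsSuperDer φ t D :=
  fun s f g hf => by
    rw [hD s f g hf, sgn_smul_congr (n := t * s)]
    rw [Nat.even_mul, Nat.even_mul, h]

theorem add (hD : IsSuperDer φ r D) (hE : IsSuperDer φ r E) : IsSuperDer φ r (D + E) :=
  fun s f g hf => by
    simp only [LinearMap.add_apply, hD s f g hf, hE s f g hf, add_mul, mul_add, smul_add]
    abel

theorem smul (k : ℝ) (hD : IsSuperDer φ r D) : IsSuperDer φ r (k • D) :=
  fun s f g hf => by
    simp only [LinearMap.smul_apply, hD s f g hf, smul_add, smul_mul_assoc, mul_smul_comm]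
    rw [smul_comm]

theorem sub (hD : IsSuperDer φ r D) (hE : IsSuperDer φ r E) : IsSuperDer φ r (D - E) := by
  rw [sub_eq_add_neg, ← neg_one_smul ℝ E]
  exact hD.add (hE.smul _)

theorem sum {ι : Type} {D : ι → Model c V →ₗ[ℝ] Model c' V'} (t : Finset ι)
    (hD : ∀ i ∈ t, IsSuperDer φ r (D i)) : IsSuperDer φ r (∑ i ∈ t, D i) := fun s f g hf => by
  simp only [LinearMap.sum_apply, Finset.sum_mul, Finset.mul_sum, Finset.smul_sum,
    ← Finset.sum_add_distrib]
  exact Finset.sum_congr rfl fun i hi => hD i hi s f g hf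

theorem mulLeft (hφ : IsEvenHom φ) (hD : IsSuperDer φ r D) {u : Model c' V'}
    (hu : HasParity t u) : IsSuperDer φ (t + r) (LinearMap.mulLeft ℝ u ∘ₗ D) := fun s f g hf => by
  simp only [LinearMap.comp_apply, LinearMap.mulLeft_apply]
  rw [hD s f g hf, mul_add, mul_smul_comm, ← mul_assoc, ← mul_assoc, hu.mul_comm (hφ s f hf),
    smul_mul_assoc, smul_smul, ← pow_add, mul_assoc (φ f),
    sgn_smul_congr (m := r * s + t * s) (n := (t + r) * s)]
  rw [add_mul, add_comm]

theorem comp_left (hD : IsSuperDer φ r D) (χ : Model c' V' →ₐ[ℝ] Model c'' V'') :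
    IsSuperDer (χ.comp φ) r (χ.toLinearMap ∘ₗ D) := fun s f g hf => by
  simp only [LinearMap.comp_apply, AlgHom.toLinearMap_apply, hD s f g hf, map_add, map_mul,
    map_smul, AlgHom.comp_apply]

theorem comp_right {χ : Model c' V' →ₐ[ℝ] Model c'' V''} {D : Model c' V' →ₗ[ℝ] Model c'' V''}
    (hD : IsSuperDer χ r D) (hφ : IsEvenHom φ) :
    IsSuperDer (χ.comp φ) r (D ∘ₗ φ.toLinearMap) := fun s f g hf => by
  simp only [LinearMap.comp_apply, AlgHom.toLinearMap_apply, map_mul, hD s _ _ (hφ s f hf),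
    AlgHom.comp_apply]

theorem commutator {D E : Model c V →ₗ[ℝ] Model c V} (hD : IsSuperDer (AlgHom.id ℝ _) r D)
    (hE : IsSuperDer (AlgHom.id ℝ _) t E)
    (hD' : ∀ s f, HasParity s f → HasParity (r + s) (D f))
    (hE' : ∀ s f, HasParity s f → HasParity (t + s) (E f)) :
    IsSuperDer (AlgHom.id ℝ _) (r + t) (D ∘ₗ E - (-1 : ℝ) ^ (r * t) • (E ∘ₗ D)) :=
  fun s f g hf => by
    simp only [LinearMap.sub_apply, LinearMap.smul_apply, LinearMap.comp_apply, AlgHom.id_apply]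
    have e1 := hD s f g hf
    have e2 := hE s f g hf
    have e3 := hD _ (E f) g (hE' s f hf)
    have e4 := hD s f (E g) hf
    have e5 := hE _ (D f) g (hD' s f hf)
    have e6 := hE s f (D g) hf
    simp only [AlgHom.id_apply] at e1 e2 e3 e4 e5 e6
    rw [e1, e2, map_add, map_smul, map_add, map_smul, e3, e4, e5, e6]
    rcases Nat.even_or_odd r with hr | hr <;> rcases Nat.even_or_odd t with ht | ht <;>
      rcases Nat.even_or_odd s with hs | hs <;>
      simp only [mul_add, add_mul, pow_add, pow_mul, hr.neg_one_pow, ht.neg_one_pow,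
        hs.neg_one_pow, one_pow, one_smul, neg_smul, sub_mul, mul_sub, smul_add, smul_sub,
        mul_one, mul_neg, neg_mul, neg_neg] <;> abel

end IsSuperDer

/-! ### Points, and the detection of functions by odd derivatives at points -/

/-- Evaluation at the point with smooth coordinates `w`, polynomial even coordinates `y` and
vanishing odd coordinates. -/
def ev (w : V) (y : c.Ev → ℝ) : Model c V →ₐ[ℝ] ℝ :=
  (Algebra.TensorProduct.lift ((Pi.evalAlgHom ℝ (fun _ : V => ℝ) w).comp (Smooth V).val)
    (Algebra.TensorProduct.lift (MvPolynomial.aeval y) ExteriorAlgebra.algebraMapInv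
      fun _ _ => Commute.all _ _) fun _ _ => Commute.all _ _ :
    Smooth V ⊗[ℝ] (MvPolynomial c.Ev ℝ ⊗[ℝ] ExteriorAlgebra ℝ (c.Od → ℝ)) →ₐ[ℝ] ℝ)

theorem ev_mk (w : V) (y : c.Ev → ℝ) (s : Smooth V) (p : MvPolynomial c.Ev ℝ)
    (u : ExteriorAlgebra ℝ (c.Od → ℝ)) :
    ev w y (mk s p u) = s.1 w * (MvPolynomial.aeval y p * ExteriorAlgebra.algebraMapInv u) :=
  (Algebra.TensorProduct.lift_tmul _ _ _ s _).trans
    (congrArg (s.1 w * ·) (Algebra.TensorProduct.lift_tmul _ _ _ p u))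

theorem algebraMapInv_involute {M : Type} [AddCommGroup M] [Module ℝ M]
    (u : ExteriorAlgebra ℝ M) :
    ExteriorAlgebra.algebraMapInv (CliffordAlgebra.involute u) =
      ExteriorAlgebra.algebraMapInv u := by
  induction u using CliffordAlgebra.left_induction with
  | algebraMap r => simp
  | add a b ha hb => rw [map_add, map_add, map_add, ha, hb]
  | ι_mul a v ha =>
    have h : ExteriorAlgebra.algebraMapInv (CliffordAlgebra.ι (0 : QuadraticForm ℝ M) v) = 0 :=
      (ExteriorAlgebra.lift_ι_apply ℝ _ _ v)
    rw [map_mul, map_mul, map_mul, CliffordAlgebra.involute_ι, map_neg, h, neg_zero, zero_mul,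
      zero_mul]

theorem ev_sigma (w : V) (y : c.Ev → ℝ) (f : Model c V) : ev w y (sigma f) = ev w y f := by
  induction f using Model.induction with
  | zero => simp
  | add f g hf hg => simp only [map_add, hf, hg]
  | tmul s p u => rw [sigma_mk, ev_mk, ev_mk, algebraMapInv_involute]

/-- All derivatives of `f` of order less than `n` in the odd directions vanish at a given point. -/
def OddFlat (w : V) (y : c.Ev → ℝ) : ℕ → Model c V → Prop
  | 0, _ => True
  | n + 1, f => ev w y f = 0 ∧ ∀ o : c.Od, OddFlat w y n (pd (Sum.inr (Sum.inr o)) f)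

namespace OddFlat

variable {w : V} {y : c.Ev → ℝ}

theorem zero (n : ℕ) : OddFlat w y n (0 : Model c V) := by
  induction n with
  | zero => trivial
  | succ n ih => exact ⟨map_zero _, fun o => by rwa [map_zero]⟩

theorem add {n : ℕ} {f g : Model c V} (hf : OddFlat w y n f) (hg : OddFlat w y n g) :
    OddFlat w y n (f + g) := by
  induction n generalizing f g with
  | zero => trivial
  | succ n ih =>
    exact ⟨by rw [map_add, hf.1, hg.1, add_zero], fun o => by
      rw [map_add]; exact ih (hf.2 o) (hg.2 o)⟩

theorem sum {ι : Type} (t : Finset ι) {n : ℕ} {f : ι → Model c V}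
    (hf : ∀ i ∈ t, OddFlat w y n (f i)) : OddFlat w y n (∑ i ∈ t, f i) := by
  classical
  induction t using Finset.induction_on with
  | empty => exact zero n
  | insert i t hi ih =>
    rw [Finset.sum_insert hi]
    exact (hf i (Finset.mem_insert_self i t)).add
      (ih fun j hj => hf j (Finset.mem_insert_of_mem hj))

theorem pred {n : ℕ} {f : Model c V} (hf : OddFlat w y (n + 1) f) : OddFlat w y n f := by
  induction n generalizing f with
  | zero => trivial
  | succ n ih => exact ⟨hf.1, fun o => ih (hf.2 o)⟩

theorem mul_left {n : ℕ} {f : Model c V} (hf : OddFlat w y n f) (u : Model c V) :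
    OddFlat w y n (u * f) := by
  induction n generalizing f u with
  | zero => trivial
  | succ n ih =>
    exact ⟨by rw [map_mul, hf.1, mul_zero], fun o => by
      rw [pd_mul]; exact (ih hf.pred _).add (ih (hf.2 o) _)⟩

/-- Multiplication by a function vanishing at the point raises the order of vanishing. -/
theorem mul_left_succ {n : ℕ} {f : Model c V} (hf : OddFlat w y n f) {u : Model c V}
    (hu : ev w y u = 0) : OddFlat w y (n + 1) (u * f) := by
  induction n generalizing f u with
  | zero => exact ⟨by rw [map_mul, hu, zero_mul], fun _ => trivial⟩
  | succ n ih =>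
    refine ⟨by rw [map_mul, hu, zero_mul], fun o => ?_⟩
    rw [pd_mul]
    exact (hf.mul_left _).add (ih (hf.2 o) ((ev_sigma w y u).trans hu))

end OddFlat

/-- All derivatives of `f` of order `m` in the odd directions vanish. -/
def OddKilled : ℕ → Model c V → Prop
  | 0, f => f = 0
  | m + 1, f => ∀ o : c.Od, OddKilled m (pd (Sum.inr (Sum.inr o)) f)

namespace OddKilled

theorem zero (m : ℕ) : OddKilled m (0 : Model c V) := by
  induction m with
  | zero => rfl
  | succ m ih => intro o; rwa [map_zero]

theorem succ {m : ℕ} {f : Model c V} (h : OddKilled m f) : OddKilled (m + 1) f := by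
  induction m generalizing f with
  | zero => intro o; rw [show f = 0 from h, map_zero]; rfl
  | succ m ih => exact fun o => ih (h o)

theorem mono {m m' : ℕ} (hm : m ≤ m') {f : Model c V} (h : OddKilled m f) : OddKilled m' f := by
  induction hm with
  | refl => exact h
  | step _ ih => exact ih.succ

theorem add {m : ℕ} {f g : Model c V} (hf : OddKilled m f) (hg : OddKilled m g) :
    OddKilled m (f + g) := by
  induction m generalizing f g with
  | zero => exact (congrArg₂ (· + ·) hf hg).trans (add_zero 0)
  | succ m ih => intro o; rw [map_add]; exact ih (hf o) (hg o)

theorem neg {m : ℕ} {f : Model c V} (hf : OddKilled m f) : OddKilled m (-f) := by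
  induction m generalizing f with
  | zero => exact (congrArg Neg.neg hf).trans neg_zero
  | succ m ih => intro o; rw [map_neg]; exact ih (hf o)

end OddKilled

theorem pd_x_mul (a b : c.Coord) (f : Model c V) :
    pd a (x b * f) = (if a = b then f else 0) + (-1 : ℝ) ^ (c.par a * c.par b) • (x b * pd a f) := by
  have h := pd_isSuperDer a _ (x b) f (hasParity_x b)
  simp only [AlgHom.id_apply] at h
  rw [h, pd_x]
  split_ifs <;> simp

/-- Functions are polynomial in the odd coordinates. -/
theorem exists_oddKilled (f : Model c V) : ∃ m, OddKilled m f := by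
  induction f using induction_coord with
  | smooth s => exact ⟨1, fun o => pd_inr_ofSmooth _ s⟩
  | add f g hf hg =>
    obtain ⟨m, hm⟩ := hf
    obtain ⟨m', hm'⟩ := hg
    exact ⟨max m m', (hm.mono (le_max_left _ _)).add (hm'.mono (le_max_right _ _))⟩
  | mul a f hf =>
    obtain ⟨m, hm⟩ := hf
    refine ⟨m + 1, ?_⟩
    induction m generalizing f with
    | zero => rw [show f = 0 from hm, mul_zero]; exact OddKilled.zero _
    | succ m ih =>
      intro o
      rw [pd_x_mul]
      refine OddKilled.add ?_ ?_
      · split_ifs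
        · exact hm
        · exact OddKilled.zero _
      · rcases neg_one_pow_eq_or ℝ (c.par (Sum.inr (Sum.inr o)) * c.par (Sum.inr a)) with h | h
        · rw [h, one_smul]; exact ih _ (hm o)
        · rw [h, neg_smul, one_smul]; exact (ih _ (hm o)).neg

/-- The product of the projections `1 - ξ ∂/∂ξ` over a list of odd coordinates `ξ`. -/
def oddProj : List c.Od → (Model c V →ₗ[ℝ] Model c V)
  | [] => LinearMap.id
  | o :: l => (LinearMap.id - LinearMap.mulLeft ℝ (x (Sum.inr (Sum.inr o))) ∘ₗ
      pd (Sum.inr (Sum.inr o))) ∘ₗ oddProj l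

theorem oddProj_cons (o : c.Od) (l : List c.Od) (f : Model c V) :
    oddProj (o :: l) f = oddProj l f - x (Sum.inr (Sum.inr o)) *
      pd (Sum.inr (Sum.inr o)) (oddProj l f) := rfl

theorem oddProj_of_pd_eq_zero (l : List c.Od) {f : Model c V}
    (hf : ∀ o : c.Od, pd (Sum.inr (Sum.inr o)) f = 0) : oddProj l f = f := by
  induction l with
  | nil => rfl
  | cons o l ih => rw [oddProj_cons, ih, hf, mul_zero, sub_zero]

theorem oddProj_ev_mul (l : List c.Od) (e : c.Ev) (f : Model c V) :
    oddProj l (x (Sum.inr (Sum.inl e)) * f) = x (Sum.inr (Sum.inl e)) * oddProj l f := by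
  induction l with
  | nil => rfl
  | cons o l ih =>
    rw [oddProj_cons, oddProj_cons, ih, pd_x_mul, if_neg (by simp), zero_add, mul_sub,
      ← mul_assoc, mul_smul_comm, ← mul_assoc,
      ((hasParity_x (Sum.inr (Sum.inr o))).mul_comm (hasParity_x (Sum.inr (Sum.inl e))) :
        (x _ : Model c V) * _ = _)]
    simp [CoordType.par]

theorem x_odd_mul_self (o : c.Od) (f : Model c V) :
    (x (Sum.inr (Sum.inr o)) : Model c V) * (x (Sum.inr (Sum.inr o)) * f) = 0 := by
  rw [← mul_assoc, HasParity.odd_sq (hasParity_x (Sum.inr (Sum.inr o))), zero_mul]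

theorem oddProj_odd_mul (l : List c.Od) (o : c.Od) (f : Model c V) :
    oddProj l (x (Sum.inr (Sum.inr o)) * f) =
      if o ∈ l then 0 else x (Sum.inr (Sum.inr o)) * oddProj l f := by
  induction l with
  | nil => simp [oddProj]
  | cons o' l ih =>
    rw [oddProj_cons, ih]
    by_cases h : o ∈ l
    · simp [h]
    · by_cases ho : o = o'
      · subst ho
        rw [if_neg h, pd_x_mul, if_pos rfl, mul_add, mul_smul_comm, x_odd_mul_self]
        simp
      · rw [if_neg h, if_neg (by simp [h, ho]), oddProj_cons, pd_x_mul,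
          if_neg (by simpa using Ne.symm ho), zero_add, mul_sub, ← mul_assoc,
          mul_smul_comm, ← mul_assoc,
          ((hasParity_x (Sum.inr (Sum.inr o))).mul_comm (hasParity_x (Sum.inr (Sum.inr o'))) :
            (x _ : Model c V) * _ = _)]
        simp [CoordType.par]

/-- The functions not involving the odd coordinates. -/
def evenIncl : Smooth V ⊗[ℝ] MvPolynomial c.Ev ℝ →ₐ[ℝ] Model c V :=
  (Algebra.TensorProduct.map (AlgHom.id ℝ _) Algebra.TensorProduct.includeLeft :
    Smooth V ⊗[ℝ] MvPolynomial c.Ev ℝ →ₐ[ℝ]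
      Smooth V ⊗[ℝ] (MvPolynomial c.Ev ℝ ⊗[ℝ] ExteriorAlgebra ℝ (c.Od → ℝ)))

theorem evenIncl_tmul (s : Smooth V) (p : MvPolynomial c.Ev ℝ) :
    evenIncl (s ⊗ₜ[ℝ] p) = mk s p 1 := rfl

theorem oddProj_mem_range (f : Model c V) :
    oddProj Finset.univ.toList f ∈ (evenIncl (c := c) (V := V)).range := by
  induction f using induction_coord with
  | smooth s =>
    rw [oddProj_of_pd_eq_zero _ fun o => pd_inr_ofSmooth _ s]
    exact ⟨s ⊗ₜ[ℝ] 1, rfl⟩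
  | add f g hf hg => rw [map_add]; exact add_mem hf hg
  | mul a f hf =>
    rcases a with e | o
    · rw [oddProj_ev_mul]
      exact mul_mem ⟨1 ⊗ₜ[ℝ] MvPolynomial.X e, rfl⟩ hf
    · rw [oddProj_odd_mul, if_pos (by simp)]
      exact zero_mem _

theorem eq_zero_of_ev_evenIncl (z : Smooth V ⊗[ℝ] MvPolynomial c.Ev ℝ)
    (h : ∀ w y, ev w y (evenIncl (c := c) z) = 0) : z = 0 := by
  let e := MvPolynomial.algebraTensorAlgEquiv (σ := c.Ev) ℝ (Smooth V)
  have key : ∀ (w : V) (y : c.Ev → ℝ), ev w y (evenIncl (c := c) z) =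
      MvPolynomial.eval y (MvPolynomial.map
        ((Pi.evalAlgHom ℝ (fun _ : V => ℝ) w).comp (Smooth V).val).toRingHom (e z)) := by
    intro w y
    clear h
    induction z using TensorProduct.induction_on with
    | zero => simp only [map_zero]
    | add a b ha hb => simp only [map_add, ha, hb]
    | tmul s p =>
      rw [evenIncl_tmul, ev_mk, map_one, mul_one]
      simp only [e, MvPolynomial.algebraTensorAlgEquiv_tmul, MvPolynomial.smul_eq_C_mul, map_mul,
        MvPolynomial.map_C, MvPolynomial.eval_C, MvPolynomial.map_map]
      rw [MvPolynomial.eval_map, MvPolynomial.aeval_def]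
      congr 1
  have h0 : e z = 0 := by
    ext m w
    have h1 : MvPolynomial.map
        ((Pi.evalAlgHom ℝ (fun _ : V => ℝ) w).comp (Smooth V).val).toRingHom (e z) = 0 :=
      MvPolynomial.funext fun y => by rw [← key w y, h, map_zero]
    have h2 := congrArg (MvPolynomial.coeff m) h1
    rw [MvPolynomial.coeff_map] at h2
    exact h2
  exact (map_eq_zero_iff e e.injective).mp h0

/-- A function is zero if all its odd derivatives vanish at all points. -/
theorem eq_zero_of_oddFlat (f : Model c V) (h : ∀ w y n, OddFlat w y n f) : f = 0 := by
  obtain ⟨m, hm⟩ := exists_oddKilled f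
  induction m generalizing f with
  | zero => exact hm
  | succ m ih =>
    have h0 : ∀ o : c.Od, pd (Sum.inr (Sum.inr o)) f = 0 := fun o =>
      ih _ (fun w y n => (h w y (n + 1)).2 o) (hm o)
    have h1 := oddProj_mem_range f
    rw [oddProj_of_pd_eq_zero _ h0] at h1
    obtain ⟨z, hz⟩ := h1
    have hz' : evenIncl z = f := hz
    rw [← hz', eq_zero_of_ev_evenIncl z fun w y => by rw [hz']; exact (h w y 1).1, map_zero]

/-- Every character of `C^∞(V)` sends the coordinates to those of a point of `V`: otherwise the
squared distance to that point would be invertible. -/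
theorem exists_point (χ : Smooth V →ₐ[ℝ] ℝ) :
    ∃ p : V, ∀ a, p.1 a = χ (Smooth.coord V a) := by
  by_cases hp : (fun a => χ (Smooth.coord V a)) ∈ V
  · exact ⟨⟨_, hp⟩, fun a => rfl⟩
  · exfalso
    let r : Smooth V := ∑ a, (Smooth.coord V a - algebraMap ℝ _ (χ (Smooth.coord V a))) ^ 2
    have hr : ∀ x : V, r.1 x = ∑ a, (x.1 a - χ (Smooth.coord V a)) ^ 2 := fun x => by
      simp only [r, AddSubmonoidClass.coe_finsetSum, Finset.sum_apply]
      rfl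
    obtain ⟨g, hg⟩ := Smooth.exists_mul_eq_one r fun x h0 => by
      rw [hr] at h0
      refine hp ?_
      have : x.1 = fun a => χ (Smooth.coord V a) := funext fun a => by
        have := (Finset.sum_eq_zero_iff_of_nonneg fun b _ =>
          sq_nonneg (x.1 b - χ (Smooth.coord V b))).mp h0 a (Finset.mem_univ a)
        exact sub_eq_zero.mp (pow_eq_zero_iff two_ne_zero |>.mp this)
      exact this ▸ x.2
    have h1 : χ r = 0 := by
      simp [r]
    have h2 := congrArg χ hg
    rw [map_mul, h1, zero_mul, map_one] at h2
    exact zero_ne_one h2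

/-- A super-derivation along a homomorphism is determined by its values on the coordinates. On
smooth functions, Hadamard's lemma at the point of `V` below a given point of `V'` shows that a
super-derivation vanishing on the coordinates takes values vanishing to arbitrarily high order. -/
theorem IsSuperDer.eq_zero {φ : Model c V →ₐ[ℝ] Model c' V'} {r : ℕ}
    {D : Model c V →ₗ[ℝ] Model c' V'} (hD : IsSuperDer φ r D) (h : ∀ a, D (x a) = 0)
    (f : Model c V) : D f = 0 := by
  have h1 : D 1 = 0 := by
    have := hD 0 1 1 (by simpa using hasParity_algebraMap (c := c) (V := V) 1)
    simpa using this
  induction f using induction_coord with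
  | add f g hf hg => rw [map_add, hf, hg, add_zero]
  | mul a f hf => rw [hD _ _ f (hasParity_x (Sum.inr a)), h, hf]; simp
  | smooth s =>
    refine eq_zero_of_oddFlat _ fun w y n => ?_
    obtain ⟨p, hp⟩ := exists_point (((ev w y).comp φ).comp (ofSmooth c))
    induction n generalizing s with
    | zero => trivial
    | succ n ih =>
      obtain ⟨g, hg⟩ := Smooth.hadamard s p
      have hc : ∀ k : ℝ, D (algebraMap ℝ _ k) = 0 := fun k => by
        rw [Algebra.algebraMap_eq_smul_one, map_smul, h1, smul_zero]
      have e : D (ofSmooth c s) = ∑ a, φ (x (Sum.inl a) - algebraMap ℝ _ (p.1 a)) *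
          D (ofSmooth c (g a)) := by
        conv_lhs => rw [hg]
        rw [map_add, AlgHom.commutes, map_add, hc, zero_add, map_sum, map_sum]
        refine Finset.sum_congr rfl fun a _ => ?_
        have hx : ofSmooth c (Smooth.coord V a - algebraMap ℝ _ (p.1 a)) =
            x (Sum.inl a) - algebraMap ℝ _ (p.1 a) := by
          rw [map_sub, AlgHom.commutes]
          rfl
        rw [map_mul, hx, hD 0 _ _ (HasParity.sub (hasParity_x (Sum.inl a))
          (hasParity_algebraMap _)), map_sub, h, hc]
        simp
      rw [e]
      refine OddFlat.sum _ fun a _ => (ih (g a)).mul_left_succ ?_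
      rw [map_sub, map_sub, hp a, AlgHom.commutes, AlgHom.commutes]
      exact sub_self _

theorem IsSuperDer.ext {φ : Model c V →ₐ[ℝ] Model c' V'} {r : ℕ}
    {D E : Model c V →ₗ[ℝ] Model c' V'} (hD : IsSuperDer φ r D) (hE : IsSuperDer φ r E)
    (h : ∀ a, D (x a) = E (x a)) (f : Model c V) : D f = E f :=
  sub_eq_zero.mp ((hD.sub hE).eq_zero (fun a => sub_eq_zero.mpr (h a)) f)

end Model

namespace Model

variable {c c' : CoordType} {V : Opens (Fin c.n → ℝ)} {V' : Opens (Fin c'.n → ℝ)}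

/-! ### Consequences of the determination by coordinates -/

theorem IsSuperDer.of_homogeneous {φ : Model c V →ₐ[ℝ] Model c' V'} {r : ℕ}
    {D : Model c V →ₗ[ℝ] Model c' V'}
    (h : ∀ (s t : ℕ) (f g : Model c V), HasParity s f → HasParity t g →
      D (f * g) = D f * φ g + (-1 : ℝ) ^ (r * s) • (φ f * D g)) : IsSuperDer φ r D :=
  fun s f g hf => by
    obtain ⟨g₀, g₁, h₀, h₁, rfl⟩ := exists_even_add_odd g
    rw [mul_add, map_add, h s 0 f g₀ hf h₀, h s 1 f g₁ hf h₁, map_add, map_add, mul_add, mul_add,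
      smul_add]
    abel

/-- The ordinary Leibniz rule for even derivations. -/
theorem IsSuperDer.leibniz_even {φ : Model c V →ₐ[ℝ] Model c' V'}
    {D : Model c V →ₗ[ℝ] Model c' V'} (hD : IsSuperDer φ 0 D) (f g : Model c V) :
    D (f * g) = D f * φ g + φ f * D g := by
  obtain ⟨f₀, f₁, h₀, h₁, rfl⟩ := exists_even_add_odd f
  rw [add_mul, map_add, hD 0 f₀ g h₀, hD 1 f₁ g h₁, map_add, map_add]
  simp only [zero_mul, pow_zero, one_smul, add_mul]
  abel

theorem pd_pd_comm (a b : c.Coord) (f : Model c V) :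
    pd a (pd b f) = (-1 : ℝ) ^ (c.par a * c.par b) • pd b (pd a f) := by
  have h := (pd_isSuperDer (V := V) a).commutator (pd_isSuperDer b)
    (fun s f hf => hf.pd a) (fun s f hf => hf.pd b)
  have := h.eq_zero (fun d => by
    have h1 : ∀ a b : c.Coord, pd a (pd b (x d : Model c V)) = 0 := fun a b => by
      rw [pd_x]
      split_ifs
      · exact pd_one a
      · exact map_zero _
    simp only [LinearMap.sub_apply, LinearMap.smul_apply, LinearMap.comp_apply, h1, smul_zero,
      sub_zero]) f
  simp only [LinearMap.sub_apply, LinearMap.smul_apply, LinearMap.comp_apply] at this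
  exact sub_eq_zero.mp this

/-- A super-derivation is the combination of the partial derivatives with its components. -/
theorem IsSuperDer.eq_sum {φ : Model c V →ₐ[ℝ] Model c' V'} (hφ : IsEvenHom φ) {r : ℕ}
    {D : Model c V →ₗ[ℝ] Model c' V'} (hD : IsSuperDer φ r D)
    (hp : ∀ a, HasParity (r + c.par a) (D (x a))) (f : Model c V) :
    D f = ∑ a, D (x a) * φ (pd a f) := by
  have h2 : IsSuperDer φ r (∑ a, LinearMap.mulLeft ℝ (D (x a)) ∘ₗ φ.toLinearMap ∘ₗ pd a) :=
    IsSuperDer.sum _ fun a _ => (((pd_isSuperDer a).comp_left φ).mulLeft hφ (hp a)).congr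
      (by simp only [parity_simps]; tauto)
  refine (hD.ext h2 (fun b => ?_) f).trans ?_
  · simp only [LinearMap.sum_apply, LinearMap.comp_apply, LinearMap.mulLeft_apply, pd_x,
      AlgHom.toLinearMap_apply]
    rw [Finset.sum_eq_single b]
    · simp
    · intro a _ hab
      simp [hab]
    · simp
  · simp only [LinearMap.sum_apply, LinearMap.comp_apply, LinearMap.mulLeft_apply,
      AlgHom.toLinearMap_apply]

theorem chain_rule {φ : Model c V →ₐ[ℝ] Model c' V'} (hφ : IsEvenHom φ) (a : c'.Coord)
    (f : Model c V) : pd a (φ f) = ∑ b, pd a (φ (x b)) * φ (pd b f) :=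
  ((pd_isSuperDer a).comp_right hφ).eq_sum (D := pd a ∘ₗ φ.toLinearMap) hφ
    (fun b => (hφ _ _ (hasParity_x b)).pd a) f

/-! ### Weighted Euler operators -/

/-- The Euler operator `∑ w_a x^a ∂/∂x^a` for arbitrary real weights of the coordinates. -/
def wEuler (w : c.Coord → ℝ) : Model c V →ₗ[ℝ] Model c V :=
  ∑ a : c.Coord, w a • (LinearMap.mulLeft ℝ (x a : Model c V) ∘ₗ pd a)

theorem euler_eq : (euler : Model c V →ₗ[ℝ] Model c V) = wEuler fun a => (c.wt a : ℝ) := rfl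

theorem wEuler_apply (w : c.Coord → ℝ) (f : Model c V) :
    wEuler w f = ∑ a, w a • (x a * pd a f) := by
  simp [wEuler]

theorem wEuler_isSuperDer (w : c.Coord → ℝ) :
    IsSuperDer (AlgHom.id ℝ (Model c V)) 0 (wEuler w) :=
  IsSuperDer.sum _ fun a _ => (((pd_isSuperDer a).mulLeft isEvenHom_id (hasParity_x a)).congr
    (by simp [parity_simps])).smul _

theorem wEuler_mul (w : c.Coord → ℝ) (f g : Model c V) :
    wEuler w (f * g) = wEuler w f * g + f * wEuler w g :=
  (wEuler_isSuperDer w).leibniz_even f g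

theorem wEuler_x (w : c.Coord → ℝ) (a : c.Coord) :
    wEuler w (x a : Model c V) = w a • x a := by
  rw [wEuler_apply, Finset.sum_eq_single a]
  · rw [pd_x, if_pos rfl, mul_one]
  · intro b _ hb
    rw [pd_x, if_neg hb, mul_zero, smul_zero]
  · simp

theorem HasParity.wEuler {s : ℕ} {f : Model c V} (hf : HasParity s f) (w : c.Coord → ℝ) :
    HasParity s (wEuler w f) := by
  rw [wEuler_apply]
  exact HasParity.sum fun a => (((hasParity_x a).mul (hf.pd a)).congr' (by
    simp only [parity_simps]; tauto)).smul _

theorem wEuler_pd (w : c.Coord → ℝ) (a : c.Coord) (f : Model c V) :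
    wEuler w (pd a f) = pd a (wEuler w f) - w a • pd a f := by
  have h := (wEuler_isSuperDer (V := V) w).commutator (pd_isSuperDer a)
    (fun s f hf => (hf.wEuler w).congr' (by simp)) (fun s f hf => hf.pd a)
  have h2 : IsSuperDer (AlgHom.id ℝ (Model c V)) (0 + c.par a) ((-w a) • pd a) :=
    ((pd_isSuperDer a).smul _).congr (by simp)
  have := h.ext h2 (fun b => by
    simp only [LinearMap.sub_apply, LinearMap.smul_apply, LinearMap.comp_apply, wEuler_x, map_smul,
      pd_x, zero_mul, pow_zero, one_smul]
    have h1 : wEuler w (1 : Model c V) = 0 := by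
      simp [wEuler_apply, pd_one]
    split_ifs with h
    · rw [h1, zero_sub, h, neg_smul]
    · simp) f
  simp only [LinearMap.sub_apply, LinearMap.smul_apply, LinearMap.comp_apply, zero_mul, pow_zero,
    one_smul] at this
  rw [eq_add_of_sub_eq this, neg_smul]
  abel

/-- Weighted Euler operators are intertwined by a homomorphism as soon as it respects the weights of
the coordinates. -/
theorem wEuler_hom {w : c.Coord → ℝ} {w' : c'.Coord → ℝ} {φ : Model c V →ₐ[ℝ] Model c' V'}
    (hφ : IsEvenHom φ) (h : ∀ a, wEuler w' (φ (x a)) = w a • φ (x a)) (f : Model c V) :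
    wEuler w' (φ f) = φ (wEuler w f) := by
  have h1 := (wEuler_isSuperDer (V := V') w').comp_right hφ
  have h2 := (wEuler_isSuperDer (V := V) w).comp_left φ
  exact IsSuperDer.ext h1 h2 (fun a => by
    simp only [LinearMap.comp_apply, AlgHom.toLinearMap_apply, h, wEuler_x, map_smul]) f

theorem hasWeight_x (a : c.Coord) : HasWeight (c.wt a) (x a : Model c V) := wEuler_x _ a

theorem HasWeight.mul {k l : ℤ} {f g : Model c V} (hf : HasWeight k f) (hg : HasWeight l g) :
    HasWeight (k + l) (f * g) := by
  rw [HasWeight, euler_eq] at *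
  rw [wEuler_mul, hf, hg, smul_mul_assoc, mul_smul_comm, ← add_smul]
  push_cast
  rfl

theorem HasWeight.pd {k : ℤ} {f : Model c V} (hf : HasWeight k f) (a : c.Coord) :
    HasWeight (k - c.wt a) (pd a f) := by
  rw [HasWeight, euler_eq] at *
  rw [wEuler_pd, hf, map_smul, ← sub_smul]
  push_cast
  rfl

theorem HasWeight.add {k : ℤ} {f g : Model c V} (hf : HasWeight k f) (hg : HasWeight k g) :
    HasWeight k (f + g) := by
  rw [HasWeight] at *
  rw [map_add, hf, hg, smul_add]

theorem HasWeight.smul {k : ℤ} {f : Model c V} (r : ℝ) (hf : HasWeight k f) :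
    HasWeight k (r • f) := by
  rw [HasWeight] at *
  rw [map_smul, hf, smul_comm]

theorem HasWeight.neg {k : ℤ} {f : Model c V} (hf : HasWeight k f) : HasWeight k (-f) := by
  rw [← neg_one_smul ℝ f]
  exact hf.smul _

theorem HasWeight.sum {ι : Type} [Fintype ι] {k : ℤ} {f : ι → Model c V}
    (hf : ∀ i, HasWeight k (f i)) : HasWeight k (∑ i, f i) := by
  rw [HasWeight, map_sum, Finset.smul_sum]
  exact Finset.sum_congr rfl fun i _ => hf i

theorem HasWeight.congr {k l : ℤ} {f : Model c V} (hf : HasWeight k f) (h : k = l) :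
    HasWeight l f := h ▸ hf

end Model

namespace Anti

open Model

variable {c : CoordType} {κ : ℤ} {V : Opens (Fin c.n → ℝ)}

/-! ### The canonical Schouten bracket -/

theorem even_par_fibre (a : c.Coord) :
    Even ((c.anti κ).par (fibre κ a)) ↔ ¬Even (c.par a) := by
  have := par_fibre (κ := κ) a
  rw [Nat.even_iff, Nat.even_iff]
  omega

theorem base_injective : Function.Injective (base κ : c.Coord → _) := by
  rintro (a | e | o) (b | e' | o') h <;> simp_all [base]

theorem fibre_injective : Function.Injective (fibre κ : c.Coord → _) := by
  rintro (a | e | o) (b | e' | o') h <;> simp_all [fibre]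

theorem base_ne_fibre (a b : c.Coord) : base κ a ≠ fibre κ b := by
  rcases a with a | e | o <;> rcases b with b | e' | o' <;> simp [base, fibre]

theorem coord_cases (A : (c.anti κ).Coord) : (∃ a, A = base κ a) ∨ ∃ a, A = fibre κ a := by
  rcases A with a | (e | o) | (o | a | e)
  · exact Or.inl ⟨Sum.inl a, rfl⟩
  · exact Or.inl ⟨Sum.inr (Sum.inl e), rfl⟩
  · exact Or.inr ⟨Sum.inr (Sum.inr o), rfl⟩
  · exact Or.inl ⟨Sum.inr (Sum.inr o), rfl⟩
  · exact Or.inr ⟨Sum.inl a, rfl⟩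
  · exact Or.inr ⟨Sum.inr (Sum.inl e), rfl⟩

theorem pd_base_x_base (a b : c.Coord) :
    pd (base κ a) (x (base κ b) : Model (c.anti κ) V) = if a = b then 1 else 0 := by
  rw [pd_x]
  simp only [base_injective.eq_iff]

theorem pd_fibre_x_fibre (a b : c.Coord) :
    pd (fibre κ a) (x (fibre κ b) : Model (c.anti κ) V) = if a = b then 1 else 0 := by
  rw [pd_x]
  simp only [fibre_injective.eq_iff]

theorem pd_fibre_x_base (a b : c.Coord) :
    pd (fibre κ a) (x (base κ b) : Model (c.anti κ) V) = 0 := by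
  rw [pd_x, if_neg (base_ne_fibre b a).symm]

theorem pd_base_x_fibre (a b : c.Coord) :
    pd (base κ a) (x (fibre κ b) : Model (c.anti κ) V) = 0 := by
  rw [pd_x, if_neg (base_ne_fibre a b)]

theorem isEvenHom_pull : IsEvenHom (pull κ : Model c V →ₐ[ℝ] Model (c.anti κ) V) :=
  fun _ _ h => pull_parity h

theorem pd_fibre_pull (a : c.Coord) (f : Model c V) : pd (fibre κ a) (pull κ f) = 0 :=
  ((pd_isSuperDer (c := c.anti κ) (V := V) (fibre κ a)).comp_right isEvenHom_pull).eq_zero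
    (fun b => by
      simp only [LinearMap.comp_apply, AlgHom.toLinearMap_apply, pull_x, pd_fibre_x_base]) f

theorem pd_base_pull (a : c.Coord) (f : Model c V) :
    pd (base κ a) (pull κ f) = pull κ (pd a f) := by
  have h1 := (pd_isSuperDer (c := c.anti κ) (V := V) (base κ a)).comp_right
    (isEvenHom_pull (c := c) (V := V))
  have h2 := (pd_isSuperDer (c := c) (V := V) a).comp_left (pull κ)
  rw [par_base] at h1
  refine IsSuperDer.ext h1 h2 (fun b => ?_) f
  simp only [LinearMap.comp_apply, AlgHom.toLinearMap_apply, pull_x, pd_x,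
    base_injective.eq_iff]
  split_ifs <;> simp

theorem twist_eq {s : ℕ} {F : Model (c.anti κ) V} (hF : HasParity s F) (k : ℕ) :
    twist k F = (-1 : ℝ) ^ (k * (s + 1)) • F := by
  rw [twist, hF.iterate_sigma, smul_smul, ← pow_add]
  exact sgn_smul_congr (by rw [mul_add, mul_one, add_comm]) F

theorem schouten_apply {s : ℕ} {F : Model (c.anti κ) V} (hF : HasParity s F)
    (G : Model (c.anti κ) V) :
    schouten F G = ∑ a : c.Coord,
      ((-1 : ℝ) ^ ((c.par a + 1) * (s + 1)) • (pd (fibre κ a) F * pd (base κ a) G) -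
        (-1 : ℝ) ^ (c.par a * (s + 1)) • (pd (base κ a) F * pd (fibre κ a) G)) := by
  simp only [schouten, LinearMap.sum_apply, LinearMap.sub_apply, LinearMap.comp_apply,
    LinearMap.mulLeft_apply, twist_eq hF, map_smul, smul_mul_assoc]

theorem twist_add (k : ℕ) (F G : Model (c.anti κ) V) : twist k (F + G) = twist k F + twist k G := by
  have : sigma^[k] (F + G) = sigma^[k] F + sigma^[k] G := by
    induction k with
    | zero => rfl
    | succ n ih => simp only [Function.iterate_succ_apply', ih, map_add]
  rw [twist, this, smul_add]
  rfl

theorem twist_smul (k : ℕ) (r : ℝ) (F : Model (c.anti κ) V) : twist k (r • F) = r • twist k F := by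
  have : sigma^[k] (r • F) = r • sigma^[k] F := by
    induction k with
    | zero => rfl
    | succ n ih => simp only [Function.iterate_succ_apply', ih, map_smul]
  rw [twist, this, smul_comm]
  rfl

theorem schouten_add (F G : Model (c.anti κ) V) : schouten (F + G) = schouten F + schouten G := by
  ext H
  simp only [schouten, LinearMap.sum_apply, LinearMap.sub_apply, LinearMap.comp_apply,
    LinearMap.mulLeft_apply, twist_add, map_add, add_mul, LinearMap.add_apply,
    ← Finset.sum_add_distrib]
  exact Finset.sum_congr rfl fun a _ => by abel

theorem schouten_smul (r : ℝ) (F : Model (c.anti κ) V) : schouten (r • F) = r • schouten F := by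
  ext H
  simp only [schouten, LinearMap.sum_apply, LinearMap.sub_apply, LinearMap.comp_apply,
    LinearMap.mulLeft_apply, twist_smul, map_smul, smul_mul_assoc, LinearMap.smul_apply,
    Finset.smul_sum, smul_sub]

theorem schouten_parity {s t : ℕ} {F G : Model (c.anti κ) V} (hF : HasParity s F)
    (hG : HasParity t G) : HasParity (s + 1 + t) (schouten F G) := by
  rw [schouten_apply hF]
  refine HasParity.sum fun a => HasParity.sub ?_ ?_
  · refine (((hF.pd (fibre κ a)).mul (hG.pd (base κ a))).congr' ?_).smul _
    simp only [Nat.even_add, Nat.not_even_one, even_par_fibre, par_base]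
    tauto
  · refine (((hF.pd (base κ a)).mul (hG.pd (fibre κ a))).congr' ?_).smul _
    simp only [Nat.even_add, Nat.not_even_one, even_par_fibre, par_base]
    tauto

theorem schouten_isSuperDer {s : ℕ} {F : Model (c.anti κ) V} (hF : HasParity s F) :
    IsSuperDer (AlgHom.id ℝ _) (s + 1) (schouten F) := by
  refine IsSuperDer.sum _ fun a _ => IsSuperDer.sub ?_ ?_
  · rw [twist_eq hF]
    refine ((pd_isSuperDer (base κ a)).mulLeft isEvenHom_id ((hF.smul _).pd (fibre κ a))).congr ?_
    simp only [Nat.even_add, Nat.not_even_one, even_par_fibre, par_base]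
    tauto
  · rw [twist_eq hF]
    refine ((pd_isSuperDer (fibre κ a)).mulLeft isEvenHom_id ((hF.smul _).pd (base κ a))).congr ?_
    simp only [Nat.even_add, Nat.not_even_one, even_par_fibre, par_base]
    tauto

theorem odd_par_fibre {a : c.Coord} (h : Even (c.par a)) : Odd ((c.anti κ).par (fibre κ a)) :=
  Nat.not_even_iff_odd.mp fun h' => even_par_fibre a |>.mp h' h

theorem even_par_fibre_of_odd {a : c.Coord} (h : Odd (c.par a)) :
    Even ((c.anti κ).par (fibre κ a)) :=
  (even_par_fibre a).mpr (Nat.not_even_iff_odd.mpr h)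

theorem schouten_antisymm {s t : ℕ} {F G : Model (c.anti κ) V} (hF : HasParity s F)
    (hG : HasParity t G) :
    schouten F G = -((-1 : ℝ) ^ ((s + 1) * (t + 1)) • schouten G F) := by
  rw [schouten_apply hF, schouten_apply hG, Finset.smul_sum, ← Finset.sum_neg_distrib]
  refine Finset.sum_congr rfl fun a _ => ?_
  rw [(hF.pd (fibre κ a)).mul_comm (hG.pd (base κ a)),
    (hF.pd (base κ a)).mul_comm (hG.pd (fibre κ a)), par_base]
  rcases Nat.even_or_odd (c.par a) with ha | ha <;>
    [have hb := odd_par_fibre (κ := κ) ha; have hb := even_par_fibre_of_odd (κ := κ) ha] <;>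
    rcases Nat.even_or_odd s with hs | hs <;> rcases Nat.even_or_odd t with ht | ht <;>
    simp only [mul_add, add_mul, pow_add, pow_mul, ha.neg_one_pow, hb.neg_one_pow, hs.neg_one_pow,
      ht.neg_one_pow, one_pow, pow_one, one_smul, neg_smul, smul_sub, smul_neg, mul_one, one_mul,
      mul_neg, neg_neg] <;> abel

/-- The coordinate derivatives are derivations of the bracket. -/
theorem pd_schouten {s : ℕ} {F : Model (c.anti κ) V} (hF : HasParity s F)
    (A : (c.anti κ).Coord) (G : Model (c.anti κ) V) :
    pd A (schouten F G) = schouten (pd A F) G +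
      (-1 : ℝ) ^ ((c.anti κ).par A * (s + 1)) • schouten F (pd A G) := by
  rw [schouten_apply hF, schouten_apply hF, schouten_apply (hF.pd A), Finset.smul_sum, map_sum,
    ← Finset.sum_add_distrib]
  refine Finset.sum_congr rfl fun a _ => ?_
  have e1 := pd_isSuperDer A _ _ (pd (base κ a) G) (hF.pd (fibre κ a))
  have e2 := pd_isSuperDer A _ _ (pd (fibre κ a) G) (hF.pd (base κ a))
  simp only [AlgHom.id_apply] at e1 e2
  rw [map_sub, map_smul, map_smul, e1, e2, pd_pd_comm A (fibre κ a), pd_pd_comm A (base κ a),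
    pd_pd_comm A (fibre κ a), pd_pd_comm A (base κ a), par_base]
  generalize (c.anti κ).par A = p
  rcases Nat.even_or_odd (c.par a) with ha | ha <;>
    [have hb := odd_par_fibre (κ := κ) ha; have hb := even_par_fibre_of_odd (κ := κ) ha] <;>
    rcases Nat.even_or_odd s with hs | hs <;> rcases Nat.even_or_odd p with ht | ht <;>
    simp only [mul_add, add_mul, pow_add, pow_mul, ha.neg_one_pow, hb.neg_one_pow, hs.neg_one_pow,
      ht.neg_one_pow, one_pow, pow_one, one_smul, neg_smul, smul_add, smul_neg, mul_one,
      one_mul, mul_neg, neg_mul, neg_neg] <;> abel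

theorem schouten_x_base {s : ℕ} {F : Model (c.anti κ) V} (hF : HasParity s F) (a : c.Coord) :
    schouten F (x (base κ a)) = (-1 : ℝ) ^ ((c.par a + 1) * (s + 1)) • pd (fibre κ a) F := by
  rw [schouten_apply hF, Finset.sum_eq_single a]
  · simp [pd_base_x_base, pd_fibre_x_base]
  · intro b _ hb
    simp [pd_base_x_base, pd_fibre_x_base, hb]
  · simp

theorem schouten_x_fibre {s : ℕ} {F : Model (c.anti κ) V} (hF : HasParity s F) (a : c.Coord) :
    schouten F (x (fibre κ a)) = -((-1 : ℝ) ^ (c.par a * (s + 1)) • pd (base κ a) F) := by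
  rw [schouten_apply hF, Finset.sum_eq_single a]
  · simp [pd_fibre_x_fibre, pd_base_x_fibre]
  · intro b _ hb
    simp [pd_fibre_x_fibre, pd_base_x_fibre, hb]
  · simp

/-- The Jacobi identity. Both sides are super-derivations in the last argument; on a coordinate it
says that the derivative in the conjugate coordinate is a derivation of the bracket. -/
theorem schouten_jacobi {s t : ℕ} {F G : Model (c.anti κ) V} (hF : HasParity s F)
    (hG : HasParity t G) (H : Model (c.anti κ) V) :
    schouten F (schouten G H) = schouten (schouten F G) H +
      (-1 : ℝ) ^ ((s + 1) * (t + 1)) • schouten G (schouten F H) := by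
  have h1 := (schouten_isSuperDer hF).commutator (schouten_isSuperDer hG)
    (fun _ _ h => schouten_parity hF h) (fun _ _ h => schouten_parity hG h)
  have h2 := schouten_isSuperDer (schouten_parity hF hG)
  refine sub_eq_iff_eq_add.mp (h1.ext (E := schouten (schouten F G)) (h2.congr ?_) (fun A => ?_) H)
  · simp only [parity_simps]; tauto
  · simp only [LinearMap.sub_apply, LinearMap.smul_apply, LinearMap.comp_apply]
    rcases coord_cases A with ⟨a, rfl⟩ | ⟨a, rfl⟩
    · rw [schouten_x_base hF, schouten_x_base hG, schouten_x_base (schouten_parity hF hG),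
        map_smul, map_smul, pd_schouten hF, schouten_antisymm hG (hF.pd _)]
      rcases Nat.even_or_odd (c.par a) with ha | ha <;>
        [have hb := odd_par_fibre (κ := κ) ha; have hb := even_par_fibre_of_odd (κ := κ) ha] <;>
        rcases Nat.even_or_odd s with hs | hs <;> rcases Nat.even_or_odd t with ht | ht <;>
        simp only [mul_add, add_mul, pow_add, pow_mul, ha.neg_one_pow, hb.neg_one_pow,
          hs.neg_one_pow, ht.neg_one_pow, one_pow, pow_one, one_smul, neg_smul, smul_add, smul_neg,
          mul_one, mul_neg, neg_neg] <;> abel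
    · rw [schouten_x_fibre hF, schouten_x_fibre hG, schouten_x_fibre (schouten_parity hF hG),
        map_neg, map_neg, map_smul, map_smul, pd_schouten hF, schouten_antisymm hG (hF.pd _),
        par_base]
      rcases Nat.even_or_odd (c.par a) with ha | ha <;>
        rcases Nat.even_or_odd s with hs | hs <;> rcases Nat.even_or_odd t with ht | ht <;>
        simp only [mul_add, add_mul, pow_add, pow_mul, ha.neg_one_pow,
          hs.neg_one_pow, ht.neg_one_pow, one_pow, pow_one, one_smul, neg_smul, smul_add, smul_neg,
          mul_one, mul_neg, neg_neg] <;> abel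

theorem wEuler_schouten {w : (c.anti κ).Coord → ℝ} {k : ℝ}
    (hw : ∀ a, w (base κ a) + w (fibre κ a) = k) {s : ℕ} {F : Model (c.anti κ) V}
    (hF : HasParity s F) (G : Model (c.anti κ) V) :
    wEuler w (schouten F G) =
      schouten (wEuler w F) G + schouten F (wEuler w G) - k • schouten F G := by
  rw [schouten_apply hF, schouten_apply hF, schouten_apply (hF.wEuler w), Finset.smul_sum, map_sum,
    ← Finset.sum_add_distrib, ← Finset.sum_sub_distrib]
  refine Finset.sum_congr rfl fun a _ => ?_
  simp only [map_sub, map_smul, wEuler_mul, wEuler_pd, sub_mul, mul_sub, smul_mul_assoc,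
    mul_smul_comm, ← hw a]
  module

/-! ### The fibrewise degree -/

/-- The fibrewise degree of the coordinates: `0` for `x^a` and `1` for `x^*_a`. -/
def fibDeg : (c.anti κ).Coord → ℝ :=
  Sum.elim (fun _ => 0) (Sum.elim (Sum.elim (fun _ => 0) (fun _ => 1))
    (Sum.elim (fun _ => 0) (fun _ => 1)))

theorem fibDeg_base (a : c.Coord) : fibDeg (base κ a) = 0 := by
  rcases a with a | e | o <;> rfl

theorem fibDeg_fibre (a : c.Coord) : fibDeg (fibre κ a) = 1 := by
  rcases a with a | e | o <;> rfl

/-- The function is homogeneous of fibrewise degree `k`. -/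
def HasDeg (k : ℝ) (F : Model (c.anti κ) V) : Prop := wEuler fibDeg F = k • F

namespace HasDeg

variable {k l : ℝ} {F G : Model (c.anti κ) V}

theorem add (hF : HasDeg k F) (hG : HasDeg k G) : HasDeg k (F + G) := by
  rw [HasDeg] at *
  rw [map_add, hF, hG, smul_add]

theorem smul (r : ℝ) (hF : HasDeg k F) : HasDeg k (r • F) := by
  rw [HasDeg] at *
  rw [map_smul, hF, smul_comm]

theorem neg (hF : HasDeg k F) : HasDeg k (-F) := by
  rw [← neg_one_smul ℝ F]
  exact hF.smul _

theorem sub (hF : HasDeg k F) (hG : HasDeg k G) : HasDeg k (F - G) := by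
  rw [sub_eq_add_neg]
  exact hF.add hG.neg

theorem sum {ι : Type} [Fintype ι] {F : ι → Model (c.anti κ) V} (hF : ∀ i, HasDeg k (F i)) :
    HasDeg k (∑ i, F i) := by
  rw [HasDeg, map_sum, Finset.smul_sum]
  exact Finset.sum_congr rfl fun i _ => hF i

theorem mul (hF : HasDeg k F) (hG : HasDeg l G) : HasDeg (k + l) (F * G) := by
  rw [HasDeg] at *
  rw [wEuler_mul, hF, hG, smul_mul_assoc, mul_smul_comm, ← add_smul]

theorem schouten {s : ℕ} (hs : HasParity s F) (hF : HasDeg k F) (hG : HasDeg l G) :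
    HasDeg (k + l - 1) (schouten F G) := by
  rw [HasDeg] at *
  rw [wEuler_schouten (k := 1) (fun a => by rw [fibDeg_base, fibDeg_fibre, zero_add]) hs, hF, hG,
    schouten_smul, map_smul, LinearMap.smul_apply]
  module

end HasDeg

theorem hasDeg_pull (f : Model c V) : HasDeg 0 (pull κ f) := by
  rw [HasDeg, wEuler_apply, zero_smul]
  refine Finset.sum_eq_zero fun A _ => ?_
  rcases coord_cases A with ⟨a, rfl⟩ | ⟨a, rfl⟩
  · rw [fibDeg_base, zero_smul]
  · rw [pd_fibre_pull, mul_zero, smul_zero]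

theorem hasDeg_x_fibre (a : c.Coord) : HasDeg 1 (x (fibre κ a) : Model (c.anti κ) V) := by
  rw [HasDeg, wEuler_x, fibDeg_fibre]

/-- A function of nonzero fibrewise degree whose brackets with all functions on the base vanish is
zero. -/
theorem HasDeg.eq_zero {k : ℝ} (hk : k ≠ 0) {s : ℕ} {F : Model (c.anti κ) V} (hs : HasParity s F)
    (hF : HasDeg k F)
    (h : ∀ (t : ℕ) (f : Model c V), HasParity t f → Anti.schouten F (pull κ f) = 0) : F = 0 := by
  have hd : ∀ a, pd (fibre κ a) F = 0 := fun a => by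
    have := h _ _ (hasParity_x a)
    rw [pull_x, schouten_x_base hs] at this
    exact (smul_eq_zero.mp this).resolve_left (pow_ne_zero _ (by norm_num))
  have h0 : wEuler fibDeg F = 0 := by
    rw [wEuler_apply]
    refine Finset.sum_eq_zero fun A _ => ?_
    rcases coord_cases A with ⟨a, rfl⟩ | ⟨a, rfl⟩
    · rw [fibDeg_base, zero_smul]
    · rw [hd, mul_zero, smul_zero]
  rw [HasDeg, h0] at hF
  exact (smul_eq_zero.mp hF.symm).resolve_left hk

end Anti

namespace Model

variable {c : CoordType} {V : Opens (Fin c.n → ℝ)}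

/-- A vector field of parity `r` on a coordinate domain. -/
structure IsVF (r : ℕ) (Y : Model c V →ₗ[ℝ] Model c V) : Prop where
  isSuperDer : IsSuperDer (AlgHom.id ℝ _) r Y
  parity : ∀ (s : ℕ) (f : Model c V), HasParity s f → HasParity (r + s) (Y f)

/-- An even Poisson bracket on a coordinate domain. -/
structure IsPB (B : Model c V →ₗ[ℝ] Model c V →ₗ[ℝ] Model c V) : Prop where
  parity : ∀ (s t : ℕ) (f g : Model c V), f.HasParity s → g.HasParity t →
    (B f g).HasParity (s + t)
  antisymm : ∀ (s t : ℕ) (f g : Model c V), f.HasParity s → g.HasParity t →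
    B f g = -((-1 : ℝ) ^ (s * t) • B g f)
  jacobi : ∀ (s t : ℕ) (f g h : Model c V), f.HasParity s → g.HasParity t →
    B f (B g h) = B (B f g) h + (-1 : ℝ) ^ (s * t) • B g (B f h)
  leibniz : ∀ (s t : ℕ) (f g h : Model c V), f.HasParity s → g.HasParity t →
    B f (g * h) = B f g * h + (-1 : ℝ) ^ (s * t) • (g * B f h)

theorem IsPB.isVF {B : Model c V →ₗ[ℝ] Model c V →ₗ[ℝ] Model c V} (hB : IsPB B) {s : ℕ}
    {f : Model c V} (hf : HasParity s f) : IsVF s (B f) :=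
  ⟨fun t g h hg => hB.leibniz s t f g h hf hg, fun t g hg => hB.parity s t f g hf hg⟩

end Model

namespace Anti

open Model

variable {c : CoordType} {κ : ℤ} {V : Opens (Fin c.n → ℝ)}

/-! ### Functions attached to vector fields -/

section theta

variable {r : ℕ} {Y : Model c V →ₗ[ℝ] Model c V}

theorem theta_parity (hY : IsVF r Y) : HasParity (r + 1) (theta κ Y) := by
  refine (HasParity.sum fun a => ((pull_parity (hY.parity _ _ (hasParity_x a))).mul
    (hasParity_x _)).congr' ?_).neg
  simp only [Nat.even_add, Nat.not_even_one, even_par_fibre]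
  tauto

theorem theta_hasDeg (Y : Model c V →ₗ[ℝ] Model c V) : HasDeg 1 (theta κ Y) := by
  refine (HasDeg.sum fun a => ?_).neg
  simpa using (hasDeg_pull (κ := κ) (Y (x a))).mul (hasDeg_x_fibre a)

theorem pd_fibre_pull_mul {s : ℕ} {f : Model c V} (hf : HasParity s f) (a : c.Coord)
    (F : Model (c.anti κ) V) :
    pd (fibre κ a) (pull κ f * F) =
      (-1 : ℝ) ^ ((c.par a + 1) * s) • (pull κ f * pd (fibre κ a) F) := by
  have h := pd_isSuperDer (fibre κ a) s (pull κ f) F (pull_parity hf)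
  rw [pd_fibre_pull, zero_mul, zero_add] at h
  rw [h, AlgHom.id_apply]
  refine sgn_smul_congr ?_ _
  simp only [parity_simps, even_par_fibre]

theorem pd_fibre_theta (hY : IsVF r Y) (a : c.Coord) :
    pd (fibre κ a) (theta κ Y) =
      -((-1 : ℝ) ^ ((c.par a + 1) * (r + c.par a)) • pull κ (Y (x a))) := by
  rw [theta, map_neg, map_sum, Finset.sum_eq_single a]
  · rw [pd_fibre_pull_mul (hY.parity _ _ (hasParity_x a)), pd_fibre_x_fibre, if_pos rfl, mul_one]
  · intro b _ hb
    rw [pd_fibre_pull_mul (hY.parity _ _ (hasParity_x b)), pd_fibre_x_fibre, if_neg hb.symm,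
      mul_zero, smul_zero]
  · simp

theorem schouten_theta_pull (hY : IsVF r Y) (f : Model c V) :
    schouten (theta κ Y) (pull κ f) = -pull κ (Y f) := by
  have h1 := (schouten_isSuperDer (theta_parity (κ := κ) hY)).comp_right
    (isEvenHom_pull (c := c) (V := V))
  have h2 := (hY.isSuperDer.comp_left (pull κ)).smul (-1)
  have := (h1.congr (t := r) (by simp [parity_simps])).ext h2 (fun a => ?_) f
  · simpa using this
  · simp only [LinearMap.comp_apply, LinearMap.smul_apply, AlgHom.toLinearMap_apply, pull_x,
      neg_smul, one_smul]
    rw [schouten_x_base (theta_parity hY), pd_fibre_theta hY, smul_neg, smul_smul, ← pow_add]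
    congr 1
    rw [Even.neg_one_pow, one_smul]
    simp only [parity_simps]
    tauto

end theta

/-! ### The bivector of a Poisson bracket -/

section bivector

variable {B : Model c V →ₗ[ℝ] Model c V →ₗ[ℝ] Model c V}

theorem bivector_parity (hB : IsPB B) : HasParity 0 (bivector κ B) := by
  refine (HasParity.sum fun a => HasParity.sum fun b => ?_).smul _
  refine ((pull_parity ((hB.parity _ _ _ _ (hasParity_x a) (hasParity_x b)).smul _)).mul
    ((hasParity_x (fibre κ b)).mul (hasParity_x (fibre κ a)))).congr' ?_
  simp only [Nat.even_add, even_par_fibre]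
  tauto

theorem bivector_hasDeg (B : Model c V →ₗ[ℝ] Model c V →ₗ[ℝ] Model c V) :
    HasDeg 2 (bivector κ B) := by
  refine (HasDeg.sum fun a => HasDeg.sum fun b => ?_).smul _
  have := (hasDeg_pull (κ := κ) ((-1 : ℝ) ^ c.par a • B (x a) (x b))).mul
    ((hasDeg_x_fibre b).mul (hasDeg_x_fibre (κ := κ) (V := V) a))
  norm_num at this ⊢
  exact this

theorem pd_fibre_bivector (hB : IsPB B) (a : c.Coord) :
    pd (fibre κ a) (bivector κ B) = theta κ (B (x a)) := by
  have e : ∀ b d : c.Coord, pd (fibre κ a) (pull κ ((-1 : ℝ) ^ c.par b • B (x b) (x d)) *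
      (x (fibre κ d) * x (fibre κ b))) =
      (if a = d then -(pull κ (B (x a) (x b)) * x (fibre κ b)) else 0) +
      (if a = b then -(pull κ (B (x a) (x d)) * x (fibre κ d)) else 0) := by
    intro b d
    have hp := (hB.parity _ _ _ _ (hasParity_x b) (hasParity_x d)).smul ((-1 : ℝ) ^ c.par b)
    have hx := pd_isSuperDer (fibre κ a) _ (x (fibre κ d)) (x (fibre κ b) : Model (c.anti κ) V)
      (hasParity_x _)
    rw [pd_fibre_x_fibre, pd_fibre_x_fibre, AlgHom.id_apply, AlgHom.id_apply] at hx
    rw [pd_fibre_pull_mul hp, hx, mul_add (pull κ _), smul_add]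
    congr 1
    · split_ifs with h
      · subst h
        rw [hB.antisymm _ _ _ _ (hasParity_x b) (hasParity_x a), one_mul]
        simp only [map_smul, map_neg, smul_mul_assoc, smul_neg, neg_mul, smul_smul, ← pow_add]
        rw [Even.neg_one_pow, one_smul]
        simp only [parity_simps]
        tauto
      · rw [zero_mul, mul_zero, smul_zero]
    · split_ifs with h
      · subst h
        rw [mul_one, ← neg_one_smul ℝ (_ * _), map_smul, mul_smul_comm, smul_mul_assoc, smul_smul,
          smul_smul, ← pow_add, ← pow_add, Odd.neg_one_pow]
        simp only [parity_simps, ← Nat.not_even_iff_odd, even_par_fibre]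
        tauto
      · rw [mul_zero, smul_zero, mul_zero, smul_zero]
  rw [bivector, map_smul, map_sum]
  simp only [map_sum, e, Finset.sum_add_distrib, Finset.sum_ite_eq, Finset.mem_univ, if_true]
  rw [Finset.sum_comm (f := fun b d => if a = b then _ else _)]
  simp only [Finset.sum_ite_eq, Finset.mem_univ, if_true, Finset.sum_neg_distrib]
  rw [theta, ← two_smul ℝ, smul_smul]
  norm_num

/-- The linear map `f ↦ (-1)^{f̃ + 1} θ_{\{f, -\}}`. -/
def bivectorAct (κ : ℤ) (B : Model c V →ₗ[ℝ] Model c V →ₗ[ℝ] Model c V) :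
    Model c V →ₗ[ℝ] Model (c.anti κ) V :=
  ∑ a, LinearMap.mulRight ℝ (x (fibre κ a)) ∘ₗ (pull κ).toLinearMap ∘ₗ B.flip (x a) ∘ₗ
    (sigma : Model c V →ₐ[ℝ] Model c V).toLinearMap

theorem bivectorAct_apply {s : ℕ} {f : Model c V} (hf : HasParity s f) :
    bivectorAct κ B f = -((-1 : ℝ) ^ s • theta κ (B f)) := by
  have hf' : sigma f = (-1 : ℝ) ^ s • f := hf
  simp only [bivectorAct, LinearMap.sum_apply, LinearMap.comp_apply, LinearMap.mulRight_apply,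
    AlgHom.toLinearMap_apply, LinearMap.flip_apply, hf', map_smul, theta, smul_neg,
    neg_neg, Finset.smul_sum]

theorem bivectorAct_isSuperDer (hB : IsPB B) : IsSuperDer (pull κ) 1 (bivectorAct κ B) := by
  refine IsSuperDer.of_homogeneous fun s t f g hf hg => ?_
  rw [bivectorAct_apply hf, bivectorAct_apply hg, bivectorAct_apply (hf.mul hg)]
  simp only [theta, smul_neg, neg_neg, Finset.smul_sum, Finset.sum_mul, Finset.mul_sum,
    ← Finset.sum_add_distrib]
  refine Finset.sum_congr rfl fun a _ => ?_
  have hx := hasParity_x (V := V) a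
  -- the Leibniz rule in the first argument, by antisymmetry
  have e : B (f * g) (x a) = f * B g (x a) + (-1 : ℝ) ^ (t * c.par a) • (B f (x a) * g) := by
    rw [hB.antisymm _ _ _ _ (hf.mul hg) hx, hB.leibniz _ _ _ _ _ hx hf,
      hB.antisymm _ _ _ _ hx hf, hB.antisymm _ _ _ _ hx hg]
    rcases Nat.even_or_odd (c.par a) with ha | ha <;>
      rcases Nat.even_or_odd s with hs | hs <;> rcases Nat.even_or_odd t with ht | ht <;>
      simp only [add_mul, pow_add, pow_mul, ha.neg_one_pow, hs.neg_one_pow,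
        ht.neg_one_pow, one_pow, one_smul, neg_smul, smul_add, smul_neg, mul_one, neg_add,
        mul_neg, neg_mul, neg_neg] <;> abel
  have e2 : pull κ g * x (fibre κ a) =
      (-1 : ℝ) ^ (t * (c.par a + 1)) • (x (fibre κ a) * pull κ g) := by
    rw [(pull_parity hg).mul_comm (hasParity_x (fibre κ a))]
    refine sgn_smul_congr ?_ _
    simp only [parity_simps, even_par_fibre]
  rw [e, map_add, map_smul, map_mul, map_mul, add_mul, smul_mul_assoc, mul_assoc (pull κ (B f _)),
    e2, mul_smul_comm, smul_add, smul_smul, smul_smul, ← pow_add, ← pow_add, mul_assoc, add_comm]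
  rcases Nat.even_or_odd (c.par a) with ha | ha <;>
    rcases Nat.even_or_odd s with hs | hs <;> rcases Nat.even_or_odd t with ht | ht <;>
    simp only [mul_add, pow_add, pow_mul, ha.neg_one_pow, hs.neg_one_pow,
      ht.neg_one_pow, one_pow, one_smul, neg_smul, mul_one, one_mul, mul_neg, neg_mul,
      neg_neg, mul_assoc]

theorem schouten_bivector_pull (hB : IsPB B) {s : ℕ} {f : Model c V} (hf : HasParity s f) :
    schouten (bivector κ B) (pull κ f) = -((-1 : ℝ) ^ s • theta κ (B f)) := by
  have h1 := (schouten_isSuperDer (bivector_parity (κ := κ) hB)).comp_right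
    (isEvenHom_pull (c := c) (V := V))
  rw [← bivectorAct_apply hf]
  refine IsSuperDer.ext h1 (bivectorAct_isSuperDer hB) (fun a => ?_) f
  rw [LinearMap.comp_apply, AlgHom.toLinearMap_apply, pull_x, schouten_x_base (bivector_parity hB),
    pd_fibre_bivector hB, bivectorAct_apply (hasParity_x a), ← neg_smul]
  congr 1
  ring

end bivector

end Anti

namespace Anti

open Model

variable {c : CoordType} {κ : ℤ} {V : Opens (Fin c.n → ℝ)}

/-! ### The square of the field of the odd double -/

theorem schouten_zero : schouten (0 : Model (c.anti κ) V) = 0 := by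
  rw [← zero_smul ℝ (0 : Model (c.anti κ) V), schouten_smul, zero_smul]

theorem schouten_schouten_theta_pull {r t : ℕ} {Y Z : Model c V →ₗ[ℝ] Model c V} (hY : IsVF r Y)
    (hZ : IsVF t Z) (f : Model c V) :
    schouten (schouten (theta κ Y) (theta κ Z)) (pull κ f) =
      pull κ (Y (Z f) - (-1 : ℝ) ^ (r * t) • Z (Y f)) := by
  have h := schouten_jacobi (theta_parity (κ := κ) hY) (theta_parity hZ) (pull κ f)
  rw [schouten_theta_pull hY, schouten_theta_pull hZ, map_neg, map_neg, schouten_theta_pull hY,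
    schouten_theta_pull hZ, neg_neg, neg_neg] at h
  rw [map_sub, map_smul, sgn_smul_congr (n := (r + 1 + 1) * (t + 1 + 1))]
  · exact eq_sub_of_add_eq h.symm
  · simp [parity_simps]

variable {Q : Model c V →ₗ[ℝ] Model c V} {B : Model c V →ₗ[ℝ] Model c V →ₗ[ℝ] Model c V}

theorem theta_parity_zero (hQ : IsVF 1 Q) : HasParity 0 (theta κ Q) :=
  (theta_parity hQ).congr rfl

/-- `Q'` commutes with itself since `Q² = 0`. -/
theorem schouten_theta_theta (hQ : IsVF 1 Q) (hQ2 : ∀ f, Q (Q f) = 0) :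
    schouten (theta κ Q) (theta κ Q) = 0 := by
  refine HasDeg.eq_zero (k := 1 + 1 - 1) (by norm_num)
    (schouten_parity (theta_parity hQ) (theta_parity hQ))
    ((theta_hasDeg Q).schouten (theta_parity hQ) (theta_hasDeg Q)) fun t f _ => ?_
  rw [schouten_schouten_theta_pull hQ hQ, hQ2, smul_zero, sub_zero, map_zero]

/-- `Q'` commutes with `P` since `Q` is a derivation of the bracket. -/
theorem schouten_theta_bivector (hQ : IsVF 1 Q) (hB : IsPB B)
    (hQB : ∀ (s : ℕ) (f g : Model c V), HasParity s f →
      Q (B f g) = B (Q f) g + (-1 : ℝ) ^ s • B f (Q g)) :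
    schouten (theta κ Q) (bivector κ B) = 0 := by
  refine HasDeg.eq_zero (k := 1 + 2 - 1) (by norm_num)
    (schouten_parity (theta_parity hQ) (bivector_parity hB))
    ((theta_hasDeg Q).schouten (theta_parity hQ) (bivector_hasDeg B)) fun s f hf => ?_
  have hBf := hB.isVF hf
  have hQf := hQ.parity s f hf
  have hBQf := hB.isVF hQf
  have key : schouten (theta κ Q) (theta κ (B f)) + theta κ (B (Q f)) = 0 := by
    have hp : HasParity (1 + s + 1) (schouten (theta κ Q) (theta κ (B f))) :=
      (schouten_parity (theta_parity hQ) (theta_parity hBf)).congr (by omega)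
    refine HasDeg.eq_zero (k := 1) one_ne_zero (hp.add (theta_parity hBQf)) (HasDeg.add ?_
      (theta_hasDeg _)) fun t g hg => ?_
    · have := (theta_hasDeg (κ := κ) Q).schouten (theta_parity hQ) (theta_hasDeg (B f))
      rwa [add_sub_cancel_right] at this
    · rw [schouten_add, LinearMap.add_apply, schouten_schouten_theta_pull hQ hBf,
        schouten_theta_pull hBQf, ← map_neg, ← map_add, hQB s f g hf, one_mul]
      refine (congrArg (pull κ) ?_).trans (map_zero (pull κ))
      abel
  have h := schouten_jacobi (theta_parity_zero (κ := κ) hQ) (bivector_parity hB) (pull κ f)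
  rw [schouten_bivector_pull hB hf, schouten_theta_pull hQ, map_neg, map_neg, map_smul,
    schouten_bivector_pull hB hQf] at h
  rw [eq_neg_of_add_eq_zero_left key] at h
  rw [← sub_eq_iff_eq_add] at h
  rw [← h]
  simp [pow_add]

/-- `P` commutes with itself by the Jacobi identity of the Poisson bracket. -/
theorem schouten_bivector_bivector (hB : IsPB B) :
    schouten (bivector κ B) (bivector κ B) = 0 := by
  have hP := bivector_parity (κ := κ) hB
  refine HasDeg.eq_zero (k := 2 + 2 - 1) (by norm_num) (schouten_parity hP hP)
    ((bivector_hasDeg B).schouten hP (bivector_hasDeg B)) fun s f hf => ?_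
  have hBf := hB.isVF hf
  have key : schouten (bivector κ B) (theta κ (B f)) = 0 := by
    refine HasDeg.eq_zero (k := 2 + 1 - 1) (by norm_num) (schouten_parity hP (theta_parity hBf))
      ((bivector_hasDeg B).schouten hP (theta_hasDeg _)) fun t g hg => ?_
    have hBg := hB.isVF hg
    have hBfg := hB.isVF (hB.parity s t f g hf hg)
    have key2 : theta κ (B (B f g)) + schouten (theta κ (B f)) (theta κ (B g)) = 0 := by
      have hp : HasParity (s + t + 1) (schouten (theta κ (B f)) (theta κ (B g))) :=
        (schouten_parity (theta_parity hBf) (theta_parity hBg)).congr (by omega)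
      refine HasDeg.eq_zero (k := 1) one_ne_zero ((theta_parity hBfg).add hp)
        ((theta_hasDeg _).add ?_) fun u h _ => ?_
      · have := (theta_hasDeg (κ := κ) (B f)).schouten (theta_parity hBf) (theta_hasDeg (B g))
        rwa [add_sub_cancel_right] at this
      · rw [schouten_add, LinearMap.add_apply, schouten_schouten_theta_pull hBf hBg,
          schouten_theta_pull hBfg, ← map_neg, ← map_add, hB.jacobi s t f g h hf hg]
        refine (congrArg (pull κ) ?_).trans (map_zero (pull κ))
        abel
    have h := schouten_jacobi hP (theta_parity hBf) (pull κ g)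
    rw [schouten_bivector_pull hB hg, schouten_theta_pull hBf, map_neg, map_neg, map_smul,
      schouten_bivector_pull hB (hB.parity s t f g hf hg), neg_neg, ← sub_eq_iff_eq_add] at h
    rw [← h, eq_neg_of_add_eq_zero_left key2]
    rcases Nat.even_or_odd s with hs | hs <;> rcases Nat.even_or_odd t with ht | ht <;>
      simp [pow_add, hs.neg_one_pow, ht.neg_one_pow]
  have h := schouten_jacobi hP hP (pull κ f)
  rw [schouten_bivector_pull hB hf, map_neg, map_smul, key, smul_zero, neg_zero, smul_zero,
    add_zero] at h
  exact h.symm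

/-- The field `X_{Q'} + lam X_P` is the Hamiltonian field of the self-commuting even function
`Q' + lam P`, hence has square zero. -/
theorem schouten_sq_zero (hQ : IsVF 1 Q) (hQ2 : ∀ f, Q (Q f) = 0) (hB : IsPB B)
    (hQB : ∀ (s : ℕ) (f g : Model c V), HasParity s f →
      Q (B f g) = B (Q f) g + (-1 : ℝ) ^ s • B f (Q g)) (lam : ℝ) (F : Model (c.anti κ) V) :
    schouten (theta κ Q + lam • bivector κ B) (schouten (theta κ Q + lam • bivector κ B) F) = 0 := by
  have hθ := theta_parity_zero (κ := κ) hQ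
  have hP := bivector_parity (κ := κ) hB
  have h0 : schouten (theta κ Q + lam • bivector κ B) (theta κ Q + lam • bivector κ B) = 0 := by
    rw [schouten_add, schouten_smul, LinearMap.add_apply, LinearMap.smul_apply, map_add, map_add,
      map_smul, map_smul, schouten_antisymm hP hθ, schouten_theta_theta hQ hQ2,
      schouten_theta_bivector hQ hB hQB, schouten_bivector_bivector hB]
    simp
  have h := schouten_jacobi (hθ.add (hP.smul lam)) (hθ.add (hP.smul lam)) F
  rw [h0, schouten_zero, LinearMap.zero_apply, zero_add] at h
  simp only [zero_add, mul_one, pow_one, neg_smul, one_smul] at h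
  refine (smul_eq_zero.mp ?_).resolve_left (two_ne_zero' ℝ)
  rw [two_smul]
  exact eq_neg_iff_add_eq_zero.mp h

/-! ### Weights -/

theorem wt_base (a : c.Coord) : (c.anti κ).wt (base κ a) = c.wt a := by
  rcases a with a | e | o <;> simp [CoordType.wt, base]

theorem wt_fibre (a : c.Coord) : (c.anti κ).wt (fibre κ a) = κ - c.wt a := by
  rcases a with a | e | o <;> simp [CoordType.wt, fibre] <;> ring

theorem pull_hasWeight {k : ℤ} {f : Model c V} (hf : HasWeight k f) :
    HasWeight k (pull κ f) := by
  rw [HasWeight, euler_eq] at *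
  rw [wEuler_hom isEvenHom_pull (w := fun a => (c.wt a : ℝ)) (fun a => by
    rw [pull_x, wEuler_x, wt_base]), hf, map_smul]

theorem schouten_hasWeight {s : ℕ} {k l : ℤ} {F G : Model (c.anti κ) V} (hs : HasParity s F)
    (hF : HasWeight k F) (hG : HasWeight l G) : HasWeight (k + l - κ) (schouten F G) := by
  rw [HasWeight, euler_eq] at *
  rw [wEuler_schouten (k := κ) (fun a => by rw [wt_base, wt_fibre]; push_cast; ring) hs, hF, hG,
    schouten_smul, map_smul, LinearMap.smul_apply]
  push_cast
  module

theorem theta_hasWeight {q : ℤ} (hQ : ∀ (k : ℤ) (f : Model c V), HasWeight k f →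
    HasWeight (q + k) (Q f)) : HasWeight (q + κ) (theta κ Q) := by
  refine (HasWeight.sum fun a => ((pull_hasWeight (hQ _ _ (hasWeight_x a))).mul
    (hasWeight_x (c := c.anti κ) (fibre κ a))).congr ?_).neg
  rw [wt_fibre]
  ring

theorem bivector_hasWeight {p : ℤ} (hB : ∀ (k l : ℤ) (f g : Model c V), HasWeight k f →
    HasWeight l g → HasWeight (p + k + l) (B f g)) : HasWeight (p + 2 * κ) (bivector κ B) := by
  refine (HasWeight.sum fun a => HasWeight.sum fun b => ?_).smul _
  refine ((pull_hasWeight ((hB _ _ _ _ (hasWeight_x a) (hasWeight_x b)).smul _)).mul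
    ((hasWeight_x (c := c.anti κ) (fibre κ b)).mul
      (hasWeight_x (c := c.anti κ) (fibre κ a)))).congr ?_
  rw [wt_fibre, wt_fibre]
  ring

end Anti

namespace Model

variable {c c' : CoordType} {V : Opens (Fin c.n → ℝ)} {V' : Opens (Fin c'.n → ℝ)}

theorem isEvenHom_of_generators {χ : Model c V →ₐ[ℝ] Model c' V'}
    (hS : ∀ s, HasParity 0 (χ (ofSmooth c s)))
    (hx : ∀ a, HasParity (c.par (Sum.inr a)) (χ (x (Sum.inr a)))) : IsEvenHom χ := by
  have h : (sigma : Model c' V' →ₐ[ℝ] Model c' V').comp χ = χ.comp sigma := by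
    refine hom_ext (fun s => ?_) (fun a => ?_)
    · have h1 := hS s
      have h2 := hasParity_ofSmooth (c := c) s
      rw [HasParity, pow_zero, one_smul] at h1 h2
      rw [AlgHom.comp_apply, AlgHom.comp_apply, h1, h2]
    · have h1 := hx a
      have h2 := hasParity_x (V := V) (Sum.inr a : c.Coord)
      rw [HasParity] at h1 h2
      rw [AlgHom.comp_apply, AlgHom.comp_apply, h1, h2, map_smul]
  intro s f hf
  have := DFunLike.congr_fun h f
  rw [AlgHom.comp_apply, AlgHom.comp_apply] at this
  rw [HasParity] at *
  rw [this, hf, map_smul]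

end Model

namespace Anti

open Model

variable {c c' : CoordType} {κ : ℤ} {V : Opens (Fin c.n → ℝ)} {V' : Opens (Fin c'.n → ℝ)}

/-! ### The coordinate changes of the anticotangent bundle -/

/-- The fibre coordinate `x^*_b` rewritten in other coordinates: `φ` is the change of coordinates on
functions and `ψ` its inverse. -/
def fibreLift (κ : ℤ) (φ : Model c V →ₐ[ℝ] Model c' V') (ψ : Model c' V' →ₐ[ℝ] Model c V)
    (b : c.Coord) : Model (c'.anti κ) V' :=
  ∑ a : c'.Coord, pull κ (φ (pd b (ψ (x a)))) * x (fibre κ a)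

section lift

variable {φ : Model c V →ₐ[ℝ] Model c' V'} {ψ : Model c' V' →ₐ[ℝ] Model c V}

theorem fibreLift_parity_aux (hφ : IsEvenHom φ) (hψ : IsEvenHom ψ) (a : c'.Coord) (b : c.Coord) :
    HasParity (c.par b + c'.par a) (φ (pd b (ψ (x a)))) :=
  hφ _ _ ((hψ _ _ (hasParity_x a)).pd b)

theorem fibreLift_parity (hφ : IsEvenHom φ) (hψ : IsEvenHom ψ) (b : c.Coord) :
    HasParity (c.par b + 1) (fibreLift κ φ ψ b) := by
  refine HasParity.sum fun a => ((pull_parity (fibreLift_parity_aux hφ hψ a b)).mul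
    (hasParity_x _)).congr' ?_
  simp only [Nat.even_add, Nat.not_even_one, even_par_fibre]
  tauto

theorem fibreLift_hasDeg (b : c.Coord) : HasDeg 1 (fibreLift κ φ ψ b) :=
  HasDeg.sum fun a => by
    simpa using (hasDeg_pull (κ := κ) (φ (pd b (ψ (x a))))).mul (hasDeg_x_fibre a)

/-- The change of coordinates of the anticotangent bundle induced by the change of coordinates `φ`
of the base with inverse `ψ`. -/
def antiLift (κ : ℤ) (hφ : IsEvenHom φ) (hψ : IsEvenHom ψ) :
    Model (c.anti κ) V →ₐ[ℝ] Model (c'.anti κ) V' :=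
  Model.lift (c := c.anti κ) (c' := c'.anti κ) (V := V) (V' := V')
    ((pull κ).comp (φ.comp (ofSmooth c)))
    (Sum.elim (fun e => pull κ (φ (x (Sum.inr (Sum.inl e)))))
      (fun o => fibreLift κ φ ψ (Sum.inr (Sum.inr o))))
    (Sum.elim (fun o => pull κ (φ (x (Sum.inr (Sum.inr o)))))
      (Sum.elim (fun a => fibreLift κ φ ψ (Sum.inl a))
        (fun e => fibreLift κ φ ψ (Sum.inr (Sum.inl e)))))
    (fun s => pull_parity (hφ _ _ (hasParity_ofSmooth (c := c) s)))
    (by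
      rintro (e | o)
      · exact pull_parity (hφ _ _ (hasParity_x (Sum.inr (Sum.inl e))))
      · exact (fibreLift_parity hφ hψ (Sum.inr (Sum.inr o))).congr (by simp [CoordType.par]))
    (by
      rintro (o | a | e)
      · exact pull_parity (hφ _ _ (hasParity_x (Sum.inr (Sum.inr o))))
      · exact fibreLift_parity hφ hψ (Sum.inl a)
      · exact fibreLift_parity hφ hψ (Sum.inr (Sum.inl e)))

variable (hφ : IsEvenHom φ) (hψ : IsEvenHom ψ)

theorem antiLift_ofSmooth (s : Smooth V) :
    antiLift κ hφ hψ (ofSmooth (c.anti κ) s) = pull κ (φ (ofSmooth c s)) :=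
  lift_ofSmooth (c := c.anti κ) (c' := c'.anti κ) _ _ _ _ _ _ s

theorem antiLift_x_base_inr (a : c.Ev ⊕ c.Od) :
    antiLift κ hφ hψ (x (base κ (Sum.inr a))) = pull κ (φ (x (Sum.inr a))) := by
  rcases a with e | o
  · exact lift_x_ev (c := c.anti κ) (c' := c'.anti κ) _ _ _ _ _ _ (Sum.inl e)
  · exact lift_x_od (c := c.anti κ) (c' := c'.anti κ) _ _ _ _ _ _ (Sum.inl o)

theorem antiLift_x_fibre (b : c.Coord) :
    antiLift κ hφ hψ (x (fibre κ b)) = fibreLift κ φ ψ b := by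
  rcases b with a | e | o
  · exact lift_x_od (c := c.anti κ) (c' := c'.anti κ) _ _ _ _ _ _ (Sum.inr (Sum.inl a))
  · exact lift_x_od (c := c.anti κ) (c' := c'.anti κ) _ _ _ _ _ _ (Sum.inr (Sum.inr e))
  · exact lift_x_ev (c := c.anti κ) (c' := c'.anti κ) _ _ _ _ _ _ (Sum.inr o)

theorem antiLift_pull (f : Model c V) : antiLift κ hφ hψ (pull κ f) = pull κ (φ f) := by
  have : (antiLift κ hφ hψ).comp (pull κ) = (pull κ).comp φ :=
    hom_ext (fun s => by
      rw [AlgHom.comp_apply, AlgHom.comp_apply, pull_ofSmooth]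
      exact antiLift_ofSmooth hφ hψ s)
      fun a => by
        rw [AlgHom.comp_apply, AlgHom.comp_apply, pull_x, antiLift_x_base_inr]
  exact DFunLike.congr_fun this f

theorem antiLift_x_base (a : c.Coord) :
    antiLift κ hφ hψ (x (base κ a)) = pull κ (φ (x a)) := by
  rw [← pull_x, antiLift_pull]

theorem inr_cases (A : (c.anti κ).Ev ⊕ (c.anti κ).Od) :
    (∃ a, (Sum.inr A : (c.anti κ).Coord) = base κ (Sum.inr a)) ∨
      ∃ b, (Sum.inr A : (c.anti κ).Coord) = fibre κ b := by
  rcases A with (e | o) | (o | a | e)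
  · exact Or.inl ⟨Sum.inl e, rfl⟩
  · exact Or.inr ⟨Sum.inr (Sum.inr o), rfl⟩
  · exact Or.inl ⟨Sum.inr o, rfl⟩
  · exact Or.inr ⟨Sum.inl a, rfl⟩
  · exact Or.inr ⟨Sum.inr (Sum.inl e), rfl⟩

theorem isEvenHom_antiLift : IsEvenHom (antiLift κ hφ hψ) := by
  refine isEvenHom_of_generators (c := c.anti κ) (fun s => ?_) (fun A => ?_)
  · rw [antiLift_ofSmooth]
    exact pull_parity (hφ _ _ (hasParity_ofSmooth (c := c) s))
  · rcases inr_cases A with ⟨a, ha⟩ | ⟨b, hb⟩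
    · rw [ha, antiLift_x_base, par_base]
      exact pull_parity (hφ _ _ (hasParity_x _))
    · rw [hb, antiLift_x_fibre]
      exact (fibreLift_parity hφ hψ b).congr (par_fibre b).symm

theorem HasDeg.antiLift {k : ℝ} {F : Model (c.anti κ) V} (hF : HasDeg k F) :
    HasDeg k (antiLift κ hφ hψ F) := by
  rw [HasDeg] at *
  rw [wEuler_hom (w := fibDeg) (isEvenHom_antiLift hφ hψ) (fun A => ?_), hF, map_smul]
  rcases coord_cases A with ⟨a, rfl⟩ | ⟨a, rfl⟩
  · rw [antiLift_x_base, fibDeg_base]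
    exact hasDeg_pull _
  · rw [antiLift_x_fibre, fibDeg_fibre]
    exact fibreLift_hasDeg a

theorem antiLift_hasWeight
    (hφw : ∀ (k : ℤ) (f : Model c V), HasWeight k f → HasWeight k (φ f))
    (hψw : ∀ (k : ℤ) (f : Model c' V'), HasWeight k f → HasWeight k (ψ f))
    {k : ℤ} {F : Model (c.anti κ) V} (hF : HasWeight k F) :
    HasWeight k (antiLift κ hφ hψ F) := by
  rw [HasWeight, euler_eq] at *
  rw [wEuler_hom (w := fun a => ((c.anti κ).wt a : ℝ)) (isEvenHom_antiLift hφ hψ) (fun A => ?_), hF,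
    map_smul]
  rcases coord_cases A with ⟨a, rfl⟩ | ⟨b, rfl⟩
  · rw [antiLift_x_base, wt_base]
    exact pull_hasWeight (hφw _ _ (hasWeight_x a))
  · rw [antiLift_x_fibre]
    refine HasWeight.sum fun a => ((pull_hasWeight (hφw _ _ ((hψw _ _ (hasWeight_x a)).pd b))).mul
      (hasWeight_x (c := c'.anti κ) (fibre κ a))).congr ?_
    rw [wt_fibre, wt_fibre]
    ring

theorem schouten_pull_pull {s : ℕ} {f : Model c V} (hf : HasParity s f) (g : Model c V) :
    schouten (pull κ f) (pull κ g) = 0 := by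
  rw [schouten_apply (pull_parity hf)]
  simp [pd_fibre_pull]

/-- The homomorphism intertwines the Hamiltonian operators of `F` and of its image. -/
def Intertwines (χ : Model (c.anti κ) V →ₐ[ℝ] Model (c'.anti κ) V') (F : Model (c.anti κ) V) :
    Prop := ∀ G, χ (schouten F G) = schouten (χ F) (χ G)

/-- Functions on the base: on the fibre coordinates this is the chain rule. -/
theorem intertwines_pull (h1 : ∀ f, ψ (φ f) = f) (h2 : ∀ g, φ (ψ g) = g) {s : ℕ} {f : Model c V} (hf : HasParity s f) :
    Intertwines (antiLift κ hφ hψ) (pull κ f) := by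
  have hf' := hφ s f hf
  have d1 := (schouten_isSuperDer (pull_parity (κ := κ) hf)).comp_left (antiLift κ hφ hψ)
  have d2 := (schouten_isSuperDer (pull_parity (κ := κ) hf')).comp_right
    (isEvenHom_antiLift (κ := κ) hφ hψ)
  intro G
  rw [antiLift_pull]
  refine d1.ext d2 (fun A => ?_) G
  simp only [LinearMap.comp_apply, AlgHom.toLinearMap_apply]
  rcases coord_cases A with ⟨a, rfl⟩ | ⟨b, rfl⟩
  · rw [antiLift_x_base, schouten_pull_pull hf', ← pull_x, schouten_pull_pull hf, map_zero]
  · have e : ∀ a, schouten (pull κ (φ f)) (pull κ (φ (pd b (ψ (x a)))) * x (fibre κ a)) =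
        -((-1 : ℝ) ^ (c.par b * (s + 1)) •
          pull κ (φ (pd b (ψ (x a)) * ψ (pd a (φ f))))) := fun a => by
      have hp := fibreLift_parity_aux hφ hψ a b
      rw [schouten_isSuperDer (pull_parity hf') _ _ _ (pull_parity hp), schouten_pull_pull hf',
        zero_mul, zero_add, schouten_x_fibre (pull_parity hf'), pd_base_pull, AlgHom.id_apply,
        mul_neg, smul_neg, mul_smul_comm, smul_smul, ← pow_add, ← map_mul, map_mul φ, h2 (pd a _)]
      refine congrArg Neg.neg (sgn_smul_congr ?_ _)
      simp only [parity_simps]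
      tauto
    rw [schouten_x_fibre (pull_parity hf), pd_base_pull, antiLift_x_fibre, fibreLift, map_sum,
      map_neg, map_smul, antiLift_pull]
    simp only [e, Finset.sum_neg_distrib, ← Finset.smul_sum, ← map_sum]
    rw [← chain_rule hψ b (φ f), h1]

theorem Intertwines.symm {F G : Model (c.anti κ) V} {s t : ℕ} (hF : HasParity s F)
    (hG : HasParity t G) (h : Intertwines (antiLift κ hφ hψ) F) :
    antiLift κ hφ hψ (schouten G F) = schouten (antiLift κ hφ hψ G) (antiLift κ hφ hψ F) := by
  have hχ := isEvenHom_antiLift (κ := κ) hφ hψ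
  rw [schouten_antisymm hG hF, schouten_antisymm (hχ _ _ hG) (hχ _ _ hF), map_neg, map_smul, h G]

theorem Intertwines.smul {χ : Model (c.anti κ) V →ₐ[ℝ] Model (c'.anti κ) V'}
    {F : Model (c.anti κ) V} (r : ℝ) (h : Intertwines χ F) : Intertwines χ (r • F) := fun G => by
  rw [map_smul, schouten_smul, schouten_smul, LinearMap.smul_apply, LinearMap.smul_apply, map_smul,
    h G]

/-- The bracket with the fibre coordinate `x^*_b` is `± ∂/∂x^b` on functions on the base. -/
theorem schouten_x_fibre_pull (b : c.Coord) (f : Model c V) :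
    ∃ r : ℝ, schouten (x (fibre κ b) : Model (c.anti κ) V) (pull κ f) = pull κ (r • pd b f) := by
  refine ⟨(-1 : ℝ) ^ ((c.par b + 1) * ((c.anti κ).par (fibre κ b) + 1)), ?_⟩
  rw [schouten_apply (hasParity_x _), Finset.sum_eq_single b]
  · simp [pd_fibre_x_fibre, pd_fibre_pull, pd_base_pull]
  · intro a _ ha
    simp [pd_fibre_x_fibre, pd_fibre_pull, ha]
  · simp

/-- Induction on the fibrewise degree: a function is intertwined if its brackets with the functions
on the base are. -/
theorem intertwines_of_schouten_pull (h1 : ∀ f, ψ (φ f) = f) (h2 : ∀ g, φ (ψ g) = g) {s : ℕ}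
    {k : ℝ} (hk : k ≠ 0) {F : Model (c.anti κ) V} (hs : HasParity s F) (hF : HasDeg k F)
    (h : ∀ (t : ℕ) (f : Model c V), HasParity t f →
      Intertwines (antiLift κ hφ hψ) (schouten F (pull κ f))) :
    Intertwines (antiLift κ hφ hψ) F := by
  have hχ := isEvenHom_antiLift (κ := κ) hφ hψ
  have hs' := hχ _ _ hs
  have d1 := (schouten_isSuperDer hs).comp_left (antiLift κ hφ hψ)
  have d2 := (schouten_isSuperDer hs').comp_right hχ
  have hpull : ∀ {u t : ℕ} {G : Model (c.anti κ) V} {g : Model c V}, HasParity u G →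
      HasParity t g → antiLift κ hφ hψ (schouten G (pull κ g)) =
        schouten (antiLift κ hφ hψ G) (pull κ (φ g)) := fun hG hg => by
    rw [← antiLift_pull hφ hψ]
    exact (intertwines_pull hφ hψ h1 h2 hg).symm hφ hψ (pull_parity hg) hG
  refine fun G => d1.ext d2 (fun A => ?_) G
  simp only [LinearMap.comp_apply, AlgHom.toLinearMap_apply]
  rcases coord_cases A with ⟨a, rfl⟩ | ⟨b, rfl⟩
  · rw [← pull_x, hpull hs (hasParity_x a), antiLift_pull]
  · have hb := hasParity_x (c := c.anti κ) (V := V) (fibre κ b)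
    have hb' := hχ _ _ hb
    have hd := (hF.schouten hs (hasDeg_x_fibre b)).antiLift hφ hψ
    have hd' := (hF.antiLift hφ hψ).schouten hs' ((hasDeg_x_fibre b).antiLift hφ hψ)
    have hp := hχ _ _ (schouten_parity hs hb)
    have hp' := schouten_parity hs' hb'
    rw [← sub_eq_zero]
    refine HasDeg.eq_zero (by simpa using hk) (hp.sub hp') (hd.sub hd') fun t f' hf' => ?_
    obtain ⟨f, hf, rfl⟩ : ∃ f, HasParity t f ∧ φ f = f' := ⟨ψ f', hψ _ _ hf', h2 f'⟩
    have j := schouten_jacobi hs hb (pull κ f)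
    have j' := schouten_jacobi hs' hb' (pull κ (φ f))
    obtain ⟨r, hr⟩ := schouten_x_fibre_pull (κ := κ) b f
    have e1 : antiLift κ hφ hψ (schouten F (schouten (x (fibre κ b)) (pull κ f))) =
        schouten (antiLift κ hφ hψ F)
          (schouten (antiLift κ hφ hψ (x (fibre κ b))) (pull κ (φ f))) := by
      rw [← hpull hb hf, hr, hpull hs ((hf.pd b).smul r), antiLift_pull]
    have e2 : antiLift κ hφ hψ (schouten (x (fibre κ b)) (schouten F (pull κ f))) =
        schouten (antiLift κ hφ hψ (x (fibre κ b)))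
          (schouten (antiLift κ hφ hψ F) (pull κ (φ f))) := by
      rw [← hpull hs hf]
      exact (h t f hf).symm hφ hψ (schouten_parity hs (pull_parity hf)) hb
    rw [← sub_eq_iff_eq_add] at j j'
    have e3 : schouten (antiLift κ hφ hψ (schouten F (x (fibre κ b)))) (pull κ (φ f)) =
        schouten (schouten (antiLift κ hφ hψ F) (antiLift κ hφ hψ (x (fibre κ b))))
          (pull κ (φ f)) := by
      rw [← hpull (schouten_parity hs hb) hf, ← j, ← j', map_sub, map_smul, e1, e2]
    rw [sub_eq_add_neg, ← neg_one_smul ℝ, schouten_add, schouten_smul, LinearMap.add_apply,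
      LinearMap.smul_apply, e3, neg_one_smul, add_neg_cancel]

/-- Functions of the same nonzero degree with the same brackets with functions on the base are
equal. -/
theorem HasDeg.eq_of_schouten_pull {k : ℝ} (hk : k ≠ 0) {s : ℕ} {F G : Model (c.anti κ) V}
    (hs : HasParity s F) (ht : HasParity s G) (hF : HasDeg k F) (hG : HasDeg k G)
    (h : ∀ (t : ℕ) (f : Model c V), HasParity t f →
      Anti.schouten F (pull κ f) = Anti.schouten G (pull κ f)) : F = G := by
  refine sub_eq_zero.mp (HasDeg.eq_zero hk (hs.sub ht) (hF.sub hG) fun t f hf => ?_)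
  rw [sub_eq_add_neg, ← neg_one_smul ℝ G, schouten_add, schouten_smul, LinearMap.add_apply,
    LinearMap.smul_apply, h t f hf, neg_one_smul, add_neg_cancel]

theorem antiLift_schouten_pull (h1 : ∀ f, ψ (φ f) = f) (h2 : ∀ g, φ (ψ g) = g) {s t : ℕ}
    {F : Model (c.anti κ) V} {f' : Model c' V'} (hF : HasParity s F) (hf' : HasParity t f') :
    schouten (antiLift κ hφ hψ F) (pull κ f') =
      antiLift κ hφ hψ (schouten F (pull κ (ψ f'))) := by
  have hf := hψ _ _ hf'
  rw [(intertwines_pull hφ hψ h1 h2 hf).symm hφ hψ (pull_parity hf) hF, antiLift_pull, h2]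

theorem antiLift_theta (h1 : ∀ f, ψ (φ f) = f) (h2 : ∀ g, φ (ψ g) = g) {r : ℕ}
    {Y : Model c V →ₗ[ℝ] Model c V} {Y' : Model c' V' →ₗ[ℝ] Model c' V'} (hY : IsVF r Y)
    (hY' : IsVF r Y') (h : ∀ f, φ (Y f) = Y' (φ f)) :
    antiLift κ hφ hψ (theta κ Y) = theta κ Y' := by
  refine HasDeg.eq_of_schouten_pull one_ne_zero
    (isEvenHom_antiLift hφ hψ _ _ (theta_parity hY)) (theta_parity hY')
    ((theta_hasDeg Y).antiLift hφ hψ) (theta_hasDeg Y') fun t f' hf' => ?_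
  rw [antiLift_schouten_pull hφ hψ h1 h2 (theta_parity hY) hf', schouten_theta_pull hY,
    schouten_theta_pull hY', map_neg, antiLift_pull, h, h2]

theorem intertwines_theta (h1 : ∀ f, ψ (φ f) = f) (h2 : ∀ g, φ (ψ g) = g) {r : ℕ}
    {Y : Model c V →ₗ[ℝ] Model c V} (hY : IsVF r Y) :
    Intertwines (antiLift κ hφ hψ) (theta κ Y) := by
  refine intertwines_of_schouten_pull hφ hψ h1 h2 one_ne_zero (theta_parity hY) (theta_hasDeg Y)
    fun t f hf => ?_
  rw [schouten_theta_pull hY, ← map_neg]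
  exact intertwines_pull hφ hψ h1 h2 (hY.parity t f hf).neg

theorem antiLift_bivector (h1 : ∀ f, ψ (φ f) = f) (h2 : ∀ g, φ (ψ g) = g)
    {B : Model c V →ₗ[ℝ] Model c V →ₗ[ℝ] Model c V}
    {B' : Model c' V' →ₗ[ℝ] Model c' V' →ₗ[ℝ] Model c' V'} (hB : IsPB B) (hB' : IsPB B')
    (h : ∀ f g, φ (B f g) = B' (φ f) (φ g)) :
    antiLift κ hφ hψ (bivector κ B) = bivector κ B' := by
  refine HasDeg.eq_of_schouten_pull two_ne_zero
    (isEvenHom_antiLift hφ hψ _ _ (bivector_parity hB)) (bivector_parity hB')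
    ((bivector_hasDeg B).antiLift hφ hψ) (bivector_hasDeg B') fun t f' hf' => ?_
  have hf := hψ _ _ hf'
  rw [antiLift_schouten_pull hφ hψ h1 h2 (bivector_parity hB) hf', schouten_bivector_pull hB hf,
    schouten_bivector_pull hB' hf', map_neg, map_smul,
    antiLift_theta hφ hψ h1 h2 (hB.isVF hf) (hB'.isVF hf') fun g => by rw [h, h2]]

theorem intertwines_bivector (h1 : ∀ f, ψ (φ f) = f) (h2 : ∀ g, φ (ψ g) = g)
    {B : Model c V →ₗ[ℝ] Model c V →ₗ[ℝ] Model c V} (hB : IsPB B) :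
    Intertwines (antiLift κ hφ hψ) (bivector κ B) := by
  refine intertwines_of_schouten_pull hφ hψ h1 h2 two_ne_zero (bivector_parity hB)
    (bivector_hasDeg B) fun t f hf => ?_
  rw [schouten_bivector_pull hB hf, ← neg_smul]
  exact (intertwines_theta hφ hψ h1 h2 (hB.isVF hf)).smul _

end lift

end Anti

/-! ### Restriction to smaller domains -/

namespace Model

variable {c : CoordType} {V V' : Opens (Fin c.n → ℝ)} (h : V' ≤ V)

theorem res_ofSmooth (s : Smooth V) : res h (ofSmooth c s) = ofSmooth c (Smooth.res h s) := rfl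

theorem res_x (a : c.Coord) : res h (x a) = x a := by
  rcases a with a | e | o <;> rfl

theorem isEvenHom_res : IsEvenHom (res (c := c) h) :=
  isEvenHom_of_generators (fun s => hasParity_ofSmooth (c := c) (Smooth.res h s)) fun a => by
    rw [res_x]
    exact hasParity_x _

theorem res_pd (a : c.Coord) (f : Model c V) : res h (pd a f) = pd a (res h f) :=
  ((pd_isSuperDer a).comp_left (res h)).ext ((pd_isSuperDer a).comp_right (isEvenHom_res h))
    (fun b => by
      simp only [LinearMap.comp_apply, AlgHom.toLinearMap_apply, res_x, pd_x]
      split_ifs <;> simp) f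

end Model

namespace Anti

open Model

section res

variable {c : CoordType} {κ : ℤ} {V V' : Opens (Fin c.n → ℝ)} (h : V' ≤ V)

theorem res_pull (f : Model c V) :
    res (c := c.anti κ) h (pull κ f) = pull κ (res h f) := by
  have : (res (c := c.anti κ) h).comp (pull κ) = (pull κ).comp (res h) :=
    hom_ext (fun s => by
      rw [AlgHom.comp_apply, AlgHom.comp_apply, res_ofSmooth, pull_ofSmooth, pull_ofSmooth]
      rfl)
      fun a => by
        rw [AlgHom.comp_apply, AlgHom.comp_apply, res_x, pull_x, pull_x]
        exact res_x (c := c.anti κ) h _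
  exact DFunLike.congr_fun this f

theorem res_schouten {s : ℕ} {F : Model (c.anti κ) V} (hF : HasParity s F)
    (G : Model (c.anti κ) V) :
    res (c := c.anti κ) h (schouten F G) =
      schouten (res (c := c.anti κ) h F) (res (c := c.anti κ) h G) := by
  rw [schouten_apply hF, schouten_apply (isEvenHom_res (c := c.anti κ) h _ _ hF)]
  simp only [map_sum, map_sub, map_smul, map_mul, res_pd]

theorem res_theta {Y : Model c V →ₗ[ℝ] Model c V} {Y' : Model c V' →ₗ[ℝ] Model c V'}
    (hY : ∀ f, res h (Y f) = Y' (res h f)) :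
    res (c := c.anti κ) h (theta κ Y) = theta κ Y' := by
  simp only [theta, map_neg, map_sum, map_mul, res_pull, hY, res_x]

theorem res_bivector {B : Model c V →ₗ[ℝ] Model c V →ₗ[ℝ] Model c V}
    {B' : Model c V' →ₗ[ℝ] Model c V' →ₗ[ℝ] Model c V'}
    (hB : ∀ f g, res h (B f g) = B' (res h f) (res h g)) :
    res (c := c.anti κ) h (bivector κ B) = bivector κ B' := by
  simp only [bivector, map_smul, map_sum, map_mul, res_pull, hB, res_x]

theorem antiLift_res {c' : CoordType} {W W' : Opens (Fin c'.n → ℝ)} (hW : W' ≤ W)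
    {φ : Model c V →ₐ[ℝ] Model c' W} {ψ : Model c' W →ₐ[ℝ] Model c V}
    {φ' : Model c V' →ₐ[ℝ] Model c' W'} {ψ' : Model c' W' →ₐ[ℝ] Model c V'}
    (hφ : IsEvenHom φ) (hψ : IsEvenHom ψ) (hφ' : IsEvenHom φ') (hψ' : IsEvenHom ψ')
    (h1 : ∀ f, res hW (φ f) = φ' (res h f)) (h2 : ∀ f, res h (ψ f) = ψ' (res hW f))
    (F : Model (c.anti κ) V) :
    res (c := c'.anti κ) hW (antiLift κ hφ hψ F) =
      antiLift κ hφ' hψ' (res (c := c.anti κ) h F) := by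
  have : (res (c := c'.anti κ) hW).comp (antiLift κ hφ hψ) =
      (antiLift κ hφ' hψ').comp (res (c := c.anti κ) h) := by
    refine hom_ext (c := c.anti κ) (fun s => ?_) (fun A => ?_)
    · rw [AlgHom.comp_apply, AlgHom.comp_apply, antiLift_ofSmooth, res_pull, h1]
      exact (antiLift_ofSmooth hφ' hψ' (Smooth.res h s)).symm
    · rw [AlgHom.comp_apply, AlgHom.comp_apply, res_x]
      rcases inr_cases A with ⟨a, ha⟩ | ⟨b, hb⟩
      · rw [ha, antiLift_x_base, antiLift_x_base, res_pull, h1, res_x]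
      · rw [hb, antiLift_x_fibre, antiLift_x_fibre]
        simp only [fibreLift, map_sum, map_mul, res_pull, h1, res_pd, h2, res_x]
  exact DFunLike.congr_fun this F

end res

/-! ### The cocycle condition -/

theorem antiLift_self {c : CoordType} {κ : ℤ} {V : Opens (Fin c.n → ℝ)}
    {φ ψ : Model c V →ₐ[ℝ] Model c V} (hφ : IsEvenHom φ) (hψ : IsEvenHom ψ)
    (h1 : ∀ f, φ f = f) (h2 : ∀ f, ψ f = f) (F : Model (c.anti κ) V) :
    antiLift κ hφ hψ F = F := by
  have : antiLift κ hφ hψ = AlgHom.id ℝ _ := by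
    refine hom_ext (c := c.anti κ) (fun s => ?_) (fun A => ?_)
    · rw [antiLift_ofSmooth, h1, pull_ofSmooth, AlgHom.id_apply]
    · rw [AlgHom.id_apply]
      rcases inr_cases A with ⟨a, ha⟩ | ⟨b, hb⟩
      · rw [ha, antiLift_x_base, h1, pull_x]
      · rw [hb, antiLift_x_fibre, fibreLift, Finset.sum_eq_single b]
        · rw [h1, h2, pd_x, if_pos rfl, map_one, one_mul]
        · intro a _ ha
          rw [h1, h2, pd_x, if_neg ha.symm, map_zero, zero_mul]
        · simp
  exact DFunLike.congr_fun this F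

theorem antiLift_antiLift {c₁ c₂ c₃ : CoordType} {κ : ℤ} {V₁ : Opens (Fin c₁.n → ℝ)}
    {V₂ : Opens (Fin c₂.n → ℝ)} {V₃ : Opens (Fin c₃.n → ℝ)}
    {φ : Model c₂ V₂ →ₐ[ℝ] Model c₁ V₁} {ψ : Model c₁ V₁ →ₐ[ℝ] Model c₂ V₂}
    {φ' : Model c₃ V₃ →ₐ[ℝ] Model c₂ V₂} {ψ' : Model c₂ V₂ →ₐ[ℝ] Model c₃ V₃}
    {φ'' : Model c₃ V₃ →ₐ[ℝ] Model c₁ V₁} {ψ'' : Model c₁ V₁ →ₐ[ℝ] Model c₃ V₃}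
    (hφ : IsEvenHom φ) (hψ : IsEvenHom ψ) (hφ' : IsEvenHom φ') (hψ' : IsEvenHom ψ')
    (hφ'' : IsEvenHom φ'') (hψ'' : IsEvenHom ψ'')
    (h1 : ∀ f, φ (φ' f) = φ'' f) (h2 : ∀ f, ψ' (ψ f) = ψ'' f) (h3 : ∀ f, φ' (ψ' f) = f)
    (F : Model (c₃.anti κ) V₃) :
    antiLift κ hφ hψ (antiLift κ hφ' hψ' F) = antiLift κ hφ'' hψ'' F := by
  have : (antiLift κ hφ hψ).comp (antiLift κ hφ' hψ') = antiLift κ hφ'' hψ'' := by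
    refine hom_ext (c := c₃.anti κ) (fun s => ?_) (fun A => ?_)
    · rw [AlgHom.comp_apply, antiLift_ofSmooth, antiLift_ofSmooth, antiLift_pull, h1]
    · rw [AlgHom.comp_apply]
      rcases inr_cases A with ⟨a, ha⟩ | ⟨b, hb⟩
      · rw [ha, antiLift_x_base, antiLift_x_base, antiLift_pull, h1]
      · rw [hb, antiLift_x_fibre, antiLift_x_fibre, fibreLift, fibreLift, map_sum]
        simp only [map_mul, antiLift_pull, antiLift_x_fibre, fibreLift, Finset.mul_sum]
        rw [Finset.sum_comm]
        refine Finset.sum_congr rfl fun d _ => ?_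
        rw [← h2, chain_rule hψ' b, map_sum, map_sum, Finset.sum_mul]
        refine Finset.sum_congr rfl fun a _ => ?_
        rw [map_mul, ← h1, ← h1, h3, map_mul, mul_assoc]
  exact DFunLike.congr_fun this F

end Anti

/-! ### The anticotangent bundle of a graded manifold -/

namespace GradedAtlas

open Model Anti

variable {X : Type*} [TopologicalSpace X] {M : GradedAtlas X}

theorem IsGradedManifold.isEvenHom_tr (hM : M.IsGradedManifold) (i j : M.ι) (W : Opens X)
    (h : M.Small i j W) : IsEvenHom (M.tr i j W h) := fun s f hf => hM.tr_parity i j W h s f hf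

theorem IsGradedManifold.tr_tr_symm (hM : M.IsGradedManifold) (i j : M.ι) (W : Opens X)
    (h : M.Small i j W) (f : M.Fn i W) : M.tr i j W h (M.tr j i W h.symm f) = f := by
  have hi : M.Small i i W := fun _ hx => ⟨(h hx).1, (h hx).1⟩
  rw [hM.tr_tr i j i W h h.symm hi, hM.tr_self]

theorem anticotangent_isGradedManifold (hM : M.IsGradedManifold) (κ : ℤ) :
    (anticotangent hM κ).IsGradedManifold where
  cover := hM.cover
  tr_parity i j W h s F hF := isEvenHom_antiLift (hM.isEvenHom_tr i j W h)
    (hM.isEvenHom_tr j i W h.symm) s F hF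
  tr_weight i j W h _ _ hF := antiLift_hasWeight (hM.isEvenHom_tr i j W h)
    (hM.isEvenHom_tr j i W h.symm) (hM.tr_weight i j W h) (hM.tr_weight j i W h.symm) hF
  tr_res i j W h W' h' hW F := antiLift_res (M.img_mono j hW) (M.img_mono i hW)
    (hM.isEvenHom_tr i j W h) (hM.isEvenHom_tr j i W h.symm) (hM.isEvenHom_tr i j W' h')
    (hM.isEvenHom_tr j i W' (Small.symm (M := M) h')) (hM.tr_res i j W h W' h' hW)
    (hM.tr_res j i W (Small.symm (M := M) h) W' (Small.symm (M := M) h') hW) F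
  tr_self i W h F := antiLift_self (hM.isEvenHom_tr i i W h) (hM.isEvenHom_tr i i W h.symm)
    (hM.tr_self i W h) (hM.tr_self i W h.symm) F
  tr_tr i j k W hij hjk hik F := antiLift_antiLift (hM.isEvenHom_tr i j W hij)
    (hM.isEvenHom_tr j i W hij.symm) (hM.isEvenHom_tr j k W hjk) (hM.isEvenHom_tr k j W hjk.symm)
    (hM.isEvenHom_tr i k W hik) (hM.isEvenHom_tr k i W hik.symm)
    (hM.tr_tr i j k W hij hjk hik)
    (hM.tr_tr k j i W (Small.symm (M := M) hjk) (Small.symm (M := M) hij)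
      (Small.symm (M := M) hik))
    (hM.tr_tr_symm j k W hjk) F

/-! ### The odd double -/

section oddDouble

variable {Q : M.Operator} {B : M.BiOperator} {q p : ℤ}

theorem IsGradedQPManifold.isVF (hM : M.IsGradedQPManifold Q B q p) (i : M.ι) (W : Opens X) :
    IsVF 1 (Q i W) :=
  ⟨fun s f g hf => hM.isHomological.leibniz i W s f g hf,
    fun s f hf => hM.isHomological.parity i W s f hf⟩

theorem IsGradedQPManifold.isPB (hM : M.IsGradedQPManifold Q B q p) (i : M.ι) (W : Opens X) :
    IsPB (B i W) :=
  ⟨hM.isPoissonBracket.parity i W, hM.isPoissonBracket.antisymm i W,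
    hM.isPoissonBracket.jacobi i W, hM.isPoissonBracket.leibniz i W⟩

/-- The even function `Q' + lam P` whose Hamiltonian field is the field of the odd double. -/
def doubleHamiltonian (κ : ℤ) (Q : M.Operator) (B : M.BiOperator) (lam : ℝ) (i : M.ι)
    (W : Opens X) : Model ((M.coord i).anti κ) (M.img i W) :=
  theta κ (Q i W) + lam • bivector κ (B i W)

theorem oddDouble_eq (hM : M.IsGradedManifold) (κ : ℤ) (lam : ℝ) :
    oddDouble hM κ Q B lam = fun i W => schouten (doubleHamiltonian κ Q B lam i W) := by
  funext i W
  exact ((schouten_add _ _).trans (congrArg _ (schouten_smul _ _))).symm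

theorem doubleHamiltonian_parity (hM : M.IsGradedQPManifold Q B q p) (κ : ℤ) (lam : ℝ) (i : M.ι)
    (W : Opens X) : HasParity 0 (doubleHamiltonian κ Q B lam i W) :=
  (theta_parity_zero (hM.isVF i W)).add ((bivector_parity (hM.isPB i W)).smul lam)

theorem doubleHamiltonian_hasWeight (hM : M.IsGradedQPManifold Q B q p) (lam : ℝ) (i : M.ι)
    (W : Opens X) : HasWeight (q + (q - p)) (doubleHamiltonian (q - p) Q B lam i W) :=
  (theta_hasWeight (hM.hasWeight i W)).add (((bivector_hasWeight
    (hM.bracketHasWeight i W)).smul lam).congr (by ring))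

theorem res_doubleHamiltonian (hM : M.IsGradedQPManifold Q B q p) (κ : ℤ) (lam : ℝ) (i : M.ι)
    {W' W : Opens X} (hW : W' ≤ W) :
    Model.res (c := (M.coord i).anti κ) (M.img_mono i hW) (doubleHamiltonian κ Q B lam i W) =
      doubleHamiltonian κ Q B lam i W' := by
  rw [doubleHamiltonian, map_add, map_smul,
    res_theta (M.img_mono i hW) (hM.isHomological.map_res i W' W hW),
    res_bivector (M.img_mono i hW) (hM.isPoissonBracket.map_res i W' W hW)]
  rfl

/-- The function `Q' + lam P` is globally defined on the anticotangent bundle. -/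
theorem antiLift_doubleHamiltonian (hM : M.IsGradedQPManifold Q B q p) (κ : ℤ) (lam : ℝ)
    (i j : M.ι) (W : Opens X) (h : M.Small i j W) :
    antiLift κ (hM.isGradedManifold.isEvenHom_tr i j W h)
        (hM.isGradedManifold.isEvenHom_tr j i W h.symm) (doubleHamiltonian κ Q B lam j W) =
      doubleHamiltonian κ Q B lam i W := by
  have hG := hM.isGradedManifold
  rw [doubleHamiltonian, map_add, map_smul,
    antiLift_theta _ _ (hG.tr_tr_symm j i W h.symm) (hG.tr_tr_symm i j W h) (hM.isVF j W)
      (hM.isVF i W) (hM.isHomological.map_tr i j W h),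
    antiLift_bivector _ _ (hG.tr_tr_symm j i W h.symm) (hG.tr_tr_symm i j W h) (hM.isPB j W)
      (hM.isPB i W) (hM.isPoissonBracket.map_tr i j W h)]
  rfl

theorem intertwines_doubleHamiltonian (hM : M.IsGradedQPManifold Q B q p) (κ : ℤ) (lam : ℝ)
    (i j : M.ι) (W : Opens X) (h : M.Small i j W) :
    Intertwines (antiLift κ (hM.isGradedManifold.isEvenHom_tr i j W h)
      (hM.isGradedManifold.isEvenHom_tr j i W h.symm)) (doubleHamiltonian κ Q B lam j W) := by
  have hG := hM.isGradedManifold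
  have i1 := intertwines_theta (κ := κ) (hG.isEvenHom_tr i j W h) (hG.isEvenHom_tr j i W h.symm)
    (hG.tr_tr_symm j i W h.symm) (hG.tr_tr_symm i j W h) (hM.isVF j W)
  have i2 := (intertwines_bivector (κ := κ) (hG.isEvenHom_tr i j W h)
    (hG.isEvenHom_tr j i W h.symm) (hG.tr_tr_symm j i W h.symm) (hG.tr_tr_symm i j W h)
    (hM.isPB j W)).smul lam
  intro F
  rw [doubleHamiltonian, map_add, schouten_add, schouten_add, LinearMap.add_apply,
    LinearMap.add_apply, map_add, i1 F, i2 F]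

theorem oddDouble_isHomological (hM : M.IsGradedQPManifold Q B q p) (κ : ℤ) (lam : ℝ) :
    (anticotangent hM.isGradedManifold κ).IsHomological
      (oddDouble hM.isGradedManifold κ Q B lam) := by
  rw [oddDouble_eq]
  exact
  { parity := fun i W s F hF =>
      (schouten_parity (doubleHamiltonian_parity hM κ lam i W) hF).congr (by omega)
    leibniz := fun i W s F G hF =>
      schouten_isSuperDer (doubleHamiltonian_parity hM κ lam i W) s F G hF
    map_res := fun i W' W hW F =>
      (res_schouten (M.img_mono i hW) (doubleHamiltonian_parity hM κ lam i W) F).trans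
        (congrArg (fun H => schouten H _) (res_doubleHamiltonian hM κ lam i hW))
    map_tr := fun i j W h F => (intertwines_doubleHamiltonian hM κ lam i j W h F).trans
      (congrArg (fun H => schouten H _) (antiLift_doubleHamiltonian hM κ lam i j W h))
    sq_zero := fun i W F => schouten_sq_zero (hM.isVF i W) (hM.isHomological.sq_zero i W)
      (hM.isPB i W) (hM.derivation i W) lam F }

theorem oddDouble_hasWeight (hM : M.IsGradedQPManifold Q B q p) (lam : ℝ) :
    (anticotangent hM.isGradedManifold (q - p)).OperatorHasWeight q
      (oddDouble hM.isGradedManifold (q - p) Q B lam) := by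
  rw [oddDouble_eq]
  exact fun i W k F hF => (schouten_hasWeight (doubleHamiltonian_parity hM _ lam i W)
    (doubleHamiltonian_hasWeight hM lam i W) hF).congr (by ring)

end oddDouble

end GradedAtlas

theorem CoordType.Strict.anti {c : CoordType} (h : c.Strict) {κ : ℤ} (hκ : ∀ o, c.wOd o ≠ κ) :
    (c.anti κ).Strict := by
  rintro (e | o)
  · simpa using h e
  · have := hκ o
    simp only [Sum.elim_inr, mul_one]
    omega

end GradedMfd

end

/-- The odd double of a graded QP-manifold `M`: the anticotangent bundle with total weight
`w + (q - p) d` and the field `X_{Q'} + lam X_P` is a graded Q-manifold, with homological field of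
weight `q`. -/
theorem theorem5p2 {X : Type*} [TopologicalSpace X] (M : GradedMfd.GradedAtlas X)
    (Q : M.Operator) (B : M.BiOperator) (q p : ℤ) (hM : M.IsGradedQPManifold Q B q p) (lam : ℝ) :
    (GradedMfd.GradedAtlas.anticotangent hM.isGradedManifold (q - p)).IsGradedQManifold
        (GradedMfd.GradedAtlas.oddDouble hM.isGradedManifold (q - p) Q B lam) q ∧
      ((∀ i, (M.coord i).Strict) → (∀ i (o : (M.coord i).Od), (M.coord i).wOd o ≠ q - p) →
        ∀ i, ((GradedMfd.GradedAtlas.anticotangent hM.isGradedManifold (q - p)).coord i).Strict) :=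
  ⟨⟨GradedMfd.GradedAtlas.anticotangent_isGradedManifold hM.isGradedManifold (q - p),
    GradedMfd.GradedAtlas.oddDouble_isHomological hM (q - p) lam,
    GradedMfd.GradedAtlas.oddDouble_hasWeight hM lam⟩, fun h h' i => (h i).anti (h' i)⟩
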